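/- **Differential polynomials.** Let $J[\mathbf u]=\mathbb R[u_{(0)},u_{(1)},u_{(2)},\dots]$, write $u=u_{(0)}$, let $D$ be the total derivative ($Du_{(i)}=u_{(i+1)}$) and $\mathcal E(\mathfrak p)=\sum_\ell(-1)^\ell D^\ell(\partial\mathfrak p/\partial u_{(\ell)})$ the Euler operator. For $\mathfrak p\in D(J[\mathbf u])$ let $D^{-1}\mathfrak p$ be its unique primitive without constant term. For a smooth function $f$ of $s$ let $\mathfrak p|_{j(f)}$ be the function obtained by substituting $u_{(i)}=f^{(i)}$; for functions of $(s,t)$ only $s$-derivatives are substituted, $\mathfrak p|_{j_s(f)}$. Let $$P[\mathbf u]=\{\mathfrak p:\ \mathcal E(uD^3\mathfrak p+4u^2D\mathfrak p)=0\},\qquad \mathcal D(\mathfrak w)=D^3\mathfrak w+2uD\mathfrak w+u_{(1)}\mathfrak w,$$ $$\mathcal J(\mathfrak q)=D^3\mathfrak q+8uD\mathfrak q+7u_{(1)}\mathfrak q+2(u_{(2)}+4u^2)D^{-1}\mathfrak q+2D^{-1}(uD^2\mathfrak q+4u^2\mathfrak q)\qquad(\mathfrak q\in D(P[\mathbf u])),$$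 and, for $\mathfrak p\in P[\mathbf u]$, $$\begin{aligned}\mathcal S(\mathfrak p)={}&\tfrac19u_{(1)}D^{-1}(uD^3\mathfrak p+4u^2D\mathfrak p)+\tfrac19(20u^2u_{(1)}+25u_{(1)}u_{(2)}+10uu_{(3)}+u_{(5)})\mathfrak p\\&+\left(\tfrac32+\tfrac{16}9u^3+\tfrac{71}{18}u_{(1)}^2+\tfrac{41}9uu_{(2)}+\tfrac{13}{18}u_{(4)}\right)D\mathfrak p+\left(\tfrac{59}9uu_{(1)}+\tfrac{35}{18}u_{(3)}\right)D^2\mathfrak p\\&+\left(2u^2+\tfrac{49}{18}u_{(2)}\right)D^3\mathfrak p+2u_{(1)}D^4\mathfrak p+\tfrac23uD^5\mathfrak p+\tfrac1{18}D^7\mathfrak p,\\ \mathcal M(\mathfrak p)={}&-\tfrac19D^{-1}(uD^3\mathfrak p+4u^2D\mathfrak p)-\left(\tfrac19u_{(2)}+\tfrac49u^2\right)\mathfrak p-\left(\tfrac12+\tfrac7{18}u_{(1)}\right)D\mathfrak p-\tfrac49uD^2\mathfrak p-\tfrac1{18}D^4\mathfrak p.\end{aligned}$$ **The hierarchy.**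 Put $\mathfrak h_0=1$, $\mathfrak h_1=u_{(2)}+4u^2$, $\mathfrak h_{n+2}=\mathcal J\mathcal D\mathfrak h_n$ and $\mathfrak q_n=D^{-1}\mathcal D\mathfrak h_n$. The $n$-th Kaup–Kupershmidt equation is $\mathcal K_n:\ \kappa_t+(\mathcal D\mathfrak h_n)|_{j_s(\kappa)}=0$. Put $\mathfrak w_0=0$, $\mathfrak w_1=\frac12$, $\mathfrak w_n=\mathfrak q_{n-2}$ for $n\ge2$, $\ell_n=[\frac n2]-\frac12(1+(-1)^n)$, and $$\lambda_n=\tfrac12(1+(-1)^n)(-27)^{[n/2]},\qquad \mathfrak v_n=18\sum_{h=0}^{\ell_n}(-27)^h\mathfrak w_{n-2h}\quad(\mathfrak v_0=0).$$ **Curves.** A smooth curve $\gamma:\mathbb R\to\mathbb{RP}^2$ without inflection points has a unique lift $\Gamma$ to $\mathbb R^3\setminus\{0\}$ with $\det(\Gamma,\Gamma',\Gamma'')=1$, and then $\Gamma'''=a\Gamma+b\Gamma'$. The curve is generic of unit speed if $a-b'/2\equiv1$; its projective curvature is then $k=-b/2$, and its canonical frame is $F_0=\Gamma$, $F_1=\Gamma'$,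 $F_2=\Gamma''-\frac b2\Gamma$. A motion on an open interval $I$ is a smooth map $\gamma:\mathbb R\times I\to\mathbb{RP}^2$, $(s,t)\mapsto\gamma(s,t)$, such that every $\gamma_{[t]}=\gamma(\cdot,t)$ is generic of unit speed; its curvature is $\kappa(s,t)=k_{[t]}(s)$. **Local vector fields.** For $\mathfrak p\in P[\mathbf u]$ and $\lambda\in\mathbb R$, the local vector field $X_{\mathfrak p,\lambda}$ with potential $\mathfrak p$ and spectral parameter $\lambda$ assigns to a generic unit-speed curve $\gamma$ with curvature $k$ the field of tangent vectors to $\mathbb{RP}^2$ along $\gamma$ represented, modulo $F_0$, by $$\left(\mathcal M(\mathfrak p)|_{j(k)}-\lambda\right)F_1+\mathfrak p|_{j(k)}F_2 .$$ An integral curve of $X_{\mathfrak p,\lambda}$ on $I$ is a motion $\gamma$ on $I$ with $\partial_t\gamma=X_{\mathfrak p,\lambda}(\gamma_{[t]})$ for all $t\in I$, i.e. $\partial_tF_0\equiv(\mathcal M(\mathfrak p)|_{j_s(\kappa)}-\lambda)F_1+\mathfrak p|_{j_s(\kappa)}F_2 \pmod{F_0}$. **Theorem.** For every $n\in\mathbb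 N=\{0,1,2,\dots\}$: 1. $\mathcal D\mathfrak h_n$ is a total derivative, so $\mathcal D\mathfrak h_n=D\mathfrak q_n$, and $\mathfrak q_n\in P[\mathbf u]$ (so the recursion makes sense); moreover $\mathfrak v_n\in P[\mathbf u]$. 2. $\mathcal S(\mathfrak v_n)+\lambda_nu_{(1)}=\mathcal D\mathfrak h_n$; that is, the evolution equation $\kappa_t+\mathcal S(\mathfrak v_n)|_{j_s(\kappa)}+\lambda_n\kappa_s=0$ induced by $X_{\mathfrak v_n,\lambda_n}$ is $\mathcal K_n$. 3. The curvature of every integral curve of $X_{\mathfrak v_n,\lambda_n}$, on any open interval $I$, is a smooth solution of $\mathcal K_n$ on $\mathbb R\times I$. 4. Conversely, let $I$ be an open interval, $t_0\in I$, $\kappa$ a smooth solution of $\mathcal K_n$ on $\mathbb R\times I$, and $\gamma_0$ a generic unit-speed curve with curvature $\kappa(\cdot,t_0)$. Then there is exactly one integral curve $\gamma$ of $X_{\mathfrak v_n,\lambda_n}$ on $I$ with curvature $\kappa$ and $\gamma(\cdot,t_0)=\gamma_0$. -/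

import Mathlib

open scoped ContDiff

noncomputable section

namespace KK

/-! ### Polynomial differential functions -/

/-- The algebra `J[u]` of polynomial differential functions: real polynomials in the jet
coordinates `u_(0), u_(1), u_(2), …`, with `MvPolynomial.X i` standing for `u_(i)`. -/
abbrev DiffPoly : Type := MvPolynomial ℕ ℝ

/-- The jet coordinate `u_(i)`. -/
abbrev u (i : ℕ) : DiffPoly := MvPolynomial.X i

/-- A real constant as a polynomial differential function. -/
abbrev c (r : ℝ) : DiffPoly := MvPolynomial.C r

/-- The value `𝔭|_{j(f)}` at `s` of a polynomial differential function on the prolongation of `f`. -/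
def onJet (p : DiffPoly) (f : ℝ → ℝ) (s : ℝ) : ℝ :=
  MvPolynomial.eval (fun i => iteratedDeriv i f s) p

/-- The total derivative, `D 𝔭 = ∑ ∂𝔭/∂u_(i) · u_(i+1)`. -/
def D : Derivation ℝ DiffPoly DiffPoly :=
  MvPolynomial.mkDerivation ℝ (fun i => u (i + 1))

/-- The Euler operator, `ℰ(𝔭) = ∑ (-1)^l D^l (∂𝔭/∂u_(l))`; only the variables that occur in `𝔭`
contribute to the sum. -/
def euler (p : DiffPoly) : DiffPoly :=
  ∑ l ∈ p.vars, (-1) ^ l * (D^[l] (MvPolynomial.pderiv l p))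

open Classical in
/-- `D⁻¹ 𝔭`: the (unique) primitive of `𝔭` with respect to the total derivative which has no
constant term. The value is `0` if `𝔭` is not a total derivative. -/
def Dinv (p : DiffPoly) : DiffPoly :=
  if h : ∃ g : DiffPoly, D g = p ∧ MvPolynomial.constantCoeff g = 0 then h.choose else 0

/-- `u D³𝔭 + 4 u² D𝔭`. -/
def potentialDensity (p : DiffPoly) : DiffPoly :=
  u 0 * D^[3] p + 4 * u 0 ^ 2 * D p

/-- The space `P[u]` of the `𝔭` such that `ℰ(u D³𝔭 + 4 u² D𝔭) = 0`. -/
def potentials : Set DiffPoly :=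
  {p | euler (potentialDensity p) = 0}

/-- `𝒟(𝔴) = D³𝔴 + 2 u D𝔴 + u_(1) 𝔴`. -/
def opD (w : DiffPoly) : DiffPoly :=
  D^[3] w + 2 * u 0 * D w + u 1 * w

/-- `𝒥(𝔮) = D³𝔮 + 8 u D𝔮 + 7 u_(1) 𝔮 + 2 (u_(2) + 4u²) D⁻¹𝔮 + 2 D⁻¹(u D²𝔮 + 4 u² 𝔮)`. -/
def opJ (q : DiffPoly) : DiffPoly :=
  D^[3] q + 8 * u 0 * D q + 7 * u 1 * q + 2 * (u 2 + 4 * u 0 ^ 2) * Dinv q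
    + 2 * Dinv (u 0 * D^[2] q + 4 * u 0 ^ 2 * q)

/-- The operator `𝒮`, which governs the evolution of the projective curvature. -/
def opS (p : DiffPoly) : DiffPoly :=
  c (1 / 9) * u 1 * Dinv (potentialDensity p)
    + c (1 / 9) * (20 * u 0 ^ 2 * u 1 + 25 * u 1 * u 2 + 10 * u 0 * u 3 + u 5) * p
    + (c (3 / 2) + c (16 / 9) * u 0 ^ 3 + c (71 / 18) * u 1 ^ 2 + c (41 / 9) * u 0 * u 2
        + c (13 / 18) * u 4) * D p
    + (c (59 / 9) * u 0 * u 1 + c (35 / 18) * u 3) * D^[2] p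
    + (2 * u 0 ^ 2 + c (49 / 18) * u 2) * D^[3] p
    + 2 * u 1 * D^[4] p
    + c (2 / 3) * u 0 * D^[5] p
    + c (1 / 18) * D^[7] p

/-- The operator `ℳ¹₀`, which gives the tangential velocity of a local motion in terms of the
normal velocity. -/
def opM (p : DiffPoly) : DiffPoly :=
  - c (1 / 9) * Dinv (potentialDensity p)
    - (c (1 / 9) * u 2 + c (4 / 9) * u 0 ^ 2) * p
    - (c (1 / 2) + c (7 / 18) * u 1) * D p
    - c (4 / 9) * u 0 * D^[2] p
    - c (1 / 18) * D^[4] p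

/-! ### The Kaup–Kupershmidt hierarchy -/

/-- The sequence `𝔥_n`: `𝔥_0 = 1`, `𝔥_1 = u_(2) + 4u²`, `𝔥_{n+2} = 𝒥 𝒟 𝔥_n`. -/
def h : ℕ → DiffPoly
  | 0 => 1
  | 1 => u 2 + 4 * u 0 ^ 2
  | n + 2 => opJ (opD (h n))

/-- The sequence `𝔮_n = D⁻¹ 𝒟 𝔥_n`. -/
def q (n : ℕ) : DiffPoly := Dinv (opD (h n))

/-- `𝔴_0 = 0`, `𝔴_1 = 1/2`, `𝔴_n = 𝔮_{n-2}` for `n > 1`. -/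
def w : ℕ → DiffPoly
  | 0 => 0
  | 1 => c (1 / 2)
  | n + 2 => q n

/-- `ℓ_n = [n/2] - (1 + (-1)^n)/2`. -/
def ell (n : ℕ) : ℤ := ((n / 2 : ℕ) : ℤ) - (if Even n then 1 else 0)

/-- The spectral parameter `λ_n = (1 + (-1)^n)/2 · (-27)^[n/2]`. -/
def lam (n : ℕ) : ℝ := (1 + (-1) ^ n) / 2 * (-27) ^ (n / 2)

/-- The potential `𝔳_n = 18 ∑_{j=0}^{ℓ_n} (-27)^j 𝔴_{n-2j}` (the sum is empty if `n = 0`). -/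
def v (n : ℕ) : DiffPoly :=
  18 * ∑ j ∈ Finset.range (ell n + 1).toNat, (-27) ^ j * w (n - 2 * j)

/-- `κ` is a smooth solution on `ℝ × I` of the evolution equation `κ_t + 𝔣|_{j_s(κ)} = 0`; here
`κ s t` is the value at the point `s` and the time `t`. -/
def IsSolution (f : DiffPoly) (I : Set ℝ) (κ : ℝ → ℝ → ℝ) : Prop :=
  ContDiffOn ℝ ∞ (fun x : ℝ × ℝ => κ x.1 x.2) (Set.univ ×ˢ I) ∧
    ∀ s, ∀ t ∈ I, deriv (fun τ => κ s τ) t + onJet f (fun σ => κ σ t) s = 0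

/-! ### Curves in the projective plane -/

/-- Vectors of `ℝ³`. -/
abbrev V3 : Type := Fin 3 → ℝ

/-- The real projective plane. -/
abbrev RP2 : Type := Projectivization ℝ V3

/-- The determinant of three vectors of `ℝ³`. -/
def det3 (x y z : V3) : ℝ := Matrix.det (Matrix.of ![x, y, z])

/-- `Γ` is a smooth lift of `γ` with `Det(Γ, Γ', Γ'') = 1`. A smooth curve has such a lift if and
only if it has no inflection points, and then the lift is unique. -/
structure IsCanonicalLift (γ : ℝ → RP2) (Γ : ℝ → V3) : Prop where
  smooth : ContDiff ℝ ∞ Γ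
  lift : ∀ s, ∃ hs : Γ s ≠ 0, γ s = Projectivization.mk ℝ (Γ s) hs
  det_eq_one : ∀ s, det3 (Γ s) (deriv Γ s) (iteratedDeriv 2 Γ s) = 1

open Classical in
/-- The canonical lift of a smooth curve without inflection points. -/
def canonicalLift (γ : ℝ → RP2) : ℝ → V3 :=
  if h : ∃ Γ, IsCanonicalLift γ Γ then h.choose else 0

/-- The coefficient `a` of `Γ''' = a Γ + b Γ'`, for the canonical lift `Γ`. -/
def coeffA (γ : ℝ → RP2) (s : ℝ) : ℝ :=
  det3 (iteratedDeriv 3 (canonicalLift γ) s) (deriv (canonicalLift γ) s)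
    (iteratedDeriv 2 (canonicalLift γ) s)

/-- The coefficient `b` of `Γ''' = a Γ + b Γ'`, for the canonical lift `Γ`. -/
def coeffB (γ : ℝ → RP2) (s : ℝ) : ℝ :=
  det3 (canonicalLift γ s) (iteratedDeriv 3 (canonicalLift γ) s)
    (iteratedDeriv 2 (canonicalLift γ) s)

/-- `γ` is a generic curve (smooth, without inflection or sextatic points) that is parameterized by
the projective parameter: its projective speed `(a - b'/2)^{1/3}` is identically `1`. -/
def IsUnitSpeedGeneric (γ : ℝ → RP2) : Prop :=
  (∃ Γ, IsCanonicalLift γ Γ) ∧ ∀ s, coeffA γ s - deriv (coeffB γ) s / 2 = 1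

/-- The projective curvature `k = -b/2` of a unit-speed generic curve. -/
def curvature (γ : ℝ → RP2) (s : ℝ) : ℝ := - (coeffB γ s / 2)

/-- The first vector `F₀ = Γ` of the canonical projective frame of a unit-speed generic curve. -/
def frame0 (γ : ℝ → RP2) (s : ℝ) : V3 := canonicalLift γ s

/-- The second vector `F₁ = Γ'` of the canonical projective frame. -/
def frame1 (γ : ℝ → RP2) (s : ℝ) : V3 := deriv (canonicalLift γ) s

/-- The third vector `F₂ = Γ'' - (b/2) Γ` of the canonical projective frame. -/
def frame2 (γ : ℝ → RP2) (s : ℝ) : V3 :=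
  iteratedDeriv 2 (canonicalLift γ) s - (coeffB γ s / 2) • canonicalLift γ s

/-! ### Motions and local vector fields -/

/-- The curve `γ_[t] : s ↦ γ(s, t)` of a family of curves. -/
def atTime (γ : ℝ → ℝ → RP2) (t : ℝ) : ℝ → RP2 := fun s => γ s t

/-- `γ` is a motion with time interval `I`: the map `(s, t) ↦ γ(s, t)` is smooth on `ℝ × I`
(it has a smooth lift to `ℝ³ \ {0}`), and every `γ_[t]` is a unit-speed generic curve. The values
`γ s t` with `t ∉ I` play no role. -/
def IsMotion (I : Set ℝ) (γ : ℝ → ℝ → RP2) : Prop :=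
  (∃ G : ℝ → ℝ → V3, ContDiffOn ℝ ∞ (fun x : ℝ × ℝ => G x.1 x.2) (Set.univ ×ˢ I) ∧
    ∀ s, ∀ t ∈ I, ∃ hs : G s t ≠ 0, γ s t = Projectivization.mk ℝ (G s t) hs) ∧
  ∀ t ∈ I, IsUnitSpeedGeneric (atTime γ t)

/-- The local vector field `X_{𝔭,λ}` with potential `𝔭` and spectral parameter `λ`, evaluated at the
unit-speed generic curve `γ` with curvature `k`. It is a vector field along `γ`: at the parameter
`s` it is the tangent vector to `ℝℙ²` at `[F₀]` which is represented, modulo `F₀`, by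
`(ℳ¹₀(𝔭)|_{j(k)} - λ) F₁ + 𝔭|_{j(k)} F₂`. -/
def localField (p : DiffPoly) (l : ℝ) (γ : ℝ → RP2) (s : ℝ) : V3 :=
  (onJet (opM p) (curvature γ) s - l) • frame1 γ s + onJet p (curvature γ) s • frame2 γ s

/-- `γ` is an integral curve (a local motion) of `X_{𝔭,λ}` with time interval `I`: it is a motion and
`∂γ/∂t = X_{𝔭,λ}(γ_[t])` as tangent vectors to `ℝℙ²`, that is, `∂F₀/∂t` and the representative of
`X_{𝔭,λ}(γ_[t])` differ by a multiple of `F₀`. -/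
def IsIntegralCurve (p : DiffPoly) (l : ℝ) (I : Set ℝ) (γ : ℝ → ℝ → RP2) : Prop :=
  IsMotion I γ ∧
    ∀ s, ∀ t ∈ I, ∃ m : ℝ,
      deriv (fun τ => frame0 (atTime γ τ) s) t
        = m • frame0 (atTime γ t) s + localField p l (atTime γ t) s

/-- The projective curvature `κ(s, t) = k_[t](s)` of a motion. -/
def motionCurvature (γ : ℝ → ℝ → RP2) : ℝ → ℝ → ℝ := fun s t => curvature (atTime γ t) s

end KK

end

/-!
The proof has an algebraic half, on the hierarchy, and an analytic half, on frames.

*Algebra.* Let `L = ∂³ + 2u∂ + u'`, a formally skew-adjoint operator. For eigenfunctions `ψ` and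
`φ` with opposite eigenvalues `±ζ³`, the functions `W = ψ'φ - ψφ'` and `H = ψφ` satisfy
`𝒟 W = 3ζ³ H'` and a second linear relation that expresses `W'` by `H` (`wronskian_eq`,
`d_wronskian`). Formal eigenfunctions exist as power series in `z = ζ⁻¹`: their logarithmic
derivative solves a Riccati equation, whose solution is the limit of a contraction
(`exists_riccati_eq_one`), and the product `H` is determined by the concomitant of `L`, a quadratic
expression in the jets of `ψ` and `φ` which is a constant. All coefficients of `H` and `W` are
therefore differential polynomials (`exists_resolvent_series`). Comparing coefficients, `𝒟` maps a
coefficient of `W` to the total derivative of one of `H`, the density `u D³𝔭 + 4u² D𝔭` of a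
coefficient `𝔭` of `H` is a total derivative, and `𝒥 D` maps it back to a coefficient of `W`. So
every `𝔥_n` is a multiple of a coefficient of `W`, and all the primitives in the recursion exist
(`exists_primitives_hierarchy`). The identity `18 𝒮 = 𝒟 𝒥 D + 27 D` (`opS_eq_opD_opJ`) and the
recursion `𝔳_{n+2} = 18 𝔮_n - 27 𝔳_n` then give `𝒮(𝔳_n) + λ_n u' = 𝒟 𝔥_n` by induction
(`v_spec`).

*Geometry.* The canonical lift `Γ` of a unit-speed curve satisfies `Γ''' = (1 - k') Γ - 2k Γ'`.
Prolonging the velocity of `Γ` along the field `X_{𝔭,λ}` gives the evolution of `(Γ, Γ', Γ'')`, and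
the choice of `ℳ` makes it compatible with the structure equation exactly when
`κ_t = -(𝒮(𝔭) + λ u')|_{j_s(κ)}` (`prolong_velocity`). Along an integral curve compatibility holds
because mixed derivatives commute (`IsFrameFamily.evolution`). Conversely a solution `κ` makes the
two linear systems for the frame a flat connection on the strip `ℝ × I` (`isFlat_of_solution`).
Flat connections on convex open sets have parallel sections with prescribed value at a point
(`exists_parallel`, by transport along rays and Grönwall's inequality). The trace of the connection
vanishes, so `det(Γ, Γ', Γ'') = 1` is preserved and the first vector of the frame sweeps out the
required motion (`IsSolution.exists_isIntegralCurve`). Uniqueness is uniqueness of parallel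
sections (`IsIntegralCurve.eq_of_curvature_eq`), together with the fact that the canonical lifts of
a motion are jointly smooth (`IsMotion.contDiffOn_canonicalLift`).
-/

noncomputable section

namespace KK

-- The normed structure on iterated spaces of continuous linear maps needs a deeper instance search.
set_option maxSynthPendingDepth 3

/-! ### Calculus of the total derivative -/

@[simp] theorem D_u (i : ℕ) : D (u i) = u (i + 1) :=
  MvPolynomial.mkDerivation_X ..

@[simp] theorem D_c (r : ℝ) : D (c r) = 0 :=
  D.map_algebraMap r

@[simp] theorem D_ofNat (n : ℕ) [n.AtLeastTwo] : D (ofNat(n) : DiffPoly) = 0 :=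
  D.map_natCast n

@[simp] theorem D_mul (a b : DiffPoly) : D (a * b) = a * D b + b * D a := by
  simp

theorem D_sq (a : DiffPoly) : D (a ^ 2) = 2 * a * D a := by
  rw [sq, D_mul]; ring

theorem D_cube (a : DiffPoly) : D (a ^ 3) = 3 * a ^ 2 * D a := by
  rw [pow_succ, D_mul, D_sq]; ring

theorem pderiv_zero_D (g : DiffPoly) :
    MvPolynomial.pderiv 0 (D g) = D (MvPolynomial.pderiv 0 g) := by
  have : ⁅MvPolynomial.pderiv (R := ℝ) 0, D⁆ = 0 := by
    apply MvPolynomial.derivation_ext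
    intro i
    classical
    rw [Derivation.commutator_apply, D_u]
    simp only [u, MvPolynomial.pderiv_X]
    by_cases hi : i = 0 <;> simp [hi]
  have h2 := congrArg (fun d : Derivation ℝ DiffPoly DiffPoly => d g) this
  simpa [Derivation.commutator_apply, sub_eq_zero] using h2

theorem pderiv_succ_D (k : ℕ) (g : DiffPoly) :
    MvPolynomial.pderiv (k + 1) (D g)
      = D (MvPolynomial.pderiv (k + 1) g) + MvPolynomial.pderiv k g := by
  have : ⁅MvPolynomial.pderiv (R := ℝ) (k + 1), D⁆ = MvPolynomial.pderiv k := by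
    apply MvPolynomial.derivation_ext
    intro i
    classical
    rw [Derivation.commutator_apply, D_u]
    simp only [u, MvPolynomial.pderiv_X, Pi.single_apply]
    by_cases hi : i = k + 1 <;> by_cases hk : i = k <;> simp [hi, hk, eq_comm]
  have h2 := congrArg (fun d : Derivation ℝ DiffPoly DiffPoly => d g) this
  rw [Derivation.commutator_apply] at h2
  rw [← h2]; ring

theorem exists_pderiv_eq_zero (g : DiffPoly) :
    ∃ N, ∀ k, N ≤ k → k ∉ g.vars ∧ MvPolynomial.pderiv k g = 0 := by
  refine ⟨g.vars.sup id + 1, fun k hk => ?_⟩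
  have : k ∉ g.vars := fun h => by
    have := Finset.le_sup (f := id) h
    simp only [id] at this
    omega
  exact ⟨this, MvPolynomial.pderiv_eq_zero_of_notMem_vars this⟩

theorem eq_C_of_pderiv_eq_zero {g : DiffPoly} (hg : ∀ k, MvPolynomial.pderiv k g = 0) :
    g = c (MvPolynomial.constantCoeff g) := by
  classical
  ext m
  rw [MvPolynomial.coeff_C]
  split_ifs with hm
  · subst hm; rfl
  · obtain ⟨i, hi⟩ : ∃ i, m i ≠ 0 := by
      by_contra! hcon
      exact hm (Finsupp.ext fun i => (hcon i).symm)
    have h1 := MvPolynomial.coeff_pderiv (i := i) g (m - Finsupp.single i 1)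
    rw [hg i, MvPolynomial.coeff_zero, tsub_add_cancel_of_le] at h1
    · rcases mul_eq_zero.mp h1.symm with h2 | h2
      · exact h2
      · exact absurd h2 (by positivity)
    · simpa [Finsupp.single_le_iff] using Nat.one_le_iff_ne_zero.mpr hi

/-- The highest jet coordinate occurring in `g` would survive in `D g` one order higher. -/
theorem eq_C_of_D_eq_zero {g : DiffPoly} (hg : D g = 0) :
    g = c (MvPolynomial.constantCoeff g) := by
  apply eq_C_of_pderiv_eq_zero
  obtain ⟨N, hN⟩ := exists_pderiv_eq_zero g
  have key : ∀ M, (∀ k, M ≤ k → MvPolynomial.pderiv k g = 0) →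
      ∀ k, MvPolynomial.pderiv k g = 0 := by
    intro M
    induction M with
    | zero => exact fun h k => h k (Nat.zero_le k)
    | succ M ih =>
      intro h
      refine ih fun k hk => ?_
      rcases hk.eq_or_lt with rfl | hlt
      · have := pderiv_succ_D M g
        rw [hg, h _ le_rfl] at this
        simpa using this.symm
      · exact h k hlt
  exact key N fun k hk => (hN k hk).2

theorem eq_of_D_eq {g g' : DiffPoly} (hD : D g = D g')
    (h0 : MvPolynomial.constantCoeff g = MvPolynomial.constantCoeff g') : g = g' := by
  have h1 : D (g - g') = 0 := by rw [map_sub, hD, sub_self]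
  have h2 := eq_C_of_D_eq_zero h1
  rw [map_sub, h0, sub_self, c, map_zero] at h2
  exact sub_eq_zero.mp h2

theorem constantCoeff_D (g : DiffPoly) : MvPolynomial.constantCoeff (D g) = 0 := by
  induction g using MvPolynomial.induction_on with
  | C a => simp
  | add p q hp hq => simp [hp, hq]
  | mul_X p i hp => rw [D_mul, D_u]; simp

theorem euler_eq_sum_range (p : DiffPoly) {N : ℕ} (hN : ∀ k, N ≤ k → k ∉ p.vars) :
    euler p = ∑ l ∈ Finset.range N, (-1) ^ l * (D^[l] (MvPolynomial.pderiv l p)) := by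
  refine Finset.sum_subset (fun k hk => ?_) fun k _ hk => ?_
  · by_contra hcon
    exact hN k (by simpa using hcon) hk
  · rw [MvPolynomial.pderiv_eq_zero_of_notMem_vars hk, iterate_map_zero, mul_zero]

/-- The Euler operator annihilates total derivatives: by the commutation relations of `D` with
the partial derivatives, the alternating sum telescopes. -/
theorem euler_D (g : DiffPoly) : euler (D g) = 0 := by
  obtain ⟨N, hN⟩ := exists_pderiv_eq_zero g
  obtain ⟨N', hN'⟩ := exists_pderiv_eq_zero (D g)
  rw [euler_eq_sum_range (D g) (N := max N N' + 1)
    fun k hk => (hN' k (by have := le_max_right N N'; omega)).1]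
  have key : ∀ M, ∑ l ∈ Finset.range (M + 1), (-1) ^ l * (D^[l] (MvPolynomial.pderiv l (D g)))
      = (-1) ^ M * (D^[M + 1] (MvPolynomial.pderiv M g)) := by
    intro M
    induction M with
    | zero => simp [pderiv_zero_D]
    | succ M ih =>
      rw [Finset.sum_range_succ, ih, pderiv_succ_D, iterate_map_add,
        Function.iterate_succ_apply D (M + 1)]
      ring
  rw [key, (hN _ (le_max_left N N')).2, iterate_map_zero, mul_zero]

theorem mem_potentials_of_D_eq {p g : DiffPoly} (hg : D g = potentialDensity p) :
    p ∈ potentials := by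
  rw [potentials, Set.mem_ofPred_eq, ← hg, euler_D]

theorem constantCoeff_Dinv (p : DiffPoly) : MvPolynomial.constantCoeff (Dinv p) = 0 := by
  unfold Dinv
  split_ifs with h
  · exact h.choose_spec.2
  · simp

theorem Dinv_eq {p g : DiffPoly} (hg : D g = p) (h0 : MvPolynomial.constantCoeff g = 0) :
    Dinv p = g := by
  have h : ∃ g : DiffPoly, D g = p ∧ MvPolynomial.constantCoeff g = 0 := ⟨g, hg, h0⟩
  have h1 : Dinv p = h.choose := by unfold Dinv; rw [dif_pos h]
  rw [h1]
  exact eq_of_D_eq (h.choose_spec.1.trans hg.symm) (h.choose_spec.2.trans h0.symm)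

theorem D_Dinv_D (g : DiffPoly) : D (Dinv (D g)) = D g := by
  have h1 : D (g - c (MvPolynomial.constantCoeff g)) = D g := by simp
  rw [Dinv_eq h1 (by simp), h1]

theorem D_Dinv {p : DiffPoly} (h : ∃ g, D g = p) : D (Dinv p) = p := by
  obtain ⟨g, rfl⟩ := h
  exact D_Dinv_D g

/-! ### Products of eigenfunctions of `∂³ + 2u∂ + u'` -/

/-- The linear relations between the products `a i j = zⁱ⁺ʲ ψ⁽ⁱ⁾ φ⁽ʲ⁾`, where `ψ` and `φ` satisfy
`y''' + 2 u y' + u' y = ± z⁻³ y`: the products of order at most two span a space stable under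
the derivation. The skew-adjointness of the operator makes the concomitant constant. -/
structure EigenProducts {A : Type*} [CommRing A] [Algebra ℝ A] (d : Derivation ℝ A A)
    (z v : A) (a : ℕ → ℕ → A) : Prop where
  d_z : d z = 0
  d_a : ∀ i j, z * d (a i j) = a (i + 1) j + a i (j + 1)
  left : ∀ j, a 3 j = a 0 j - 2 * v * z ^ 2 * a 1 j - d v * z ^ 3 * a 0 j
  right : ∀ i, a i 3 = - a i 0 - 2 * v * z ^ 2 * a i 1 - d v * z ^ 3 * a i 0
  concomitant : a 0 2 - a 1 1 + a 2 0 + 2 * v * z ^ 2 * a 0 0 = 3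

namespace EigenProducts

variable {A : Type*} [CommRing A] [IsDomain A] [Algebra ℝ A] {d : Derivation ℝ A A}
  {z v : A} {a : ℕ → ℕ → A}

/-- The relation `z² 𝒟 W = 3 H'` between `W = a 1 0 - a 0 1`, the Wronskian multiplied by `z`, and
the product `H = a 0 0`. -/
theorem wronskian_eq (h : EigenProducts d z v a) (hz : z ≠ 0) :
    z ^ 2 * (d (d (d (a 1 0 - a 0 1))) + 2 * v * d (a 1 0 - a 0 1) + d v * (a 1 0 - a 0 1))
      = 3 * d (a 0 0) := by
  have h0 := h.d_z
  have h1 : z * d (a 1 0 - a 0 1) = a 2 0 - a 0 2 := by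
    rw [map_sub]; linear_combination h.d_a 1 0 - h.d_a 0 1
  have h2 : z ^ 2 * d (d (a 1 0 - a 0 1))
      = 2 * a 0 0 - 2 * v * z ^ 2 * (a 1 0 - a 0 1) + (a 2 1 - a 1 2) := by
    have := congrArg d h1
    simp only [Derivation.leibniz, smul_eq_mul, h0, map_sub] at this
    simp only [map_sub]
    linear_combination z * this + h.d_a 2 0 - h.d_a 0 2 + h.left 0 - h.right 0
  have h3 := congrArg d h2
  simp only [Derivation.leibniz, Derivation.leibniz_pow, smul_eq_mul, h0, map_sub, map_add,
    mul_zero, add_zero, smul_zero] at h3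
  have e2 : d (2 : A) = 0 := d.map_natCast 2
  rw [e2] at h3
  apply mul_left_cancel₀ hz
  simp only [map_sub] at h1 ⊢
  linear_combination z * h3 + h.d_a 2 1 - h.d_a 1 2 + h.left 1 - h.right 1 - h.d_a 0 0

/-- The companion relation, a fifth-order operator in `H`; it comes from differentiating `a 2 2` in
two ways, after the symmetric products have been eliminated by means of the concomitant. -/
theorem d_wronskian (h : EigenProducts d z v a) (hz : z ≠ 0) :
    9 * d (a 1 0 - a 0 1) = - z ^ 4 * (d (d (d (d (d (a 0 0))))) + 10 * v * d (d (d (a 0 0)))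
      + 15 * d v * d (d (a 0 0)) + (9 * d (d v) + 16 * v ^ 2) * d (a 0 0)
      + 2 * (d (d (d v)) + 8 * v * d v) * a 0 0) := by
  have h0 := h.d_z
  have e2 : d (2 : A) = 0 := d.map_natCast 2
  have e3 : d (3 : A) = 0 := d.map_natCast 3
  have e4 : d (4 : A) = 0 := d.map_natCast 4
  have hH2 : z ^ 2 * d (d (a 0 0)) = a 2 0 + 2 * a 1 1 + a 0 2 := by
    have := congrArg d (h.d_a 0 0)
    simp only [Derivation.leibniz, smul_eq_mul, h0, map_add] at this
    linear_combination z * this + h.d_a 1 0 + h.d_a 0 1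
  -- the concomitant expresses `a 1 1` by `H = a 0 0`
  have hP : 3 * a 1 1 = z ^ 2 * d (d (a 0 0)) + 2 * v * z ^ 2 * a 0 0 - 3 := by
    linear_combination -hH2 - h.concomitant
  have hP1 := congrArg d hP
  simp only [Derivation.leibniz, Derivation.leibniz_pow, smul_eq_mul, h0, map_sub, map_add, e2, e3,
    mul_zero, add_zero, smul_zero] at hP1
  have hP2 := congrArg d hP1
  simp only [Derivation.leibniz, Derivation.leibniz_pow, smul_eq_mul, h0, map_add, e2, e3,
    mul_zero, add_zero, smul_zero, map_zero, sub_zero] at hP2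
  have hP3 := congrArg d hP2
  simp only [Derivation.leibniz, Derivation.leibniz_pow, smul_eq_mul, h0, map_add, e2, e3,
    mul_zero, add_zero, smul_zero, map_zero] at hP3
  -- two expressions for the derivative of `a 2 2`: `h22'` and `hQ`
  have h22 : 2 * a 2 2 = z ^ 2 * d (d (a 1 1)) + (a 1 0 - a 0 1) + 4 * v * z ^ 2 * a 1 1
      + d v * z ^ 4 * d (a 0 0) := by
    have := congrArg d (h.d_a 1 1)
    simp only [Derivation.leibniz, smul_eq_mul, h0, map_add] at this
    linear_combination -z * this - h.d_a 2 1 - h.d_a 1 2 - h.left 1 - h.right 1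
      - d v * z ^ 3 * h.d_a 0 0
  have h22' := congrArg d h22
  simp only [Derivation.leibniz, Derivation.leibniz_pow, smul_eq_mul, h0, map_sub, map_add, e2, e4,
    mul_zero, add_zero, smul_zero] at h22'
  have hW : z * d (a 1 0 - a 0 1) = a 2 0 - a 0 2 := by
    rw [map_sub]; linear_combination h.d_a 1 0 - h.d_a 0 1
  have hQ : z * d (a 2 2) = - z * d (a 1 0 - a 0 1) - 2 * v * z ^ 3 * d (a 1 1)
      - d v * z ^ 3 * (z ^ 2 * d (d (a 0 0)) - 2 * a 1 1) := by
    linear_combination h.d_a 2 2 + h.left 2 + h.right 2 + hW + 2 * v * z ^ 2 * h.d_a 1 1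
      + d v * z ^ 3 * hH2
  apply mul_left_cancel₀ hz
  simp only [map_sub] at hQ ⊢
  linear_combination 6 * hQ - 3 * z * h22' - z ^ 3 * hP3 - 8 * v * z ^ 3 * hP1

end EigenProducts

/-! ### The formal eigenfunction and its Riccati equation -/

open PowerSeries in
/-- The total derivative acting coefficientwise on power series over `J[u]`. The series variable
stands for the inverse of the spectral parameter `ζ`, with `ζ³ = λ`. -/
def seriesD : Derivation ℝ (PowerSeries DiffPoly) (PowerSeries DiffPoly) :=
  Derivation.mk'
    { toFun := fun g => PowerSeries.mk fun n => D (coeff n g)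
      map_add' := fun f g => by ext1 n; simp
      map_smul' := fun r f => by ext1 n; simp }
    fun f g => by
      ext1 n
      simp only [LinearMap.coe_mk, AddHom.coe_mk, coeff_mk, smul_eq_mul, map_add, coeff_mul,
        map_sum, D_mul, Finset.sum_add_distrib]
      congr 1
      rw [← Finset.Nat.sum_antidiagonal_swap]
      rfl

@[simp] theorem coeff_seriesD (n : ℕ) (g : PowerSeries DiffPoly) :
    PowerSeries.coeff n (seriesD g) = D (PowerSeries.coeff n g) :=
  PowerSeries.coeff_mk n fun n => D (PowerSeries.coeff n g)

@[simp] theorem seriesD_C (a : DiffPoly) :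
    seriesD (PowerSeries.C a) = PowerSeries.C (D a) := by
  ext1 n
  simp only [coeff_seriesD, PowerSeries.coeff_C]
  split_ifs <;> simp

@[simp] theorem seriesD_X : seriesD PowerSeries.X = 0 := by
  ext1 n
  simp only [coeff_seriesD, PowerSeries.coeff_X]
  split_ifs <;> simp

theorem seriesD_X_pow_mul (n : ℕ) (g : PowerSeries DiffPoly) :
    seriesD (PowerSeries.X ^ n * g) = PowerSeries.X ^ n * seriesD g := by
  simp [Derivation.leibniz_pow]

theorem seriesD_rescale (g : PowerSeries DiffPoly) :
    seriesD (PowerSeries.rescale (-1) g) = PowerSeries.rescale (-1) (seriesD g) := by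
  ext1 n
  rcases neg_one_pow_eq_or DiffPoly n with h | h <;> simp [PowerSeries.coeff_rescale, h]

/-- With `f = z p`, `z = ζ⁻¹`, the Riccati equation `p'' + 3 p p' + p³ + 2 u p + u' = ζ³` for the
logarithmic derivative `p` of an eigenfunction says that this series is `1`. -/
def riccati (f : PowerSeries DiffPoly) : PowerSeries DiffPoly :=
  PowerSeries.X ^ 2 * seriesD (seriesD f) + 3 * PowerSeries.X * f * seriesD f + f ^ 3
    + 2 * PowerSeries.C (u 0) * PowerSeries.X ^ 2 * f + PowerSeries.C (u 1) * PowerSeries.X ^ 3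

/-- One step of the successive approximation of the solution of the Riccati equation: Newton's
method with the derivative `3` of `f³` at `f = 1`. -/
def riccatiStep (f : PowerSeries DiffPoly) : PowerSeries DiffPoly :=
  f - PowerSeries.C (c (1 / 3)) * (riccati f - 1)

theorem three_mul_C_third : (3 : PowerSeries DiffPoly) * PowerSeries.C (c (1 / 3)) = 1 := by
  have h3 : (3 : DiffPoly) * c (1 / 3) = 1 := by
    rw [show (3 : DiffPoly) = MvPolynomial.C 3 from (map_ofNat MvPolynomial.C 3).symm, c,
      ← map_mul]
    norm_num
  rw [show (3 : PowerSeries DiffPoly) = PowerSeries.C 3 from (map_ofNat PowerSeries.C 3).symm,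
    ← map_mul, h3, map_one]

theorem riccatiStep_sub_one_dvd {f : PowerSeries DiffPoly} (hf : PowerSeries.X ∣ f - 1) :
    PowerSeries.X ∣ riccatiStep f - 1 := by
  obtain ⟨a, ha⟩ := hf
  obtain rfl : f = 1 + PowerSeries.X * a := by rw [← ha]; ring
  set X : PowerSeries DiffPoly := PowerSeries.X
  set k := PowerSeries.C (c (1 / 3) : DiffPoly)
  refine ⟨a - k * (X * seriesD (seriesD (1 + X * a))
    + 3 * (1 + X * a) * seriesD (1 + X * a) + 3 * a + 3 * X * a ^ 2 + X ^ 2 * a ^ 3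
    + 2 * PowerSeries.C (u 0) * X * (1 + X * a) + PowerSeries.C (u 1) * X ^ 2), ?_⟩
  unfold riccatiStep riccati
  ring

theorem riccatiStep_contracts {n : ℕ} {f g : PowerSeries DiffPoly} (hf : PowerSeries.X ∣ f - 1)
    (hg : PowerSeries.X ∣ g - 1) (hfg : PowerSeries.X ^ n ∣ f - g) :
    PowerSeries.X ^ (n + 1) ∣ riccatiStep f - riccatiStep g := by
  obtain ⟨a, ha⟩ := hf
  obtain ⟨b, hb⟩ := hg
  obtain ⟨k, hk⟩ := hfg
  have h1 : seriesD f - seriesD g = PowerSeries.X ^ n * seriesD k := by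
    rw [← map_sub, hk, seriesD_X_pow_mul]
  have h2 : seriesD (seriesD f) - seriesD (seriesD g)
      = PowerSeries.X ^ n * seriesD (seriesD k) := by
    rw [← map_sub, h1, seriesD_X_pow_mul]
  have h3 := three_mul_C_third
  unfold riccatiStep riccati
  set X : PowerSeries DiffPoly := PowerSeries.X
  set t := PowerSeries.C (c (1 / 3) : DiffPoly)
  -- the coefficient `1 - (f² + f g + g²) / 3` of `f - g` is divisible by `X`
  refine ⟨-t * (X * seriesD (seriesD k) + 3 * (f * seriesD k + k * seriesD g)
    + k * ((f + 1) * a + a * g + b + (g + 1) * b) + 2 * PowerSeries.C (u 0) * X * k), ?_⟩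
  linear_combination (-t * X ^ 2) * h2 - 3 * t * X * f * h1 - X ^ n * k * h3
    + (1 - 3 * t * X * seriesD g - t * (f ^ 2 + f * g + g ^ 2)
      - 2 * t * PowerSeries.C (u 0) * X ^ 2) * hk
    - t * X ^ n * k * (f + 1 + g) * ha - t * X ^ n * k * (g + 2) * hb

/-- The successive approximations converge in the `X`-adic topology. -/
theorem exists_riccati_eq_one :
    ∃ f : PowerSeries DiffPoly, PowerSeries.X ∣ f - 1 ∧ riccati f = 1 := by
  set φ : ℕ → PowerSeries DiffPoly := fun n => riccatiStep^[n] 1 with hφ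
  have hsucc : ∀ n, φ (n + 1) = riccatiStep (φ n) := fun n =>
    Function.iterate_succ_apply' riccatiStep n 1
  have h1 : ∀ n, PowerSeries.X ∣ φ n - 1 := by
    intro n
    induction n with
    | zero => simp [hφ]
    | succ n ih => rw [hsucc]; exact riccatiStep_sub_one_dvd ih
  have h2 : ∀ n, PowerSeries.X ^ (n + 1) ∣ φ (n + 1) - φ n := by
    intro n
    induction n with
    | zero => simpa [hφ] using h1 1
    | succ n ih =>
      rw [hsucc, hsucc n]
      exact riccatiStep_contracts (by simpa [hsucc] using h1 (n + 1)) (h1 n)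
        (by simpa [hsucc] using ih)
  have h3 : ∀ n m, n ≤ m → PowerSeries.coeff n (φ m) = PowerSeries.coeff n (φ n) := by
    intro n m hnm
    induction m, hnm using Nat.le_induction with
    | base => rfl
    | succ m hm ih =>
      rw [← ih, ← sub_eq_zero, ← map_sub]
      exact PowerSeries.X_pow_dvd_iff.mp (h2 m) n (by omega)
  set f : PowerSeries DiffPoly := PowerSeries.mk fun n => PowerSeries.coeff n (φ n) with hf
  have h4 : ∀ n, PowerSeries.X ^ (n + 1) ∣ f - φ n := by
    intro n
    rw [PowerSeries.X_pow_dvd_iff]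
    intro m hm
    rw [map_sub, hf, PowerSeries.coeff_mk, h3 m n (by omega), sub_self]
  have h5 : PowerSeries.X ∣ f - 1 := by simpa [hφ] using h4 0
  refine ⟨f, h5, ?_⟩
  have h6 : riccatiStep f = f := by
    ext1 n
    have h7 : PowerSeries.X ^ (n + 1) ∣ riccatiStep f - f := by
      have e : riccatiStep f - f = (riccatiStep f - riccatiStep (φ n)) - (f - φ (n + 1)) := by
        rw [hsucc]; ring
      rw [e]
      exact dvd_sub ((pow_dvd_pow _ (by omega)).trans (riccatiStep_contracts h5 (h1 n) (h4 n)))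
        ((pow_dvd_pow _ (by omega)).trans (h4 (n + 1)))
    rw [← sub_eq_zero, ← map_sub]
    exact PowerSeries.X_pow_dvd_iff.mp h7 n (by omega)
  unfold riccatiStep at h6
  linear_combination -3 * h6 - (riccati f - 1) * three_mul_C_third

/-- `zⁱ ψ⁽ⁱ⁾ / ψ` for an eigenfunction `ψ` with logarithmic derivative `z⁻¹ f`. -/
def logJet (f : PowerSeries DiffPoly) : ℕ → PowerSeries DiffPoly
  | 0 => 1
  | n + 1 => PowerSeries.X * seriesD (logJet f n) + f * logJet f n

@[simp] theorem logJet_one (f : PowerSeries DiffPoly) : logJet f 1 = f := by simp [logJet]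

theorem logJet_three (f : PowerSeries DiffPoly) :
    logJet f 3 = riccati f - 2 * PowerSeries.C (u 0) * PowerSeries.X ^ 2 * f
      - PowerSeries.C (u 1) * PowerSeries.X ^ 3 := by
  simp only [logJet, riccati, map_add, Derivation.leibniz, Derivation.map_one_eq_zero, map_zero,
    smul_eq_mul, seriesD_X]
  ring

/-- Changing the signs of `z` and of the series turns an eigenfunction into one with the opposite
eigenvalue. -/
theorem logJet_neg_rescale_three (f : PowerSeries DiffPoly) :
    logJet (-PowerSeries.rescale (-1) f) 3 = -PowerSeries.rescale (-1) (riccati f)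
      - 2 * PowerSeries.C (u 0) * PowerSeries.X ^ 2 * (-PowerSeries.rescale (-1) f)
      - PowerSeries.C (u 1) * PowerSeries.X ^ 3 := by
  have hC : ∀ a : DiffPoly, PowerSeries.rescale (-1) (PowerSeries.C a) = PowerSeries.C a :=
    fun a => by
      ext1 n
      rw [PowerSeries.coeff_rescale, PowerSeries.coeff_C]
      split_ifs with h <;> simp [h]
  have hX : PowerSeries.rescale (-1 : DiffPoly) PowerSeries.X = -PowerSeries.X := by
    rw [PowerSeries.rescale_X]; simp
  rw [logJet_three]
  unfold riccati
  simp only [map_add, map_mul, map_pow, map_ofNat, hC, hX, map_neg, seriesD_rescale]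
  ring

theorem map_constantCoeff_seriesD (g : PowerSeries DiffPoly) :
    PowerSeries.map MvPolynomial.constantCoeff (seriesD g) = 0 := by
  ext n; simp [constantCoeff_D]

theorem map_constantCoeff_rescale (g : PowerSeries DiffPoly) :
    PowerSeries.map MvPolynomial.constantCoeff (PowerSeries.rescale (-1) g)
      = PowerSeries.rescale (-1) (PowerSeries.map MvPolynomial.constantCoeff g) := by
  ext n; simp [PowerSeries.coeff_rescale]

theorem map_constantCoeff_logJet (f : PowerSeries DiffPoly) (n : ℕ) :
    PowerSeries.map MvPolynomial.constantCoeff (logJet f n)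
      = PowerSeries.map MvPolynomial.constantCoeff f ^ n := by
  induction n with
  | zero => simp [logJet]
  | succ n ih => rw [logJet, map_add, map_mul, map_constantCoeff_seriesD, map_mul, ih]; ring

theorem constantCoeff_logJet (f : PowerSeries DiffPoly) (n : ℕ) :
    PowerSeries.constantCoeff (logJet f n) = PowerSeries.constantCoeff f ^ n := by
  induction n with
  | zero => simp [logJet]
  | succ n ih => rw [logJet, map_add, map_mul, map_mul, ih]; simp; ring

/-- Modulo the jet coordinates the Riccati equation becomes `m³ = 1`. -/
theorem map_constantCoeff_eq_one {f : PowerSeries DiffPoly} (hf : PowerSeries.X ∣ f - 1)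
    (hr : riccati f = 1) : PowerSeries.map MvPolynomial.constantCoeff f = 1 := by
  have h1 := congrArg (PowerSeries.map MvPolynomial.constantCoeff) hr
  simp only [riccati, map_add, map_mul, map_pow, map_constantCoeff_seriesD, map_one,
    PowerSeries.map_C, PowerSeries.map_X, map_ofNat, MvPolynomial.constantCoeff_X, map_zero,
    mul_zero, zero_mul, add_zero, zero_add] at h1
  have h0 : PowerSeries.constantCoeff f = 1 := by
    have := PowerSeries.X_dvd_iff.mp hf
    simpa [sub_eq_zero] using this
  set m := PowerSeries.map MvPolynomial.constantCoeff f
  have h2 : (m - 1) * (m ^ 2 + m + 1) = 0 := by linear_combination h1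
  rcases mul_eq_zero.mp h2 with h | h
  · exact sub_eq_zero.mp h
  · have h3 := congrArg PowerSeries.constantCoeff h
    have h4 : PowerSeries.constantCoeff m = 1 := by
      rw [← PowerSeries.coeff_zero_eq_constantCoeff_apply, PowerSeries.coeff_map,
        PowerSeries.coeff_zero_eq_constantCoeff_apply, h0, map_one]
    simp [h4] at h3
    norm_num at h3

/-- Power series `H` and `W` standing for the product `ψφ` and the Wronskian `z (ψ'φ - ψφ')` of
eigenfunctions with opposite eigenvalues. -/
theorem exists_resolvent_series : ∃ H W : PowerSeries DiffPoly,
    PowerSeries.map MvPolynomial.constantCoeff H = 1 ∧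
    PowerSeries.map MvPolynomial.constantCoeff W = 2 ∧
    PowerSeries.X ^ 2 * (seriesD (seriesD (seriesD W)) + 2 * PowerSeries.C (u 0) * seriesD W
      + seriesD (PowerSeries.C (u 0)) * W) = 3 * seriesD H ∧
    9 * seriesD W = - PowerSeries.X ^ 4 * (seriesD (seriesD (seriesD (seriesD (seriesD H))))
      + 10 * PowerSeries.C (u 0) * seriesD (seriesD (seriesD H))
      + 15 * seriesD (PowerSeries.C (u 0)) * seriesD (seriesD H)
      + (9 * seriesD (seriesD (PowerSeries.C (u 0))) + 16 * PowerSeries.C (u 0) ^ 2) * seriesD H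
      + 2 * (seriesD (seriesD (seriesD (PowerSeries.C (u 0))))
        + 8 * PowerSeries.C (u 0) * seriesD (PowerSeries.C (u 0))) * H) := by
  obtain ⟨f, hf, hr⟩ := exists_riccati_eq_one
  have hm := map_constantCoeff_eq_one hf hr
  have h0 : PowerSeries.constantCoeff f = 1 := by
    have := PowerSeries.X_dvd_iff.mp hf
    simpa [sub_eq_zero] using this
  -- `f` and `g` belong to eigenfunctions `ψ` and `φ` with opposite eigenvalues
  set g := -PowerSeries.rescale (-1 : DiffPoly) f with hg
  have hmg : PowerSeries.map MvPolynomial.constantCoeff g = -1 := by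
    rw [hg, map_neg, map_constantCoeff_rescale, hm, map_one]
  have h0g : PowerSeries.constantCoeff g = -1 := by
    rw [hg, map_neg, ← PowerSeries.coeff_zero_eq_constantCoeff_apply, PowerSeries.coeff_rescale]
    simp [h0]
  have hF3 : logJet f 3 = 1 - 2 * PowerSeries.C (u 0) * PowerSeries.X ^ 2 * f
      - PowerSeries.C (u 1) * PowerSeries.X ^ 3 := by rw [logJet_three, hr]
  have hG3 : logJet g 3 = -1 - 2 * PowerSeries.C (u 0) * PowerSeries.X ^ 2 * g
      - PowerSeries.C (u 1) * PowerSeries.X ^ 3 := by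
    rw [hg, logJet_neg_rescale_three, hr, map_one]
  -- the concomitant of `ψ` and `φ` is `B ψ φ`, so the product `H = ψ φ` has to be `3 / B`
  set B := logJet f 2 + logJet g 2 - f * g + 2 * PowerSeries.C (u 0) * PowerSeries.X ^ 2 with hB
  have hBu : IsUnit B := by
    rw [PowerSeries.isUnit_iff_constantCoeff]
    have : PowerSeries.constantCoeff B = MvPolynomial.C (3 : ℝ) := by
      rw [hB]
      simp only [map_add, map_sub, map_mul, constantCoeff_logJet, h0, h0g, map_pow,
        PowerSeries.constantCoeff_X, map_ofNat]
      ring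
    rw [this]
    exact (IsUnit.mk0 (3 : ℝ) (by norm_num)).map MvPolynomial.C
  obtain ⟨b, hb⟩ := hBu.exists_right_inv
  have hdB : PowerSeries.X * seriesD B = -(f + g) * B := by
    have e1 : PowerSeries.X * seriesD (logJet f 2) = logJet f 3 - f * logJet f 2 := by
      simp only [logJet]; ring
    have e2 : PowerSeries.X * seriesD (logJet g 2) = logJet g 3 - g * logJet g 2 := by
      simp only [logJet]; ring
    have e3 : logJet f 2 = PowerSeries.X * seriesD f + f * f := by simp [logJet]
    have e4 : logJet g 2 = PowerSeries.X * seriesD g + g * g := by simp [logJet]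
    have e5 : seriesD (2 : PowerSeries DiffPoly) = 0 := seriesD.map_natCast 2
    have e6 : seriesD (PowerSeries.X ^ 2) = 0 := by simp [Derivation.leibniz_pow]
    rw [hB]
    simp only [map_add, map_sub, Derivation.leibniz, smul_eq_mul, e5, e6, seriesD_C, D_u]
    linear_combination e1 + e2 + hF3 + hG3 + f * e4 + g * e3
  set H := 3 * b with hH
  have hBH : B * H = 3 := by rw [hH]; linear_combination 3 * hb
  have hdH : PowerSeries.X * seriesD H = (f + g) * H := by
    have := congrArg seriesD hBH
    rw [Derivation.leibniz, smul_eq_mul, smul_eq_mul,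
      show seriesD (3 : PowerSeries DiffPoly) = 0 from seriesD.map_natCast 3] at this
    apply hBu.mul_left_cancel
    linear_combination PowerSeries.X * this - H * hdB
  have hE : EigenProducts seriesD PowerSeries.X (PowerSeries.C (u 0))
      (fun i j => logJet f i * logJet g j * H) := by
    refine ⟨seriesD_X, fun i j => ?_, fun j => ?_, fun i => ?_, ?_⟩
    · simp only [Derivation.leibniz, smul_eq_mul, logJet]
      linear_combination logJet f i * logJet g j * hdH
    · simp only [hF3, seriesD_C, D_u, logJet_one]
      simp only [logJet]
      ring
    · simp only [hG3, seriesD_C, D_u, logJet_one]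
      simp only [logJet]
      ring
    · rw [logJet_one, logJet_one, show logJet f 0 = 1 from rfl, show logJet g 0 = 1 from rfl]
      rw [hB] at hBH
      linear_combination hBH
  have hX : (PowerSeries.X : PowerSeries DiffPoly) ≠ 0 := PowerSeries.X_ne_zero
  -- `h1` and `h2` are the two differential relations; the rest computes the constant terms
  have h1 := hE.wronskian_eq hX
  have h2 := hE.d_wronskian hX
  have hmH : PowerSeries.map MvPolynomial.constantCoeff H = 1 := by
    have := congrArg (PowerSeries.map MvPolynomial.constantCoeff) hBH
    rw [hB] at this
    simp only [map_mul, map_add, map_sub, map_constantCoeff_logJet, hm, hmg, map_ofNat,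
      PowerSeries.map_C, MvPolynomial.constantCoeff_X, map_zero, mul_zero, zero_mul] at this
    have h3 : (3 : PowerSeries ℝ) ≠ 0 := by
      intro h
      have := congrArg PowerSeries.constantCoeff h
      rw [map_ofNat, map_zero] at this
      norm_num at this
    apply mul_left_cancel₀ h3
    linear_combination this
  have e0 : logJet f 0 * logJet g 0 * H = H := by simp [logJet]
  rw [e0] at h1 h2
  refine ⟨H, logJet f 1 * logJet g 0 * H - logJet f 0 * logJet g 1 * H, hmH, ?_, h1, h2⟩
  simp only [map_sub, map_mul, map_constantCoeff_logJet, hm, hmg, hmH]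
  ring

/-! ### The hierarchy as coefficients of the resolvent series -/

theorem c_ofNat (n : ℕ) [n.AtLeastTwo] : c (ofNat(n) : ℝ) = (ofNat(n) : DiffPoly) :=
  map_ofNat MvPolynomial.C n

theorem eq_of_ofNat_mul_eq (n : ℕ) [n.AtLeastTwo] {a b : DiffPoly}
    (h : ofNat(n) * a = ofNat(n) * b) : a = b :=
  mul_left_cancel₀ (OfNat.ofNat_ne_zero n) h

/-- Two sequences with the properties of the coefficients of the series `H` (product) and `W`
(Wronskian): constant terms vanish beyond the leading coefficient, and the two differential
relations hold coefficientwise. -/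
structure ResolventCoeffs (H W : ℕ → DiffPoly) : Prop where
  constantCoeff_H : ∀ n, MvPolynomial.constantCoeff (H (n + 1)) = 0
  constantCoeff_W : ∀ n, MvPolynomial.constantCoeff (W (n + 1)) = 0
  H_zero : H 0 = 1
  W_zero : W 0 = 2
  opD_W : ∀ n, opD (W n) = 3 * D (H (n + 2))
  D_W : ∀ n, 9 * D (W (n + 4)) = - (D (D (D (D (D (H n))))) + 10 * u 0 * D (D (D (H n)))
    + 15 * u 1 * D (D (H n)) + (9 * u 2 + 16 * u 0 ^ 2) * D (H n)
    + 2 * (u 3 + 8 * u 0 * u 1) * H n)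

theorem exists_resolventCoeffs : ∃ H W, ResolventCoeffs H W := by
  obtain ⟨H, W, hH, hW, ha, hb⟩ := exists_resolvent_series
  have o2 : (2 : PowerSeries DiffPoly) = PowerSeries.C 2 := (map_ofNat PowerSeries.C 2).symm
  have o3 : (3 : PowerSeries DiffPoly) = PowerSeries.C 3 := (map_ofNat PowerSeries.C 3).symm
  have o8 : (8 : PowerSeries DiffPoly) = PowerSeries.C 8 := (map_ofNat PowerSeries.C 8).symm
  have o9 : (9 : PowerSeries DiffPoly) = PowerSeries.C 9 := (map_ofNat PowerSeries.C 9).symm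
  have o10 : (10 : PowerSeries DiffPoly) = PowerSeries.C 10 := (map_ofNat PowerSeries.C 10).symm
  have o15 : (15 : PowerSeries DiffPoly) = PowerSeries.C 15 := (map_ofNat PowerSeries.C 15).symm
  have o16 : (16 : PowerSeries DiffPoly) = PowerSeries.C 16 := (map_ofNat PowerSeries.C 16).symm
  simp only [o2, o3, o8, o9, o10, o15, o16, seriesD_C, D_u, ← map_mul, ← map_add, ← map_pow,
    neg_mul] at ha hb
  have hcH : ∀ n, MvPolynomial.constantCoeff (PowerSeries.coeff n H)
      = PowerSeries.coeff n (1 : PowerSeries ℝ) := fun n => by rw [← hH, PowerSeries.coeff_map]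
  have hcW : ∀ n, MvPolynomial.constantCoeff (PowerSeries.coeff n W)
      = PowerSeries.coeff n (PowerSeries.C 2 : PowerSeries ℝ) := fun n => by
    rw [map_ofNat, ← hW, PowerSeries.coeff_map]
  have hDH : D (PowerSeries.coeff 0 H) = 0 := by
    have := congrArg (PowerSeries.coeff 0) ha
    rw [PowerSeries.coeff_X_pow_mul', PowerSeries.coeff_C_mul, coeff_seriesD] at this
    simpa using this.symm
  have hDW : D (PowerSeries.coeff 0 W) = 0 := by
    have := congrArg (PowerSeries.coeff 0) hb
    rw [map_neg, PowerSeries.coeff_X_pow_mul', PowerSeries.coeff_C_mul, coeff_seriesD] at this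
    simpa using this
  refine ⟨fun n => PowerSeries.coeff n H, fun n => PowerSeries.coeff n W, fun n => ?_, fun n => ?_,
    ?_, ?_, fun n => ?_, fun n => ?_⟩
  · rw [hcH, PowerSeries.coeff_one]; simp
  · rw [hcW, PowerSeries.coeff_C]; simp
  · rw [eq_C_of_D_eq_zero hDH, hcH]; simp
  · rw [eq_C_of_D_eq_zero hDW, hcW]; simp [c_ofNat]
  · have := congrArg (PowerSeries.coeff (n + 2)) ha
    rw [PowerSeries.coeff_X_pow_mul] at this
    simp only [map_add, PowerSeries.coeff_C_mul, coeff_seriesD] at this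
    exact this
  · have := congrArg (PowerSeries.coeff (n + 4)) hb
    rw [map_neg, PowerSeries.coeff_X_pow_mul] at this
    simp only [PowerSeries.coeff_C_mul, coeff_seriesD, map_add, add_mul] at this
    linear_combination this

theorem opJ_D {p r : DiffPoly} (hp : MvPolynomial.constantCoeff p = 0)
    (hr : D r = potentialDensity p) (hr0 : MvPolynomial.constantCoeff r = 0) :
    opJ (D p) = D (D (D (D p))) + 8 * u 0 * D (D p) + 7 * u 1 * D p
      + 2 * (u 2 + 4 * u 0 ^ 2) * p + 2 * r := by
  have h1 : Dinv (D p) = p := Dinv_eq rfl hp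
  have h2 : Dinv (u 0 * D^[2] (D p) + 4 * u 0 ^ 2 * D p) = r := Dinv_eq hr hr0
  rw [opJ, h1, h2]
  rfl

namespace ResolventCoeffs

variable {H W : ℕ → DiffPoly}

/-- The relation `D_W` contains the density of `H (n + 1)` linearly, next to a total derivative;
solving for the density gives its primitive, and `𝒥 (D (H (n + 1))) = -9 W (n + 5)`. -/
theorem exists_primitive (h : ResolventCoeffs H W) (n : ℕ) :
    ∃ r, D r = potentialDensity (H (n + 1)) ∧ MvPolynomial.constantCoeff r = 0 ∧
      D (D (D (D (H (n + 1))))) + 8 * u 0 * D (D (H (n + 1))) + 7 * u 1 * D (H (n + 1))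
        + 2 * (u 2 + 4 * u 0 ^ 2) * H (n + 1) + 2 * r = - 9 * W (n + 5) := by
  have h2 : c (1 / 2) * 2 = 1 := by rw [← c_ofNat, c, ← map_mul]; norm_num
  set e := c (1 / 2) with he
  have hDe : D e = 0 := D_c _
  refine ⟨e * (- 9 * W (n + 5) - (D (D (D (D (H (n + 1))))) + 8 * u 0 * D (D (H (n + 1)))
    + 7 * u 1 * D (H (n + 1)) + 2 * (u 2 + 4 * u 0 ^ 2) * H (n + 1))), ?_, ?_, ?_⟩
  · have hw := h.D_W (n + 1)
    simp only [potentialDensity, Function.iterate_succ_apply', Function.iterate_zero_apply,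
      D_mul, D_u, hDe, map_sub, map_add, map_neg, D_ofNat, D_sq]
    linear_combination -e * hw + (u 0 * D (D (D (H (n + 1)))) + 4 * u 0 ^ 2 * D (H (n + 1))) * h2
  · simp [constantCoeff_D, h.constantCoeff_H n, h.constantCoeff_W (n + 4)]
  · linear_combination (- 9 * W (n + 5) - (D (D (D (D (H (n + 1))))) + 8 * u 0 * D (D (H (n + 1)))
      + 7 * u 1 * D (H (n + 1)) + 2 * (u 2 + 4 * u 0 ^ 2) * H (n + 1))) * h2

/-- The hierarchy's second seed `𝔥_1` is a multiple of a coefficient of `W`. -/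
theorem W_four (h : ResolventCoeffs H W) : c (-9 / 2) * W 4 = u 2 + 4 * u 0 ^ 2 := by
  have hw := h.D_W 0
  rw [h.H_zero] at hw
  simp only [Derivation.map_one_eq_zero, map_zero] at hw
  have h9 : c (-9 / 2) * 2 = -9 := by
    rw [← c_ofNat, c, ← map_mul, ← c_ofNat 9, c, ← map_neg]; norm_num
  apply eq_of_D_eq
  · apply eq_of_ofNat_mul_eq 2
    simp only [D_mul, D_c, map_add, D_u, D_ofNat, D_sq]
    linear_combination D (W 4) * h9 - hw
  · simp [h.constantCoeff_W 3]

/-- The recursion `𝒥𝒟` moves a coefficient of the second series six places up. -/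
theorem opJ_opD (h : ResolventCoeffs H W) (a : ℝ) (n : ℕ) :
    ∃ p r, D p = opD (c a * W n) ∧ MvPolynomial.constantCoeff p = 0 ∧
      D r = potentialDensity p ∧ MvPolynomial.constantCoeff r = 0 ∧
      opJ (opD (c a * W n)) = c (-27 * a) * W (n + 6) := by
  obtain ⟨r, hr, hr0, hrW⟩ := h.exists_primitive (n + 1)
  have hD : D (3 * c a * H (n + 2)) = opD (c a * W n) := by
    have := h.opD_W n
    simp only [opD, Function.iterate_succ_apply', Function.iterate_zero_apply, D_mul, D_c, D_ofNat,
      map_add, map_zero] at this ⊢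
    linear_combination -c a * this
  have hp0 : MvPolynomial.constantCoeff (3 * c a * H (n + 2)) = 0 := by
    simp [h.constantCoeff_H (n + 1)]
  have hr' : D (3 * c a * r) = potentialDensity (3 * c a * H (n + 2)) := by
    simp only [potentialDensity, Function.iterate_succ_apply', Function.iterate_zero_apply, D_mul,
      D_c, D_ofNat, map_add, map_zero] at hr ⊢
    linear_combination 3 * c a * hr
  have hr0' : MvPolynomial.constantCoeff (3 * c a * r) = 0 := by simp [hr0]
  refine ⟨3 * c a * H (n + 2), 3 * c a * r, hD, hp0, hr', hr0', ?_⟩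
  have h27 : c (-27 * a) = -27 * c a := by
    rw [c, map_mul, map_neg, ← c, ← c, c_ofNat]
  rw [← hD, opJ_D hp0 hr' hr0', h27]
  simp only [D_mul, D_c, D_ofNat, map_add, map_zero]
  linear_combination 3 * c a * hrW

theorem exists_h_eq (h : ResolventCoeffs H W) (n : ℕ) : ∃ a m, KK.h n = c a * W m := by
  induction n using Nat.twoStepInduction with
  | zero =>
    refine ⟨1 / 2, 0, ?_⟩
    rw [h.W_zero, ← c_ofNat, c, ← map_mul, KK.h]
    norm_num
  | one => exact ⟨_, 4, h.W_four.symm⟩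
  | more n ih _ =>
    obtain ⟨a, m, hm⟩ := ih
    obtain ⟨_, _, _, _, _, _, hJ⟩ := h.opJ_opD a m
    exact ⟨_, _, by rw [KK.h, hm, hJ]⟩

end ResolventCoeffs

/-- All the primitives in the recursion exist: `𝔮_n` is a multiple of a coefficient of `H`. -/
theorem exists_primitives_hierarchy (n : ℕ) :
    D (q n) = opD (h n) ∧ MvPolynomial.constantCoeff (q n) = 0 ∧
      ∃ r, D r = potentialDensity (q n) ∧ MvPolynomial.constantCoeff r = 0 := by
  obtain ⟨H, W, hHW⟩ := exists_resolventCoeffs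
  obtain ⟨a, m, hm⟩ := hHW.exists_h_eq n
  obtain ⟨p, r, hp, hp0, hr, hr0, -⟩ := hHW.opJ_opD a m
  have hq : q n = p := by rw [q, hm]; exact Dinv_eq hp hp0
  rw [hq]
  exact ⟨by rw [hp, hm], hp0, r, hr, hr0⟩

/-! ### The evolution of the curvature -/

/-- The potentials whose density is a total derivative; for these `D (D⁻¹ 𝔭) = 𝔭` holds for the
nonlocal terms of `𝒮` and `ℳ`. -/
def HasPrimitive (p : DiffPoly) : Prop := ∃ r, D r = potentialDensity p

theorem HasPrimitive.D_Dinv {p : DiffPoly} (hp : HasPrimitive p) :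
    D (Dinv (potentialDensity p)) = potentialDensity p := KK.D_Dinv hp

theorem HasPrimitive.mem_potentials {p : DiffPoly} (hp : HasPrimitive p) : p ∈ potentials :=
  mem_potentials_of_D_eq hp.choose_spec

theorem potentialDensity_add (p p' : DiffPoly) :
    potentialDensity (p + p') = potentialDensity p + potentialDensity p' := by
  simp only [potentialDensity, iterate_map_add, map_add]; ring

theorem potentialDensity_c_mul (r : ℝ) (p : DiffPoly) :
    potentialDensity (c r * p) = c r * potentialDensity p := by
  simp only [potentialDensity, Function.iterate_succ_apply', Function.iterate_zero_apply, D_mul,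
    D_c, mul_zero, add_zero]
  ring

theorem HasPrimitive.add {p p' : DiffPoly} (hp : HasPrimitive p) (hp' : HasPrimitive p') :
    HasPrimitive (p + p') ∧ Dinv (potentialDensity (p + p'))
      = Dinv (potentialDensity p) + Dinv (potentialDensity p') := by
  have h : D (Dinv (potentialDensity p) + Dinv (potentialDensity p'))
      = potentialDensity (p + p') := by
    rw [map_add, hp.D_Dinv, hp'.D_Dinv, potentialDensity_add]
  exact ⟨⟨_, h⟩, Dinv_eq h (by simp [constantCoeff_Dinv])⟩

theorem HasPrimitive.c_mul {p : DiffPoly} (hp : HasPrimitive p) (r : ℝ) :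
    HasPrimitive (c r * p) ∧ Dinv (potentialDensity (c r * p))
      = c r * Dinv (potentialDensity p) := by
  have h : D (c r * Dinv (potentialDensity p)) = potentialDensity (c r * p) := by
    rw [D_mul, hp.D_Dinv, D_c, mul_zero, add_zero, potentialDensity_c_mul]
  exact ⟨⟨_, h⟩, Dinv_eq h (by simp [constantCoeff_Dinv])⟩

theorem opS_add {p p' : DiffPoly} (hp : HasPrimitive p) (hp' : HasPrimitive p') :
    opS (p + p') = opS p + opS p' := by
  simp only [opS, (hp.add hp').2, Function.iterate_succ_apply', Function.iterate_zero_apply,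
    map_add]
  ring

theorem opS_c_mul {p : DiffPoly} (hp : HasPrimitive p) (r : ℝ) :
    opS (c r * p) = c r * opS p := by
  simp only [opS, (hp.c_mul r).2, Function.iterate_succ_apply', Function.iterate_zero_apply,
    D_mul, D_c, mul_zero, add_zero]
  ring

/-- The operator `𝒮` with its rational coefficients brought to the denominator `18`. -/
theorem opS_eq (p : DiffPoly) : opS p = c (1 / 18) * (2 * u 1 * Dinv (potentialDensity p)
    + 2 * (20 * u 0 ^ 2 * u 1 + 25 * u 1 * u 2 + 10 * u 0 * u 3 + u 5) * p
    + (27 + 32 * u 0 ^ 3 + 71 * u 1 ^ 2 + 82 * u 0 * u 2 + 13 * u 4) * D p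
    + (118 * u 0 * u 1 + 35 * u 3) * D (D p)
    + (36 * u 0 ^ 2 + 49 * u 2) * D (D (D p))
    + 36 * u 1 * D (D (D (D p)))
    + 12 * u 0 * D (D (D (D (D p))))
    + D (D (D (D (D (D (D p))))))) := by
  have h : (18 : DiffPoly) * c (1 / 18) = 1 := by rw [← c_ofNat, c, ← map_mul]; norm_num
  have hc : ∀ (a b : ℝ) (b' : DiffPoly), c b = b' → a = b / 18 → c a = b' * c (1 / 18) := by
    rintro a b _ rfl rfl
    rw [c, ← map_mul]; congr 1; ring
  unfold opS
  rw [hc (1 / 9) 2 2 (c_ofNat 2) (by norm_num), hc (3 / 2) 27 27 (c_ofNat 27) (by norm_num),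
    hc (16 / 9) 32 32 (c_ofNat 32) (by norm_num), hc (71 / 18) 71 71 (c_ofNat 71) (by norm_num),
    hc (41 / 9) 82 82 (c_ofNat 82) (by norm_num), hc (13 / 18) 13 13 (c_ofNat 13) (by norm_num),
    hc (59 / 9) 118 118 (c_ofNat 118) (by norm_num), hc (35 / 18) 35 35 (c_ofNat 35) (by norm_num),
    hc (49 / 18) 49 49 (c_ofNat 49) (by norm_num), hc (2 / 3) 12 12 (c_ofNat 12) (by norm_num)]
  simp only [Function.iterate_succ_apply', Function.iterate_zero_apply]
  linear_combination (-2 * u 0 ^ 2 * D (D (D p)) - 2 * u 1 * D (D (D (D p)))) * h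

/-- The operator `𝒮` is, up to the factor `18`, the sum of `𝒟𝒥D` and `27 D`. -/
theorem opS_eq_opD_opJ {p : DiffPoly} (hp : MvPolynomial.constantCoeff p = 0)
    (h : HasPrimitive p) : 18 * opS p = opD (opJ (D p)) + 27 * D p := by
  have h18 : (18 : DiffPoly) * c (1 / 18) = 1 := by rw [← c_ofNat, c, ← map_mul]; norm_num
  rw [opJ_D hp h.D_Dinv (constantCoeff_Dinv _), opS_eq, ← mul_assoc, h18, one_mul]
  have hD := h.D_Dinv
  set r := Dinv (potentialDensity p)
  simp only [potentialDensity, Function.iterate_succ_apply', Function.iterate_zero_apply] at hD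
  simp only [opD, Function.iterate_succ_apply', Function.iterate_zero_apply, map_add, D_mul, D_u,
    D_ofNat, hD, D_sq, map_zero]
  ring

theorem v_zero : v 0 = 0 := by simp [v, ell]

theorem v_one : v 1 = c 9 := by
  have h2 : (18 : DiffPoly) * c (1 / 2) = c 9 := by rw [← c_ofNat, c, ← map_mul]; norm_num
  simpa [v, ell, w] using h2

theorem v_add_two (n : ℕ) : v (n + 2) = 18 * q n - 27 * v n := by
  have hl : ell (n + 2) = ell n + 1 := by
    have he : Even (n + 2) ↔ Even n := by simp [parity_simps]
    unfold ell
    simp only [show (n + 2) / 2 = n / 2 + 1 by omega, he]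
    push_cast; ring
  have hl0 : 0 ≤ ell n + 1 := by
    unfold ell
    split_ifs <;> omega
  have hl1 : (ell (n + 2) + 1).toNat = (ell n + 1).toNat + 1 := by rw [hl]; omega
  unfold v
  rw [hl1, Finset.sum_range_succ', mul_add]
  have : ∀ j, n + 2 - 2 * (j + 1) = n - 2 * j := fun j => by omega
  simp only [this, pow_succ, pow_zero, one_mul, mul_zero, Nat.sub_zero]
  have e : ∑ j ∈ Finset.range (ell n + 1).toNat, (-27 : DiffPoly) ^ j * -27 * w (n - 2 * j)
      = -27 * ∑ j ∈ Finset.range (ell n + 1).toNat, (-27) ^ j * w (n - 2 * j) := by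
    rw [Finset.mul_sum]
    exact Finset.sum_congr rfl fun j _ => by ring
  rw [e, w]
  ring

theorem lam_add_two (n : ℕ) : lam (n + 2) = -27 * lam n := by
  unfold lam
  rw [show (n + 2) / 2 = n / 2 + 1 by omega, pow_add (-1 : ℝ) n 2, pow_succ (-27 : ℝ)]
  ring

theorem hasPrimitive_c (r : ℝ) : HasPrimitive (c r) :=
  ⟨0, by simp [potentialDensity, Function.iterate_succ_apply']⟩

/-- The potentials `𝔳_n` satisfy a two-step recursion along which `𝒮(𝔳_n) + λ_n u'` reproduces
`𝒟𝔥_n`. -/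
theorem v_spec (n : ℕ) : HasPrimitive (v n) ∧ opS (v n) + c (lam n) * u 1 = opD (h n) := by
  induction n using Nat.twoStepInduction with
  | zero =>
    rw [v_zero]
    refine ⟨by simpa using hasPrimitive_c 0, ?_⟩
    have : opS 0 = 0 := by simpa using opS_c_mul (hasPrimitive_c 0) 0
    rw [this]
    simp [lam, h, opD, Function.iterate_succ_apply']
  | one =>
    rw [v_one]
    refine ⟨hasPrimitive_c 9, ?_⟩
    have h0 : Dinv (potentialDensity (c 9)) = 0 :=
      Dinv_eq (by simp [potentialDensity, Function.iterate_succ_apply']) (map_zero _)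
    have h18 : (18 : DiffPoly) * c (1 / 18) = 1 := by rw [← c_ofNat, c, ← map_mul]; norm_num
    have hl : lam 1 = 0 := by simp [lam]
    rw [opS_eq, h0, hl, c_ofNat]
    simp only [opD, h, Function.iterate_succ_apply', Function.iterate_zero_apply, map_add, D_mul,
      D_u, D_ofNat, D_sq, map_zero, c]
    linear_combination (20 * u 0 ^ 2 * u 1 + 25 * u 1 * u 2 + 10 * u 0 * u 3 + u 5) * h18
  | more n ih _ =>
    obtain ⟨hv, hS⟩ := ih
    obtain ⟨hq, hq0, r, hr, -⟩ := exists_primitives_hierarchy n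
    have hqp : HasPrimitive (q n) := ⟨r, hr⟩
    have e : v (n + 2) = c 18 * q n + c (-27) * v n := by
      rw [v_add_two, c_ofNat, c, map_neg, ← c, c_ofNat]; ring
    have h1 := hqp.c_mul 18
    have h2 := hv.c_mul (-27)
    refine ⟨by rw [e]; exact (h1.1.add h2.1).1, ?_⟩
    have h3 := opS_eq_opD_opJ hq0 hqp
    rw [hq] at h3
    rw [e, opS_add h1.1 h2.1, opS_c_mul hqp, opS_c_mul hv, lam_add_two, KK.h, c_ofNat, c, c,
      map_neg, map_mul, map_neg, ← c, ← c, c_ofNat]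
    linear_combination h3 - 27 * hS

/-! ### The compatibility identities -/

/-- If `V = ∑ rᵢ Γ⁽ⁱ⁾` for a solution of `Γ''' = (1 - u') Γ - 2 u Γ'`, then
`V' = ∑ (prolong r)ᵢ Γ⁽ⁱ⁾`. -/
def prolong (r : Fin 3 → DiffPoly) : Fin 3 → DiffPoly :=
  ![D (r 0) + (1 - u 1) * r 2, r 0 + D (r 1) - 2 * u 0 * r 2, r 1 + D (r 2)]

/-- The components, with respect to `Γ, Γ', Γ''`, of the velocity of the canonical lift `Γ` along
an integral curve of `X_{𝔭,λ}`. The component along `Γ` is the one which makes the time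
evolution of the frame traceless, so that it preserves `det(Γ, Γ', Γ'') = 1`. -/
def velocity (p : DiffPoly) (l : ℝ) : Fin 3 → DiffPoly :=
  ![- D (opM p - c l) - c (1 / 3) * D (D p) + c (4 / 3) * u 0 * p, opM p - c l, p]

/-- The operator `ℳ` with its rational coefficients brought to the denominator `18`. -/
theorem opM_eq (p : DiffPoly) : opM p = c (1 / 18) * (-2 * Dinv (potentialDensity p)
    - (2 * u 2 + 8 * u 0 ^ 2) * p - (9 + 7 * u 1) * D p - 8 * u 0 * D (D p)
    - D (D (D (D p)))) := by
  have hc : ∀ (a b : ℝ) (b' : DiffPoly), c b = b' → a = b / 18 → c a = b' * c (1 / 18) := by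
    rintro a b _ rfl rfl
    rw [c, ← map_mul]; congr 1; ring
  unfold opM
  rw [hc (1 / 9) 2 2 (c_ofNat 2) (by norm_num), hc (1 / 2) 9 9 (c_ofNat 9) (by norm_num),
    hc (4 / 9) 8 8 (c_ofNat 8) (by norm_num), hc (7 / 18) 7 7 (c_ofNat 7) (by norm_num)]
  simp only [Function.iterate_succ_apply', Function.iterate_zero_apply]
  ring

/-- Differentiating `Γ''' = (1 - u') Γ - 2 u Γ'` along the field with velocity `r` shows that the
curvature evolves by `u_t = -(𝒮(𝔭) + λ u')`; the tangential component `ℳ(𝔭) - λ` is the one for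
which the three components are consistent. -/
theorem prolong_velocity {p : DiffPoly} (hp : HasPrimitive p) (l : ℝ) :
    (prolong^[3] (velocity p l)) = fun i => (1 - u 1) * velocity p l i
      - 2 * u 0 * prolong (velocity p l) i
      + ![D (opS p + c l * u 1), 2 * (opS p + c l * u 1), 0] i := by
  have h18 : (18 : DiffPoly) * c (1 / 18) = 1 := by rw [← c_ofNat, c, ← map_mul]; norm_num
  have h3 : c (1 / 3) = 6 * c (1 / 18) := by rw [← c_ofNat, c, ← map_mul]; norm_num
  have h43 : c (4 / 3) = 24 * c (1 / 18) := by rw [← c_ofNat, c, ← map_mul]; norm_num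
  have hD := hp.D_Dinv
  simp only [potentialDensity, Function.iterate_succ_apply', Function.iterate_zero_apply] at hD
  simp only [Function.iterate_succ_apply', Function.iterate_zero_apply]
  ext1 i
  fin_cases i
  · simp only [prolong, velocity, opM_eq, opS_eq, h3, h43, potentialDensity, Fin.zero_eta,
      Matrix.cons_val, map_add, map_sub, map_neg, D_mul, D_u, D_c, D_ofNat, D_sq, D_cube, map_zero,
      Function.iterate_succ_apply', Function.iterate_zero_apply, hD, Derivation.map_one_eq_zero]
    linear_combination (3 * u 1 * D (D p) + 3 * u 2 * D p + u 3 * p - 3 * D (D p)) * h18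
  · simp only [prolong, velocity, opM_eq, opS_eq, h3, h43, potentialDensity, Fin.mk_one,
      Matrix.cons_val, map_add, map_sub, map_neg, D_mul, D_u, D_c, D_ofNat, D_sq, D_cube, map_zero,
      Function.iterate_succ_apply', Function.iterate_zero_apply, hD, Derivation.map_one_eq_zero]
    linear_combination (6 * u 0 * D (D p) + 9 * u 1 * D p + 4 * u 2 * p - 3 * D p) * h18
  · simp only [prolong, velocity, opM_eq, opS_eq, h3, h43, potentialDensity, Fin.reduceFinMk,
      Matrix.cons_val, map_add, map_sub, map_neg, D_mul, D_u, D_c, D_ofNat, D_sq, D_cube, map_zero,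
      Function.iterate_succ_apply', Function.iterate_zero_apply, hD, Derivation.map_one_eq_zero]
    linear_combination (4 * u 0 * D p - D (D (D p)) + 4 * u 1 * p) * h18

theorem trace_prolong_velocity (p : DiffPoly) (l : ℝ) :
    velocity p l 0 + prolong (velocity p l) 1 + prolong (prolong (velocity p l)) 2 = 0 := by
  have h3 : 3 * c (1 / 3) = 1 := by rw [← c_ofNat, c, ← map_mul]; norm_num
  have h43 : c (4 / 3) = 4 * c (1 / 3) := by rw [← c_ofNat, c, ← map_mul]; norm_num
  simp only [prolong, velocity, h43, Matrix.cons_val, map_add]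
  linear_combination (-D (D p) + 4 * u 0 * p) * h3

/-! ### Linear differential equations -/

section LinearODE

variable {F : Type*} [NormedAddCommGroup F] [NormedSpace ℝ F]

/-- The terms of the Dyson series of the linear equation `y' = M(r) y`. -/
def dysonTerm (M : ℝ → F →L[ℝ] F) (y₀ : F) : ℕ → ℝ → F
  | 0 => fun _ => y₀
  | n + 1 => fun r => ∫ t in (0 : ℝ)..r, M t (dysonTerm M y₀ n t)

theorem continuous_dysonTerm {M : ℝ → F →L[ℝ] F} (hM : Continuous M) (y₀ : F) (n : ℕ) :
    Continuous (dysonTerm M y₀ n) := by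
  induction n with
  | zero => exact continuous_const
  | succ n ih =>
    exact intervalIntegral.continuous_primitive
      (fun a b => (hM.clm_apply ih).intervalIntegrable a b) 0

theorem hasDerivAt_dysonTerm [CompleteSpace F] {M : ℝ → F →L[ℝ] F} (hM : Continuous M) (y₀ : F)
    (n : ℕ) (r : ℝ) :
    HasDerivAt (dysonTerm M y₀ (n + 1)) (M r (dysonTerm M y₀ n r)) r :=
  ((hM.clm_apply (continuous_dysonTerm hM y₀ n)).integral_hasStrictDerivAt 0 r).hasDerivAt

theorem norm_dysonTerm_le {M : ℝ → F →L[ℝ] F} {K : ℝ}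
    (hK : ∀ r, ‖M r‖ ≤ K) (y₀ : F) (n : ℕ) (r : ℝ) :
    ‖dysonTerm M y₀ n r‖ ≤ ‖y₀‖ * (K ^ n * |r| ^ n / n.factorial) := by
  have hK0 : 0 ≤ K := (norm_nonneg _).trans (hK 0)
  induction n generalizing r with
  | zero => simp [dysonTerm]
  | succ n ih =>
    have hint : MeasureTheory.IntegrableOn
        (fun t : ℝ => ‖y₀‖ * K ^ (n + 1) / n.factorial * |t - 0| ^ n) (Set.uIoc 0 r) :=
      (Continuous.integrableOn_uIoc (by fun_prop))
    calc ‖dysonTerm M y₀ (n + 1) r‖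
        ≤ ∫ t in Set.uIoc 0 r, ‖M t (dysonTerm M y₀ n t)‖ :=
          intervalIntegral.norm_integral_le_integral_norm_uIoc
      _ ≤ ∫ t in Set.uIoc 0 r, ‖y₀‖ * K ^ (n + 1) / n.factorial * |t - 0| ^ n := by
          refine MeasureTheory.integral_mono_of_nonneg
            (Filter.Eventually.of_forall fun t => norm_nonneg _) hint
            (Filter.Eventually.of_forall fun t => ?_)
          calc ‖M t (dysonTerm M y₀ n t)‖ ≤ K * (‖y₀‖ * (K ^ n * |t| ^ n / n.factorial)) :=
                (M t).le_of_opNorm_le_of_le (hK t) (ih t)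
            _ = ‖y₀‖ * K ^ (n + 1) / n.factorial * |t - 0| ^ n := by rw [sub_zero]; ring
      _ = ‖y₀‖ * (K ^ (n + 1) * |r| ^ (n + 1) / (n + 1).factorial) := by
          rw [MeasureTheory.integral_const_mul, integral_pow_abs_sub_uIoc, sub_zero,
            Nat.factorial_succ]
          push_cast
          field_simp

/-- Sum of the Dyson series; the ball of radius `2` serves as a neighbourhood of `[0, 1]`. -/
theorem exists_linear_ode [CompleteSpace F] {M : ℝ → F →L[ℝ] F} (hM : Continuous M) {K : ℝ}
    (hK : ∀ r, ‖M r‖ ≤ K) (y₀ : F) :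
    ∃ y : ℝ → F, y 0 = y₀ ∧ ∀ r ∈ Metric.ball (0 : ℝ) 2, HasDerivAt y (M r (y r)) r := by
  have hK0 : 0 ≤ K := (norm_nonneg _).trans (hK 0)
  set φ := dysonTerm M y₀ with hφ
  have hb : ∀ n, ∀ r ∈ Metric.ball (0 : ℝ) 2, ‖φ n r‖ ≤ ‖y₀‖ * ((K * 2) ^ n / n.factorial) := by
    intro n r hr
    have hr' : |r| ≤ 2 := by simpa using (Metric.mem_ball.mp hr).le
    refine (norm_dysonTerm_le hK y₀ n r).trans ?_
    rw [mul_pow]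
    gcongr
  have hs : Summable fun n => ‖y₀‖ * ((K * 2) ^ n / n.factorial) :=
    (Real.summable_pow_div_factorial _).mul_left _
  have hsum : ∀ r ∈ Metric.ball (0 : ℝ) 2, Summable fun n => φ n r := fun r hr =>
    hs.of_norm_bounded fun n => hb n r hr
  have h0 : (0 : ℝ) ∈ Metric.ball (0 : ℝ) 2 := by simp
  refine ⟨fun r => y₀ + ∑' n, φ (n + 1) r, ?_, fun r hr => ?_⟩
  · have : ∀ n, φ (n + 1) 0 = 0 := fun n => intervalIntegral.integral_same
    simp [this]
  · have h1 := hasDerivAt_tsum_of_isPreconnected (g := fun n => φ (n + 1))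
      (g' := fun n r => M r (φ n r)) (hs.mul_left K) Metric.isOpen_ball
      (convex_ball (0 : ℝ) 2).isPreconnected (fun n r _ => hasDerivAt_dysonTerm hM y₀ n r)
      (fun n r hr => (M r).le_of_opNorm_le_of_le (hK r) (hb n r hr)) h0
      ((summable_nat_add_iff 1).mpr (hsum 0 h0)) hr
    have h2 : M r (y₀ + ∑' n, φ (n + 1) r) = ∑' n, M r (φ n r) := by
      rw [← (M r).map_tsum (hsum r hr), (hsum r hr).tsum_eq_zero_add]
      rfl
    rw [h2]
    exact h1.const_add y₀

end LinearODE

/-! ### Parallel sections of flat connections -/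

section Parallel

variable {E F : Type*} [NormedAddCommGroup E] [NormedSpace ℝ E]
  [NormedAddCommGroup F] [NormedSpace ℝ F]

/-- First-order Taylor estimate, uniform along a compact set. -/
theorem exists_uniform_taylor {G : Type*} [NormedAddCommGroup G] [NormedSpace ℝ G] {f : E → G}
    {U K : Set E} (hU : IsOpen U) (hf : ContDiffOn ℝ 1 f U) (hK : IsCompact K) (hKU : K ⊆ U)
    {ε : ℝ} (hε : 0 < ε) :
    ∃ ρ > 0, ∀ x ∈ K, ∀ h : E, ‖h‖ < ρ →
      x + h ∈ U ∧ ‖f (x + h) - f x - fderiv ℝ f x h‖ ≤ ε * ‖h‖ := by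
  obtain ⟨δ, hδ, hδU⟩ := hK.exists_thickening_subset_open hU hKU
  have hcont : ∀ x ∈ K, ContinuousAt (fderiv ℝ f) x := fun x hx =>
    (hf.continuousOn_fderiv_of_isOpen hU le_rfl).continuousAt (hU.mem_nhds (hKU hx))
  have hunif := hK.uniformContinuousAt_of_continuousAt (fderiv ℝ f) hcont
    (Metric.dist_mem_uniformity hε)
  obtain ⟨η, hη, hηU⟩ := Metric.mem_uniformity_dist.mp hunif
  refine ⟨min δ η, lt_min hδ hη, fun x hx h hh => ?_⟩
  have hball : ∀ y ∈ Metric.ball x (min δ η), y ∈ U := fun y hy =>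
    hδU (Metric.mem_thickening_iff.mpr ⟨x, hx, (Metric.mem_ball.mp hy).trans_le (min_le_left _ _)⟩)
  have hxh : x + h ∈ Metric.ball x (min δ η) := by simpa using hh
  refine ⟨hball _ hxh, ?_⟩
  have := (convex_ball x (min δ η)).norm_image_sub_le_of_norm_fderiv_le' (𝕜 := ℝ) (f := f)
    (φ := fderiv ℝ f x) (C := ε)
    (fun y hy => (hf.differentiableOn one_ne_zero).differentiableAt (hU.mem_nhds (hball y hy)))
    (fun y hy => ?_) (Metric.mem_ball_self (lt_min hδ hη)) hxh
  · simpa using this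
  · have h1 : dist x y < η := by
      rw [dist_comm]; exact (Metric.mem_ball.mp hy).trans_le (min_le_right _ _)
    have h2 : dist (fderiv ℝ f x) (fderiv ℝ f y) < ε := hηU h1 hx
    rw [dist_comm, dist_eq_norm] at h2
    exact h2.le

theorem exists_norm_le_unit {G : Type*} [NormedAddCommGroup G] {f : ℝ → G}
    (hf : ContinuousOn f (Set.Icc 0 1)) : ∃ C, ∀ r ∈ Set.Icc (0 : ℝ) 1, ‖f r‖ ≤ C :=
  isCompact_Icc.exists_bound_of_continuousOn hf

/-- Uniqueness of parallel sections: along rays they solve the same linear equation. -/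
theorem parallel_unique {U : Set E} (hUc : Convex ℝ U) {α : E → E →L[ℝ] F →L[ℝ] F}
    (hα : ContinuousOn α U) {p₀ : E} (hp₀ : p₀ ∈ U) {y y' : E → F}
    (hy : ∀ p ∈ U, HasFDerivAt y ((α p).flip (y p)) p)
    (hy' : ∀ p ∈ U, HasFDerivAt y' ((α p).flip (y' p)) p) (h0 : y p₀ = y' p₀) :
    ∀ p ∈ U, y p = y' p := by
  intro p hp
  set c : ℝ → E := fun r => p₀ + r • (p - p₀) with hc
  have hcU : ∀ r ∈ Set.Icc (0 : ℝ) 1, c r ∈ U := fun r hr =>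
    hUc.add_smul_sub_mem hp₀ hp hr
  have hcc : Continuous c := by fun_prop
  have hαc : ContinuousOn (fun r => α (c r)) (Set.Icc 0 1) := hα.comp hcc.continuousOn hcU
  obtain ⟨M, hM⟩ := exists_norm_le_unit (G := E →L[ℝ] F →L[ℝ] F) hαc
  have hcd : ∀ r, HasDerivAt c (p - p₀) r := fun r => by
    have := ((hasDerivAt_id r).smul_const (p - p₀)).const_add p₀
    rwa [one_smul] at this
  have hz : ∀ r ∈ Set.Icc (0 : ℝ) 1, HasDerivAt (fun r => y (c r) - y' (c r))
      (α (c r) (p - p₀) (y (c r) - y' (c r))) r := fun r hr => by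
    have := ((hy _ (hcU r hr)).comp_hasDerivAt r (hcd r)).sub
      ((hy' _ (hcU r hr)).comp_hasDerivAt r (hcd r))
    refine this.congr_deriv ?_
    rw [map_sub (α (c r) (p - p₀))]
    rfl
  have := eq_zero_of_abs_deriv_le_mul_abs_self_of_eq_zero_right (K := M * ‖p - p₀‖)
    (fun r hr => (hz r hr).continuousAt.continuousWithinAt)
    (fun r hr => (hz r (Set.Ico_subset_Icc_self hr)).hasDerivWithinAt)
    (by simp [hc, h0]) (fun r hr => ?_) 1 (Set.right_mem_Icc.mpr zero_le_one)
  · simpa [hc, sub_eq_zero] using this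
  · exact (α (c r) (p - p₀)).le_of_opNorm_le
      ((α (c r)).le_of_opNorm_le (hM r (Set.Ico_subset_Icc_self hr)) _) _

/-- Regularity by bootstrapping: the derivative of a parallel section is `α` applied to the
section. -/
theorem contDiffOn_of_parallel [FiniteDimensional ℝ E] {U : Set E} (hU : IsOpen U)
    {α : E → E →L[ℝ] F →L[ℝ] F} (hα : ContDiffOn ℝ ∞ α U) {y : E → F}
    (hy : ∀ p ∈ U, HasFDerivAt y ((α p).flip (y p)) p) : ContDiffOn ℝ ∞ y U := by
  have hd : DifferentiableOn ℝ y U := fun p hp => (hy p hp).differentiableAt.differentiableWithinAt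
  rw [contDiffOn_infty]
  intro n
  induction n with
  | zero => simpa using hd.continuousOn
  | succ n ih =>
    push_cast
    rw [contDiffOn_succ_iff_fderiv_of_isOpen hU]
    refine ⟨hd, by simp, ?_⟩
    have h1 : ContDiffOn ℝ n (fun p => (α p).flip (y p)) U :=
      contDiffOn_clm_apply.mpr fun a =>
        ((contDiffOn_infty.mp hα n).clm_apply contDiffOn_const).clm_apply ih
    exact h1.congr fun p hp => (hy p hp).fderiv

end Parallel

section Flat

variable {E F : Type*} [NormedAddCommGroup E] [NormedSpace ℝ E]
  [NormedAddCommGroup F] [NormedSpace ℝ F]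

/-- Parallel transport along the ray from `p₀` to `p`. -/
theorem exists_ray_transport [CompleteSpace F] {U : Set E} (hUc : Convex ℝ U)
    {α : E → E →L[ℝ] F →L[ℝ] F} (hα : ContinuousOn α U) {p₀ : E} (hp₀ : p₀ ∈ U) (y₀ : F)
    {p : E} (hp : p ∈ U) :
    ∃ η : ℝ → F, η 0 = y₀ ∧ ∀ r ∈ Set.Icc (0 : ℝ) 1,
      HasDerivWithinAt η (α (p₀ + r • (p - p₀)) (p - p₀) (η r)) (Set.Icc 0 1) r := by
  -- the coefficient along the ray, extended by constants to all of `ℝ`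
  set m : ℝ → ℝ := fun r => Set.projIcc (0 : ℝ) 1 zero_le_one r with hm
  have hmc : Continuous m := continuous_subtype_val.comp continuous_projIcc
  have hmI : ∀ r, m r ∈ Set.Icc (0 : ℝ) 1 := fun r => Subtype.coe_prop _
  have hcU : ∀ r ∈ Set.Icc (0 : ℝ) 1, p₀ + r • (p - p₀) ∈ U := fun r hr =>
    hUc.add_smul_sub_mem hp₀ hp hr
  have h1 : ContinuousOn (fun r : ℝ => α (p₀ + r • (p - p₀)) (p - p₀)) (Set.Icc 0 1) :=
    (hα.comp (by fun_prop) hcU).clm_apply continuousOn_const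
  obtain ⟨K, hK⟩ := exists_norm_le_unit h1
  have hM : Continuous fun r => α (p₀ + m r • (p - p₀)) (p - p₀) :=
    h1.comp_continuous hmc hmI
  obtain ⟨η, hη0, hη⟩ := exists_linear_ode hM (fun r => hK _ (hmI r)) y₀
  refine ⟨η, hη0, fun r hr => ?_⟩
  have h2 := hη r (by rw [mem_ball_zero_iff, Real.norm_eq_abs, abs_of_nonneg hr.1]; linarith [hr.2])
  have h3 : m r = r := by rw [hm]; exact congrArg Subtype.val (Set.projIcc_of_mem _ hr)
  rw [h3] at h2
  exact h2.hasDerivWithinAt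

/-- Grönwall's inequality on `[0, 1]`, for a vanishing initial value. -/
theorem norm_le_gronwall_unit {z z' : ℝ → F} {K ε : ℝ}
    (hz : ∀ r ∈ Set.Icc (0 : ℝ) 1, HasDerivWithinAt z (z' r) (Set.Icc 0 1) r)
    (h0 : z 0 = 0) (hb : ∀ r ∈ Set.Icc (0 : ℝ) 1, ‖z' r‖ ≤ K * ‖z r‖ + ε) (hK : 0 < K) :
    ‖z 1‖ ≤ ε * ((Real.exp K - 1) / K) := by
  have := norm_le_gronwallBound_of_norm_deriv_right_le (f := z) (f' := z') (δ := 0) (K := K)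
    (ε := ε) (a := 0) (b := 1) (fun r hr => (hz r hr).continuousWithinAt)
    (fun r hr => (hz r (Set.Ico_subset_Icc_self hr)).mono_of_mem_nhdsWithin
      (Icc_mem_nhdsGE_of_mem hr)) (by simp [h0])
    (fun r hr => hb r (Set.Ico_subset_Icc_self hr)) 1 (Set.right_mem_Icc.mpr zero_le_one)
  rw [gronwallBound_of_K_ne_0 hK.ne'] at this
  refine this.trans (le_of_eq ?_)
  simp only [sub_zero, mul_one, zero_mul, zero_add]
  ring

/-- The error made by first-order variation of the endpoint of a ray solves the linear equation
of the neighbouring ray up to the displayed inhomogeneity; this is where flatness enters. -/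
theorem ray_variation_identity {A A' : E →L[ℝ] F →L[ℝ] F} {A₁ : E →L[ℝ] E →L[ℝ] F →L[ℝ] F}
    {e δ : E} (r : ℝ) (y y' : F)
    (flat : A₁ e δ + (A δ).comp (A e) = A₁ δ e + (A e).comp (A δ)) :
    A' (e + δ) y' - A e y - (A δ y + r • (A₁ e δ y + A δ (A e y)))
      = A' (e + δ) (y' - y - r • A δ y)
        + (((A' - A - A₁ (r • δ)) e + (A' - A) δ) y
          + r • ((A' - A) (e + δ) + A δ) (A δ y)) := by
  have h := congrArg (fun L => L y) flat
  simp only [add_apply, ContinuousLinearMap.comp_apply] at h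
  rw [h]
  simp only [add_apply, sub_apply, map_add, map_sub,
    map_smul, smul_apply]
  module

/-- Bounds for the coefficient and for the inhomogeneity in `ray_variation_identity`: the latter is
`ε ‖δ‖` times a constant independent of `δ`. -/
theorem ray_error_le {A A' : E →L[ℝ] F →L[ℝ] F} {A₁ : E →L[ℝ] E →L[ℝ] F →L[ℝ] F}
    {e δ : E} {r : ℝ} {y : F} {ε a₀ a₁ b : ℝ} (hr : r ∈ Set.Icc (0 : ℝ) 1) (hA : ‖A‖ ≤ a₀)
    (hA₁ : ‖A₁‖ ≤ a₁) (hy : ‖y‖ ≤ b) (hε : 0 ≤ ε) (hε1 : ε ≤ 1) (hδ : ‖δ‖ ≤ ε)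
    (hT : ‖A' - A - A₁ (r • δ)‖ ≤ ε * ‖r • δ‖) :
    ‖A'‖ ≤ a₀ + a₁ + 1 ∧
    ‖((A' - A - A₁ (r • δ)) e + (A' - A) δ) y + r • ((A' - A) (e + δ) + A δ) (A δ y)‖
      ≤ ε * ‖δ‖ * ((‖e‖ + (a₁ + 1) + ((a₁ + 1) * (‖e‖ + 1) + a₀) * a₀) * b) := by
  have ha₀ : 0 ≤ a₀ := (norm_nonneg A).trans hA
  have ha₁ : 0 ≤ a₁ := (norm_nonneg A₁).trans hA₁
  have hb : 0 ≤ b := (norm_nonneg y).trans hy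
  have hδ0 := norm_nonneg δ
  have hrδ : ‖r • δ‖ ≤ ‖δ‖ := by
    rw [norm_smul, Real.norm_eq_abs, abs_of_nonneg hr.1]
    exact mul_le_of_le_one_left hδ0 hr.2
  have hT' : ‖A' - A - A₁ (r • δ)‖ ≤ ε * ‖δ‖ := hT.trans (by gcongr)
  have hΔ : ‖A' - A‖ ≤ (a₁ + 1) * ‖δ‖ := by
    have e1 : A' - A = (A' - A - A₁ (r • δ)) + A₁ (r • δ) := by abel
    rw [e1]
    calc _ ≤ ‖A' - A - A₁ (r • δ)‖ + ‖A₁ (r • δ)‖ := norm_add_le _ _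
      _ ≤ ε * ‖δ‖ + a₁ * ‖δ‖ := add_le_add hT' (A₁.le_of_opNorm_le_of_le hA₁ hrδ)
      _ ≤ 1 * ‖δ‖ + a₁ * ‖δ‖ := by gcongr
      _ = (a₁ + 1) * ‖δ‖ := by ring
  have hδ1 : ‖δ‖ ≤ 1 := hδ.trans hε1
  constructor
  · have e1 : A' = A + (A' - A) := by abel
    rw [e1]
    calc _ ≤ ‖A‖ + ‖A' - A‖ := norm_add_le _ _
      _ ≤ a₀ + (a₁ + 1) * 1 := by gcongr; exact hΔ.trans (by gcongr)
      _ = a₀ + a₁ + 1 := by ring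
  · have n1 : ‖((A' - A - A₁ (r • δ)) e + (A' - A) δ) y‖
        ≤ (ε * ‖δ‖ * ‖e‖ + (a₁ + 1) * ‖δ‖ * ε) * b := by
      refine ContinuousLinearMap.le_of_opNorm_le_of_le _
        ((norm_add_le _ _).trans (add_le_add ?_ ?_)) hy
      · exact ContinuousLinearMap.le_of_opNorm_le _ hT' e
      · exact ContinuousLinearMap.le_of_opNorm_le_of_le _ hΔ hδ
    have n2 : ‖((A' - A) (e + δ) + A δ) (A δ y)‖
        ≤ ((a₁ + 1) * ε * (‖e‖ + 1) + a₀ * ε) * (a₀ * ‖δ‖ * b) := by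
      refine ContinuousLinearMap.le_of_opNorm_le_of_le _
        ((norm_add_le _ _).trans (add_le_add ?_ ?_)) ?_
      · exact ContinuousLinearMap.le_of_opNorm_le_of_le _ (hΔ.trans (by gcongr))
          ((norm_add_le _ _).trans (by gcongr))
      · exact ContinuousLinearMap.le_of_opNorm_le_of_le _ hA hδ
      · exact ContinuousLinearMap.le_of_opNorm_le_of_le _ (A.le_of_opNorm_le hA δ) hy
    have n3 : ‖r • ((A' - A) (e + δ) + A δ) (A δ y)‖
        ≤ ((a₁ + 1) * ε * (‖e‖ + 1) + a₀ * ε) * (a₀ * ‖δ‖ * b) := by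
      rw [norm_smul, Real.norm_eq_abs, abs_of_nonneg hr.1]
      exact (mul_le_of_le_one_left (norm_nonneg _) hr.2).trans n2
    refine (norm_add_le _ _).trans ((add_le_add n1 n3).trans (le_of_eq ?_))
    ring

/-- A flat linear connection on a convex open set has parallel sections with arbitrary value at a
given point: transport along rays is differentiable in the endpoint, with the expected
derivative. -/
theorem exists_parallel [CompleteSpace F] {U : Set E} (hU : IsOpen U) (hUc : Convex ℝ U)
    {α : E → E →L[ℝ] F →L[ℝ] F} (hα : ContDiffOn ℝ 1 α U)
    (flat : ∀ p ∈ U, ∀ a b, fderiv ℝ α p a b + (α p b).comp (α p a)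
      = fderiv ℝ α p b a + (α p a).comp (α p b))
    {p₀ : E} (hp₀ : p₀ ∈ U) (y₀ : F) :
    ∃ y : E → F, y p₀ = y₀ ∧ ∀ p ∈ U, HasFDerivAt y ((α p).flip (y p)) p := by
  have hex : ∀ p : E, ∃ η : ℝ → F, p ∈ U → η 0 = y₀ ∧ ∀ r ∈ Set.Icc (0 : ℝ) 1,
      HasDerivWithinAt η (α (p₀ + r • (p - p₀)) (p - p₀) (η r)) (Set.Icc 0 1) r := fun p => by
    by_cases hp : p ∈ U
    · obtain ⟨η, hη⟩ := exists_ray_transport hUc hα.continuousOn hp₀ y₀ hp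
      exact ⟨η, fun _ => hη⟩
    · exact ⟨0, fun h => absurd h hp⟩
  choose η hη using hex
  refine ⟨fun p => η p 1, ?_, fun p hp => ?_⟩
  · have h := norm_le_gronwall_unit (z := fun r => η p₀ r - y₀) (K := 1) (ε := 0)
      (fun r hr => ((hη p₀ hp₀).2 r hr).sub_const y₀) (by simp [(hη p₀ hp₀).1])
      (fun r _ => by simp) one_pos
    simpa [sub_eq_zero] using h
  · set e := p - p₀ with he
    set γ : ℝ → E := fun r => p₀ + r • e with hγ
    have hγc : Continuous γ := by fun_prop
    have hγU : ∀ r ∈ Set.Icc (0 : ℝ) 1, γ r ∈ U := fun r hr => hUc.add_smul_sub_mem hp₀ hp hr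
    have hγd : ∀ r, HasDerivAt γ e r := fun r => by
      have := ((hasDerivAt_id r).smul_const e).const_add p₀
      rwa [one_smul] at this
    obtain ⟨hp0, hpd⟩ := hη p hp
    have hα0 : ContinuousOn (fun r => α (γ r)) (Set.Icc 0 1) :=
      hα.continuousOn.comp hγc.continuousOn hγU
    have hα1 : ContinuousOn (fun r => fderiv ℝ α (γ r)) (Set.Icc 0 1) :=
      (hα.continuousOn_fderiv_of_isOpen hU le_rfl).comp hγc.continuousOn hγU
    obtain ⟨a₀, ha₀⟩ := exists_norm_le_unit (G := E →L[ℝ] F →L[ℝ] F) hα0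
    obtain ⟨a₁, ha₁⟩ := exists_norm_le_unit (G := E →L[ℝ] E →L[ℝ] F →L[ℝ] F) hα1
    obtain ⟨b, hb⟩ := exists_norm_le_unit (f := η p)
      (fun r hr => (hpd r hr).continuousWithinAt)
    have h0 : (0 : ℝ) ∈ Set.Icc (0 : ℝ) 1 := Set.left_mem_Icc.mpr zero_le_one
    have ha₀' : 0 ≤ a₀ := (norm_nonneg _).trans (ha₀ 0 h0)
    have ha₁' : 0 ≤ a₁ := (norm_nonneg _).trans (ha₁ 0 h0)
    have hb' : 0 ≤ b := (norm_nonneg _).trans (hb 0 h0)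
    -- `ε ‖δ‖ T` bounds the inhomogeneity and `G` is the Grönwall factor for the rate `K`
    set T := (‖e‖ + (a₁ + 1) + ((a₁ + 1) * (‖e‖ + 1) + a₀) * a₀) * b with hT
    have hT0 : 0 ≤ T := by positivity
    set K := (a₀ + a₁ + 1) * (‖e‖ + 1) with hK
    have hK0 : 0 < K := by positivity
    set G := (Real.exp K - 1) / K with hG
    have hG0 : 0 ≤ G := div_nonneg (by linarith [Real.one_le_exp hK0.le]) hK0.le
    rw [hasFDerivAt_iff_isLittleO_nhds_zero, Asymptotics.isLittleO_iff]
    intro C hC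
    set ε := min 1 (C / (T * G + 1)) with hε
    have hTG : 0 < T * G + 1 := by positivity
    have hε0 : 0 < ε := lt_min one_pos (by positivity)
    have hε1 : ε ≤ 1 := min_le_left _ _
    have hεC : ε * (T * G) ≤ C := by
      have : ε * (T * G + 1) ≤ C := by
        rw [← le_div_iff₀ hTG]; exact min_le_right _ _
      nlinarith
    obtain ⟨ρ, hρ, hρU⟩ := exists_uniform_taylor hU hα (isCompact_Icc.image hγc)
      (Set.image_subset_iff.mpr hγU) hε0
    have hball : Metric.ball (0 : E) (min ρ ε) ∈ nhds (0 : E) :=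
      Metric.ball_mem_nhds _ (lt_min hρ hε0)
    filter_upwards [hball] with δ hδ
    rw [mem_ball_zero_iff] at hδ
    have hδρ : ‖δ‖ < ρ := hδ.trans_le (min_le_left _ _)
    have hδε : ‖δ‖ ≤ ε := (hδ.trans_le (min_le_right _ _)).le
    have hγ1 : γ 1 = p := by simp [hγ, he]
    have hpδ : p + δ ∈ U := by
      have := (hρU (γ 1) ⟨1, Set.right_mem_Icc.mpr zero_le_one, rfl⟩ δ hδρ).1
      rwa [hγ1] at this
    obtain ⟨hq0, hqd⟩ := hη (p + δ) hpδ
    -- the deviation of the neighbouring solution from its expected first variation `r • α δ η`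
    have hz := norm_le_gronwall_unit (K := K) (ε := ε * ‖δ‖ * T)
      (z := fun r => η (p + δ) r - η p r - r • α (γ r) δ (η p r))
      (z' := fun r => α (γ r + r • δ) (e + δ) (η (p + δ) r) - α (γ r) e (η p r)
        - (α (γ r) δ (η p r) + r • (fderiv ℝ α (γ r) e δ (η p r) + α (γ r) δ (α (γ r) e (η p r)))))
      (fun r hr => ?_) (by simp [hp0, hq0]) (fun r hr => ?_) hK0
    · have hflip : (α p).flip (η p 1) δ = α p δ (η p 1) := rfl
      simp only [one_smul, hγ1] at hz
      rw [hflip]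
      calc _ ≤ ε * ‖δ‖ * T * G := hz
        _ = ε * (T * G) * ‖δ‖ := by ring
        _ ≤ C * ‖δ‖ := by gcongr
    · have d1 : HasDerivWithinAt (η (p + δ)) (α (γ r + r • δ) (e + δ) (η (p + δ) r))
          (Set.Icc 0 1) r := by
        have := hqd r hr
        rwa [show p₀ + r • (p + δ - p₀) = γ r + r • δ by simp only [hγ, he]; module,
          show p + δ - p₀ = e + δ by rw [he]; abel] at this
      have d2 : HasDerivAt (fun r => α (γ r)) (fderiv ℝ α (γ r) e) r :=
        (((hα.differentiableOn one_ne_zero).differentiableAt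
          (hU.mem_nhds (hγU r hr))).hasFDerivAt).comp_hasDerivAt r (hγd r)
      have d3 : HasDerivWithinAt (fun r => α (γ r) δ) (fderiv ℝ α (γ r) e δ) (Set.Icc 0 1) r := by
        simpa using (d2.clm_apply (hasDerivAt_const r δ)).hasDerivWithinAt
      have d4 := (hasDerivWithinAt_id r (Set.Icc (0 : ℝ) 1)).smul (d3.clm_apply (hpd r hr))
      refine ((d1.sub (hpd r hr)).sub d4).congr_deriv ?_
      simp only [id, one_smul]
      rw [add_comm (r • _)]
    · have hTy := (hρU (γ r) ⟨r, hr, rfl⟩ (r • δ) (lt_of_le_of_lt (by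
        rw [norm_smul, Real.norm_eq_abs, abs_of_nonneg hr.1]
        exact mul_le_of_le_one_left (norm_nonneg δ) hr.2) hδρ)).2
      obtain ⟨b1, b2⟩ := ray_error_le (e := e) hr (ha₀ r hr) (ha₁ r hr) (hb r hr) hε0.le hε1 hδε hTy
      rw [ray_variation_identity r _ _ (flat (γ r) (hγU r hr) e δ)]
      refine (norm_add_le _ _).trans (add_le_add ?_ b2)
      refine ContinuousLinearMap.le_of_opNorm_le _ ?_ _
      exact ContinuousLinearMap.le_of_opNorm_le_of_le _ b1
        ((norm_add_le _ _).trans (by gcongr; exact hδε.trans hε1))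

end Flat

/-! ### Frames over a plane domain -/

/-- A frame: three vectors of `ℝ³`. -/
abbrev Frame : Type := Fin 3 → V3

/-- The action of a coefficient matrix on frames, `(M Y)ᵢ = ∑ⱼ Mᵢⱼ Yⱼ`. -/
def rowOp : (Fin 3 → Fin 3 → ℝ) →L[ℝ] Frame →L[ℝ] Frame :=
  LinearMap.toContinuousLinearMap
    { toFun := fun M => LinearMap.toContinuousLinearMap
        { toFun := fun Y i => ∑ j, M i j • Y j
          map_add' := fun Y Z => by
            ext1 i; simp [smul_add, Finset.sum_add_distrib]
          map_smul' := fun r Y => by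
            ext1 i; simp [Finset.smul_sum, smul_comm r] }
      map_add' := fun M N => by
        ext1 Y; ext1 i
        simp [add_smul, Finset.sum_add_distrib]
      map_smul' := fun r M => by
        ext1 Y; ext1 i
        simp [mul_smul, Finset.smul_sum] }

theorem rowOp_apply (M : Fin 3 → Fin 3 → ℝ) (Y : Frame) (i : Fin 3) :
    rowOp M Y i = ∑ j, M i j • Y j := rfl

theorem rowOp_comp (M N : Fin 3 → Fin 3 → ℝ) :
    (rowOp M).comp (rowOp N) = rowOp fun i j => ∑ k, M i k * N k j := by
  ext1 Y; ext1 i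
  simp only [ContinuousLinearMap.comp_apply, rowOp_apply, Finset.smul_sum, Finset.sum_smul,
    smul_smul]
  rw [Finset.sum_comm]

/-- The connection form `a ds + b dt`. -/
def planeForm (a b : ℝ × ℝ → Fin 3 → Fin 3 → ℝ) (p : ℝ × ℝ) : ℝ × ℝ →L[ℝ] Frame →L[ℝ] Frame :=
  ContinuousLinearMap.smulRightL ℝ (ℝ × ℝ) (Frame →L[ℝ] Frame) (ContinuousLinearMap.fst ℝ ℝ ℝ)
      (rowOp (a p))
    + ContinuousLinearMap.smulRightL ℝ (ℝ × ℝ) (Frame →L[ℝ] Frame) (ContinuousLinearMap.snd ℝ ℝ ℝ)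
      (rowOp (b p))

theorem planeForm_apply (a b : ℝ × ℝ → Fin 3 → Fin 3 → ℝ) (p v : ℝ × ℝ) :
    planeForm a b p v = v.1 • rowOp (a p) + v.2 • rowOp (b p) := rfl

theorem contDiffOn_planeForm {U : Set (ℝ × ℝ)} {n : WithTop ℕ∞}
    {a b : ℝ × ℝ → Fin 3 → Fin 3 → ℝ} (ha : ContDiffOn ℝ n a U) (hb : ContDiffOn ℝ n b U) :
    ContDiffOn ℝ n (planeForm a b) U := by
  unfold planeForm
  exact ((ContinuousLinearMap.contDiff _).comp_contDiffOn
      ((ContinuousLinearMap.contDiff rowOp).comp_contDiffOn ha)).add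
    ((ContinuousLinearMap.contDiff _).comp_contDiffOn
      ((ContinuousLinearMap.contDiff rowOp).comp_contDiffOn hb))

theorem fderiv_planeForm {a b : ℝ × ℝ → Fin 3 → Fin 3 → ℝ} {p : ℝ × ℝ}
    (ha : DifferentiableAt ℝ a p) (hb : DifferentiableAt ℝ b p) (v w : ℝ × ℝ) :
    fderiv ℝ (planeForm a b) p v w
      = w.1 • rowOp (fderiv ℝ a p v) + w.2 • rowOp (fderiv ℝ b p v) := by
  have h : HasFDerivAt (planeForm a b) _ p :=
    ((ContinuousLinearMap.smulRightL ℝ (ℝ × ℝ) (Frame →L[ℝ] Frame)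
      (ContinuousLinearMap.fst ℝ ℝ ℝ)).hasFDerivAt.comp p
        (rowOp.hasFDerivAt.comp p ha.hasFDerivAt)).add
    ((ContinuousLinearMap.smulRightL ℝ (ℝ × ℝ) (Frame →L[ℝ] Frame)
      (ContinuousLinearMap.snd ℝ ℝ ℝ)).hasFDerivAt.comp p
        (rowOp.hasFDerivAt.comp p hb.hasFDerivAt))
  rw [h.fderiv]
  rfl

theorem fderiv_matrix_apply {a : ℝ × ℝ → Fin 3 → Fin 3 → ℝ} {p : ℝ × ℝ}
    (ha : DifferentiableAt ℝ a p) (v : ℝ × ℝ) (i j : Fin 3) :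
    fderiv ℝ a p v i j = fderiv ℝ (fun p => a p i j) p v := by
  have h1 := hasFDerivAt_pi'.mp ha.hasFDerivAt i
  have h2 := hasFDerivAt_pi'.mp h1 j
  rw [h2.fderiv]
  rfl

/-- The integrability condition for the linear system `Y_s = a Y`, `Y_t = b Y`. -/
def IsFlat (a b : ℝ × ℝ → Fin 3 → Fin 3 → ℝ) (p : ℝ × ℝ) : Prop :=
  ∀ i j, fderiv ℝ (fun p => a p i j) p (0, 1) + ∑ k, a p i k * b p k j
    = fderiv ℝ (fun p => b p i j) p (1, 0) + ∑ k, b p i k * a p k j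

theorem exists_frame {U : Set (ℝ × ℝ)} (hU : IsOpen U) (hUc : Convex ℝ U)
    {a b : ℝ × ℝ → Fin 3 → Fin 3 → ℝ} (ha : ContDiffOn ℝ ∞ a U) (hb : ContDiffOn ℝ ∞ b U)
    (flat : ∀ p ∈ U, IsFlat a b p) {p₀ : ℝ × ℝ} (hp₀ : p₀ ∈ U) (Y₀ : Frame) :
    ∃ Y : ℝ × ℝ → Frame, Y p₀ = Y₀ ∧ ContDiffOn ℝ ∞ Y U ∧ ∀ p ∈ U,
      fderiv ℝ Y p (1, 0) = rowOp (a p) (Y p) ∧ fderiv ℝ Y p (0, 1) = rowOp (b p) (Y p) := by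
  have hα := contDiffOn_planeForm ha hb
  have flat' : ∀ p ∈ U, ∀ v w, fderiv ℝ (planeForm a b) p v w
      + (planeForm a b p w).comp (planeForm a b p v)
      = fderiv ℝ (planeForm a b) p w v + (planeForm a b p v).comp (planeForm a b p w) := by
    intro p hp v w
    have da : DifferentiableAt ℝ a p :=
      (ha.differentiableOn (by simp)).differentiableAt (hU.mem_nhds hp)
    have db : DifferentiableAt ℝ b p :=
      (hb.differentiableOn (by simp)).differentiableAt (hU.mem_nhds hp)
    have key : rowOp (fderiv ℝ a p (0, 1)) + (rowOp (a p)).comp (rowOp (b p))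
        = rowOp (fderiv ℝ b p (1, 0)) + (rowOp (b p)).comp (rowOp (a p)) := by
      rw [rowOp_comp, rowOp_comp, ← map_add, ← map_add]
      congr 1
      ext i j
      simp only [Pi.add_apply, fderiv_matrix_apply da, fderiv_matrix_apply db]
      exact flat p hp i j
    have hv : ∀ v : ℝ × ℝ, v = v.1 • ((1 : ℝ), (0 : ℝ)) + v.2 • ((0 : ℝ), (1 : ℝ)) := fun v => by
      ext <;> simp
    have da' : ∀ v : ℝ × ℝ, fderiv ℝ a p v
        = v.1 • fderiv ℝ a p (1, 0) + v.2 • fderiv ℝ a p (0, 1) := fun v => by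
      conv_lhs => rw [hv v, map_add, map_smul, map_smul]
    have db' : ∀ v : ℝ × ℝ, fderiv ℝ b p v
        = v.1 • fderiv ℝ b p (1, 0) + v.2 • fderiv ℝ b p (0, 1) := fun v => by
      conv_lhs => rw [hv v, map_add, map_smul, map_smul]
    rw [fderiv_planeForm da db, fderiv_planeForm da db, da' v, da' w, db' v, db' w,
      planeForm_apply, planeForm_apply]
    simp only [map_add, map_smul, ContinuousLinearMap.add_comp, ContinuousLinearMap.comp_add,
      ContinuousLinearMap.smul_comp, ContinuousLinearMap.comp_smul]
    -- the curvature is alternating, hence a multiple of its value on the coordinate vectors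
    rw [← sub_eq_zero] at key ⊢
    have e : ∀ X : Frame →L[ℝ] Frame, X = 0 → (w.1 * v.2 - v.1 * w.2) • X = 0 := by
      rintro _ rfl; simp
    rw [← e _ key]
    module
  obtain ⟨Y, hY0, hY⟩ := exists_parallel hU hUc (hα.of_le (by exact_mod_cast le_top)) flat' hp₀ Y₀
  refine ⟨Y, hY0, contDiffOn_of_parallel hU hα hY, fun p hp => ?_⟩
  rw [(hY p hp).fderiv]
  simp [planeForm_apply]

theorem frame_unique {U : Set (ℝ × ℝ)} (hU : IsOpen U) (hUc : Convex ℝ U)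
    {a b : ℝ × ℝ → Fin 3 → Fin 3 → ℝ} (ha : ContDiffOn ℝ ∞ a U) (hb : ContDiffOn ℝ ∞ b U)
    {p₀ : ℝ × ℝ} (hp₀ : p₀ ∈ U) {Y Y' : ℝ × ℝ → Frame}
    (hY : DifferentiableOn ℝ Y U) (hY' : DifferentiableOn ℝ Y' U)
    (hYs : ∀ p ∈ U, fderiv ℝ Y p (1, 0) = rowOp (a p) (Y p))
    (hYt : ∀ p ∈ U, fderiv ℝ Y p (0, 1) = rowOp (b p) (Y p))
    (hYs' : ∀ p ∈ U, fderiv ℝ Y' p (1, 0) = rowOp (a p) (Y' p))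
    (hYt' : ∀ p ∈ U, fderiv ℝ Y' p (0, 1) = rowOp (b p) (Y' p)) (h0 : Y p₀ = Y' p₀) :
    ∀ p ∈ U, Y p = Y' p := by
  have key : ∀ Z : ℝ × ℝ → Frame, DifferentiableOn ℝ Z U →
      (∀ p ∈ U, fderiv ℝ Z p (1, 0) = rowOp (a p) (Z p)) →
      (∀ p ∈ U, fderiv ℝ Z p (0, 1) = rowOp (b p) (Z p)) →
      ∀ p ∈ U, HasFDerivAt Z ((planeForm a b p).flip (Z p)) p := by
    intro Z hZ hZs hZt p hp
    have h := (hZ.differentiableAt (hU.mem_nhds hp)).hasFDerivAt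
    refine h.congr_fderiv ?_
    refine ContinuousLinearMap.ext fun v => ?_
    have hv : v = v.1 • ((1 : ℝ), (0 : ℝ)) + v.2 • ((0 : ℝ), (1 : ℝ)) := by ext <;> simp
    rw [ContinuousLinearMap.flip_apply, planeForm_apply]
    conv_lhs => rw [hv, map_add, map_smul, map_smul, hZs p hp, hZt p hp]
    rfl
  exact parallel_unique hUc (contDiffOn_planeForm ha hb).continuousOn hp₀ (key Y hY hYs hYt)
    (key Y' hY' hYs' hYt') h0

/-- Uniqueness of frames along a line. -/
theorem frame_unique_line {a : ℝ → Fin 3 → Fin 3 → ℝ} (ha : Continuous a) {Y Y' : ℝ → Frame}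
    (hY : ∀ s, HasDerivAt Y (rowOp (a s) (Y s)) s) (hY' : ∀ s, HasDerivAt Y' (rowOp (a s) (Y' s)) s)
    (h0 : Y 0 = Y' 0) (s : ℝ) : Y s = Y' s := by
  refine parallel_unique (U := Set.univ) convex_univ
    (α := fun s => ContinuousLinearMap.smulRightL ℝ ℝ (Frame →L[ℝ] Frame)
      (ContinuousLinearMap.id ℝ ℝ) (rowOp (a s)))
    (Continuous.continuousOn (by fun_prop)) (Set.mem_univ 0) (fun s _ => ?_) (fun s _ => ?_) h0 s
    (Set.mem_univ s)
  · refine (hY s).hasFDerivAt.congr_fderiv ?_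
    ext1
    simp
  · refine (hY' s).hasFDerivAt.congr_fderiv ?_
    ext1
    simp

/-! ### Jets of functions on a strip -/

theorem hasDerivAt_onJet {f : ℝ → ℝ} (hf : ContDiff ℝ ∞ f) (P : DiffPoly) (s : ℝ) :
    HasDerivAt (onJet P f) (onJet (D P) f s) s := by
  induction P using MvPolynomial.induction_on with
  | C r =>
    have h1 : onJet (MvPolynomial.C r) f = fun _ => r := by ext; simp [onJet]
    have h2 : onJet (D (MvPolynomial.C r)) f s = 0 := by
      rw [show D (MvPolynomial.C r) = 0 from D_c r]; simp [onJet]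
    rw [h1, h2]
    exact hasDerivAt_const s r
  | add P Q hP hQ =>
    have h1 : onJet (P + Q) f = onJet P f + onJet Q f := by ext; simp [onJet]
    rw [h1]
    refine (hP.add hQ).congr_deriv ?_
    simp [onJet]
  | mul_X P i hP =>
    have hi : HasDerivAt (iteratedDeriv i f) (iteratedDeriv (i + 1) f s) s := by
      rw [iteratedDeriv_succ]
      exact ((hf.differentiable_iteratedDeriv i (by exact_mod_cast ENat.natCast_lt_top i))
        s).hasDerivAt
    have h1 : onJet (P * MvPolynomial.X i) f = onJet P f * iteratedDeriv i f := by
      ext; simp [onJet]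
    rw [h1]
    refine (hP.mul hi).congr_deriv ?_
    rw [D_mul, D_u]
    simp only [onJet, map_add, map_mul, MvPolynomial.eval_X]
    ring

section Strip

variable {G : Type*} [NormedAddCommGroup G] [NormedSpace ℝ G] {I : Set ℝ}

theorem isOpen_strip (hI : IsOpen I) : IsOpen ((Set.univ : Set ℝ) ×ˢ I) := isOpen_univ.prod hI

theorem hasDerivAt_left {g : ℝ × ℝ → G} {s t : ℝ} (hg : DifferentiableAt ℝ g (s, t)) :
    HasDerivAt (fun σ => g (σ, t)) (fderiv ℝ g (s, t) (1, 0)) s :=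
  hg.hasFDerivAt.comp_hasDerivAt s ((hasDerivAt_id s).prodMk (hasDerivAt_const s t))

theorem hasDerivAt_right {g : ℝ × ℝ → G} {s t : ℝ} (hg : DifferentiableAt ℝ g (s, t)) :
    HasDerivAt (fun τ => g (s, τ)) (fderiv ℝ g (s, t) (0, 1)) t :=
  hg.hasFDerivAt.comp_hasDerivAt t ((hasDerivAt_const t s).prodMk (hasDerivAt_id t))

theorem differentiableAt_of_strip (hI : IsOpen I) {g : ℝ × ℝ → G}
    (hg : ContDiffOn ℝ ∞ g (Set.univ ×ˢ I)) {x : ℝ × ℝ} (hx : x ∈ (Set.univ : Set ℝ) ×ˢ I) :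
    DifferentiableAt ℝ g x :=
  (hg.differentiableOn (by simp)).differentiableAt ((isOpen_strip hI).mem_nhds hx)

theorem contDiffOn_fderiv_apply (hI : IsOpen I) {g : ℝ × ℝ → G}
    (hg : ContDiffOn ℝ ∞ g (Set.univ ×ˢ I)) (v : ℝ × ℝ) :
    ContDiffOn ℝ ∞ (fun x => fderiv ℝ g x v) (Set.univ ×ˢ I) :=
  (hg.fderiv_of_isOpen (isOpen_strip hI) (by simp)).clm_apply contDiffOn_const

theorem fderiv_fderiv_comm (hI : IsOpen I) {g : ℝ × ℝ → G}
    (hg : ContDiffOn ℝ ∞ g (Set.univ ×ˢ I)) {x : ℝ × ℝ} (hx : x ∈ (Set.univ : Set ℝ) ×ˢ I)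
    (v w : ℝ × ℝ) :
    fderiv ℝ (fun x => fderiv ℝ g x v) x w = fderiv ℝ (fun x => fderiv ℝ g x w) x v := by
  have hx' := (isOpen_strip hI).mem_nhds hx
  have h1 : DifferentiableAt ℝ (fderiv ℝ g) x :=
    ((hg.fderiv_of_isOpen (m := ∞) (isOpen_strip hI) (by simp)).differentiableOn
      (by simp)).differentiableAt hx'
  have h2 : IsSymmSndFDerivAt ℝ g x :=
    (hg.contDiffAt hx').isSymmSndFDerivAt (by
      rw [minSmoothness_of_isRCLikeNormedField]; exact ENat.LEInfty.out)
  have h3 : ∀ v w : ℝ × ℝ, fderiv ℝ (fun x => fderiv ℝ g x v) x w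
      = fderiv ℝ (fderiv ℝ g) x w v := fun v w => by
    rw [fderiv_clm_apply h1 (differentiableAt_const v)]
    simp
  rw [h3, h3, h2.eq]

theorem contDiff_slice {g : ℝ × ℝ → G} (hg : ContDiffOn ℝ ∞ g (Set.univ ×ˢ I)) {t : ℝ}
    (ht : t ∈ I) : ContDiff ℝ ∞ fun σ => g (σ, t) := by
  rw [← contDiffOn_univ]
  exact hg.comp (by fun_prop) fun s _ => ⟨Set.mem_univ _, ht⟩

theorem contDiffOn_iteratedDeriv_slice (hI : IsOpen I) {g : ℝ × ℝ → G}
    (hg : ContDiffOn ℝ ∞ g (Set.univ ×ˢ I)) (n : ℕ) :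
    ContDiffOn ℝ ∞ (fun x : ℝ × ℝ => iteratedDeriv n (fun σ => g (σ, x.2)) x.1)
      (Set.univ ×ˢ I) := by
  induction n with
  | zero => simpa using hg
  | succ n ih =>
    refine (contDiffOn_fderiv_apply hI ih (1, 0)).congr fun x hx => ?_
    rw [iteratedDeriv_succ]
    exact (hasDerivAt_left (differentiableAt_of_strip hI ih hx)).deriv

end Strip

/-- The function `(s, t) ↦ 𝔭|_{j_s(κ)}` obtained by substituting the `s`-derivatives of `κ`. -/
def ev (κ : ℝ → ℝ → ℝ) (P : DiffPoly) (x : ℝ × ℝ) : ℝ := onJet P (fun σ => κ σ x.2) x.1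

section Ev

variable {κ : ℝ → ℝ → ℝ} {I : Set ℝ}

@[simp] theorem ev_add (P Q : DiffPoly) (x : ℝ × ℝ) : ev κ (P + Q) x = ev κ P x + ev κ Q x := by
  simp [ev, onJet]

@[simp] theorem ev_sub (P Q : DiffPoly) (x : ℝ × ℝ) : ev κ (P - Q) x = ev κ P x - ev κ Q x := by
  simp [ev, onJet]

@[simp] theorem ev_neg (P : DiffPoly) (x : ℝ × ℝ) : ev κ (-P) x = -ev κ P x := by
  simp [ev, onJet]

@[simp] theorem ev_mul (P Q : DiffPoly) (x : ℝ × ℝ) : ev κ (P * Q) x = ev κ P x * ev κ Q x := by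
  simp [ev, onJet]

@[simp] theorem ev_zero (x : ℝ × ℝ) : ev κ 0 x = 0 := by simp [ev, onJet]

@[simp] theorem ev_one (x : ℝ × ℝ) : ev κ 1 x = 1 := by simp [ev, onJet]

@[simp] theorem ev_c (r : ℝ) (x : ℝ × ℝ) : ev κ (c r) x = r := by simp [ev, onJet]

@[simp] theorem ev_ofNat (n : ℕ) [n.AtLeastTwo] (x : ℝ × ℝ) :
    ev κ (ofNat(n) : DiffPoly) x = (ofNat(n) : ℝ) := by
  rw [← c_ofNat, ev_c]

theorem ev_u_zero (x : ℝ × ℝ) : ev κ (u 0) x = κ x.1 x.2 := by simp [ev, onJet]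

theorem contDiffOn_ev (hI : IsOpen I)
    (hκ : ContDiffOn ℝ ∞ (fun x : ℝ × ℝ => κ x.1 x.2) (Set.univ ×ˢ I)) (P : DiffPoly) :
    ContDiffOn ℝ ∞ (ev κ P) (Set.univ ×ˢ I) := by
  induction P using MvPolynomial.induction_on with
  | C r => exact contDiffOn_const.congr fun x _ => ev_c r x
  | add P Q hP hQ => exact (hP.add hQ).congr fun x _ => ev_add P Q x
  | mul_X P i hP =>
    refine (hP.mul (contDiffOn_iteratedDeriv_slice hI hκ i)).congr fun x _ => ?_
    simp [ev, onJet]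

theorem fderiv_ev_left (hI : IsOpen I)
    (hκ : ContDiffOn ℝ ∞ (fun x : ℝ × ℝ => κ x.1 x.2) (Set.univ ×ˢ I)) (P : DiffPoly)
    {x : ℝ × ℝ} (hx : x ∈ (Set.univ : Set ℝ) ×ˢ I) :
    fderiv ℝ (ev κ P) x (1, 0) = ev κ (D P) x := by
  have h1 := hasDerivAt_left (differentiableAt_of_strip hI (contDiffOn_ev hI hκ P) hx)
  have h2 := hasDerivAt_onJet (contDiff_slice hκ hx.2) P x.1
  exact h1.unique h2

theorem fderiv_ev_right_u_zero {x : ℝ × ℝ} : fderiv ℝ (ev κ (u 0)) x (0, 1)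
    = fderiv ℝ (fun x : ℝ × ℝ => κ x.1 x.2) x (0, 1) := by
  have : ev κ (u 0) = fun x : ℝ × ℝ => κ x.1 x.2 := funext ev_u_zero
  rw [this]

/-- If `κ_t = -E|_{j_s(κ)}` then `κ_{st} = -(D E)|_{j_s(κ)}`. -/
theorem fderiv_ev_right_u_one (hI : IsOpen I)
    (hκ : ContDiffOn ℝ ∞ (fun x : ℝ × ℝ => κ x.1 x.2) (Set.univ ×ˢ I)) {E : DiffPoly}
    (hE : ∀ x ∈ (Set.univ : Set ℝ) ×ˢ I, fderiv ℝ (ev κ (u 0)) x (0, 1) = -ev κ E x)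
    {x : ℝ × ℝ} (hx : x ∈ (Set.univ : Set ℝ) ×ˢ I) :
    fderiv ℝ (ev κ (u 1)) x (0, 1) = -ev κ (D E) x := by
  have hnhds := (isOpen_strip hI).mem_nhds hx
  have e1 : ev κ (u 1) =ᶠ[nhds x] fun x => fderiv ℝ (ev κ (u 0)) x (1, 0) := by
    filter_upwards [hnhds] with y hy
    rw [fderiv_ev_left hI hκ _ hy, D_u]
  have e2 : (fun x => fderiv ℝ (ev κ (u 0)) x (0, 1)) =ᶠ[nhds x] fun x => -ev κ E x := by
    filter_upwards [hnhds] with y hy using hE y hy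
  rw [e1.fderiv_eq, fderiv_fderiv_comm hI (contDiffOn_ev hI hκ _) hx, e2.fderiv_eq, fderiv_fun_neg,
    neg_apply, fderiv_ev_left hI hκ _ hx]

end Ev

/-! ### The coefficient matrices of the frame equations -/

/-- The matrix of the structure equation `Γ''' = (1 - u') Γ - 2 u Γ'`. -/
def structureMatrix : Fin 3 → Fin 3 → DiffPoly :=
  ![![0, 1, 0], ![0, 0, 1], ![1 - u 1, -2 * u 0, 0]]

/-- The matrix of the time evolution of `(Γ, Γ', Γ'')`: the successive prolongations of the
velocity of `Γ`. -/
def evolutionMatrix (p : DiffPoly) (l : ℝ) (i : Fin 3) : Fin 3 → DiffPoly :=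
  prolong^[i] (velocity p l)

theorem prolong_eq (r : Fin 3 → DiffPoly) (j : Fin 3) :
    prolong r j = D (r j) + ∑ k, r k * structureMatrix k j := by
  fin_cases j <;> simp [prolong, structureMatrix, Fin.sum_univ_three] <;> ring

/-- If `κ_t = -(𝒮(𝔭) + λ u')|_{j_s(κ)}`, the structure equation and the time evolution of the frame
are compatible. Only the last row of the condition has content. -/
theorem isFlat_of_solution {κ : ℝ → ℝ → ℝ} {I : Set ℝ} (hI : IsOpen I)
    (hκ : ContDiffOn ℝ ∞ (fun x : ℝ × ℝ => κ x.1 x.2) (Set.univ ×ˢ I)) {p : DiffPoly} {l : ℝ}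
    (hp : HasPrimitive p)
    (hE : ∀ x ∈ (Set.univ : Set ℝ) ×ˢ I,
      fderiv ℝ (ev κ (u 0)) x (0, 1) = -ev κ (opS p + c l * u 1) x)
    {x : ℝ × ℝ} (hx : x ∈ (Set.univ : Set ℝ) ×ˢ I) :
    IsFlat (fun x i j => ev κ (structureMatrix i j) x)
      (fun x i j => ev κ (evolutionMatrix p l i j) x) x := by
  intro i j
  have hR : fderiv ℝ (ev κ (evolutionMatrix p l i j)) x (1, 0)
      + ∑ k, ev κ (evolutionMatrix p l i k) x * ev κ (structureMatrix k j) x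
      = ev κ (prolong (evolutionMatrix p l i) j) x := by
    rw [fderiv_ev_left hI hκ _ hx, prolong_eq]
    simp [Fin.sum_univ_three]
  have hd : ∀ P, DifferentiableAt ℝ (ev κ P) x := fun P =>
    differentiableAt_of_strip hI (contDiffOn_ev hI hκ P) hx
  have h0 : fderiv ℝ (ev κ 0) x = 0 := by
    rw [show ev κ 0 = fun _ => 0 from funext ev_zero]; simp
  have h1 : fderiv ℝ (ev κ 1) x = 0 := by
    rw [show ev κ 1 = fun _ => 1 from funext ev_one]; simp
  have hg : fderiv ℝ (ev κ (1 - u 1)) x (0, 1) = ev κ (D (opS p + c l * u 1)) x := by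
    rw [show ev κ (1 - u 1) = fun x => 1 - ev κ (u 1) x from funext fun x => by simp,
      fderiv_const_sub, neg_apply, fderiv_ev_right_u_one hI hκ hE hx, neg_neg]
  have hk : fderiv ℝ (ev κ (-2 * u 0)) x (0, 1) = 2 * ev κ (opS p + c l * u 1) x := by
    rw [show ev κ (-2 * u 0) = fun x => -2 * ev κ (u 0) x from funext fun x => by simp,
      fderiv_const_mul (hd _), smul_apply, hE x hx, smul_eq_mul]
    ring
  refine Eq.trans ?_ hR.symm
  change fderiv ℝ (ev κ (structureMatrix i j)) x (0, 1)
    + ∑ k, ev κ (structureMatrix i k) x * ev κ (evolutionMatrix p l k j) x = _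
  have ht0 : ∀ i j, i ≠ 2 → fderiv ℝ (ev κ (structureMatrix i j)) x = 0 := by
    intro i j hi
    fin_cases i <;> fin_cases j <;> first | exact h0 | exact h1 | exact absurd rfl hi
  have hsum : ∀ i : Fin 3, i ≠ 2 → ∑ k, ev κ (structureMatrix i k) x
      * ev κ (evolutionMatrix p l k j) x = ev κ (evolutionMatrix p l (i + 1) j) x := by
    intro i hi
    fin_cases i <;> simp [structureMatrix, Fin.sum_univ_three] at hi ⊢
  by_cases hi : i = 2
  · subst hi
    have e : prolong (evolutionMatrix p l 2) j = prolong^[3] (velocity p l) j := rfl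
    have h3 := congrArg (fun P => ev κ P x) (congrFun (prolong_velocity hp l) j)
    simp only [ev_add, ev_sub, ev_mul] at h3
    have e0 : evolutionMatrix p l 0 = velocity p l := rfl
    have e1 : evolutionMatrix p l 1 = prolong (velocity p l) := rfl
    have s0 : structureMatrix 2 0 = 1 - u 1 := rfl
    have s1 : structureMatrix 2 1 = -2 * u 0 := rfl
    have s2 : structureMatrix 2 2 = 0 := rfl
    rw [e, h3, Fin.sum_univ_three, e0, e1, s0, s1, s2]
    simp only [ev_sub, ev_mul, ev_zero, ev_neg]
    fin_cases j
    · simp only [Fin.zero_eta, s0, hg, Matrix.cons_val]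
      ring
    · simp only [Fin.mk_one, s1, hk, Matrix.cons_val, ev_mul, ev_ofNat]
      ring
    · simp only [Fin.reduceFinMk, s2, h0, Matrix.cons_val, ev_zero, zero_apply]
      ring
  · rw [ht0 i j hi, hsum i hi]
    fin_cases i
    · simp [evolutionMatrix]
    · simp [evolutionMatrix]
    · exact absurd rfl hi

/-! ### Canonical lifts -/

theorem det3_eq (x y z : V3) : det3 x y z = x 0 * y 1 * z 2 - x 0 * y 2 * z 1 - x 1 * y 0 * z 2
    + x 1 * y 2 * z 0 + x 2 * y 0 * z 1 - x 2 * y 1 * z 0 := by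
  simp [det3, Matrix.det_fin_three]

theorem ContDiffOn.det3 {E : Type*} [NormedAddCommGroup E] [NormedSpace ℝ E] {S : Set E}
    {n : WithTop ℕ∞} {x y z : E → V3} (hx : ContDiffOn ℝ n x S) (hy : ContDiffOn ℝ n y S)
    (hz : ContDiffOn ℝ n z S) : ContDiffOn ℝ n (fun p => det3 (x p) (y p) (z p)) S := by
  have hx' := contDiffOn_pi.mp hx
  have hy' := contDiffOn_pi.mp hy
  have hz' := contDiffOn_pi.mp hz
  simp only [det3_eq]
  exact (((((((hx' 0).mul (hy' 1)).mul (hz' 2)).sub (((hx' 0).mul (hy' 2)).mul (hz' 1))).sub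
    (((hx' 1).mul (hy' 0)).mul (hz' 2))).add (((hx' 1).mul (hy' 2)).mul (hz' 0))).add
    (((hx' 2).mul (hy' 0)).mul (hz' 1))).sub (((hx' 2).mul (hy' 1)).mul (hz' 0))

theorem HasDerivAt.det3 {x y z : ℝ → V3} {x' y' z' : V3} {s : ℝ} (hx : HasDerivAt x x' s)
    (hy : HasDerivAt y y' s) (hz : HasDerivAt z z' s) :
    HasDerivAt (fun s => det3 (x s) (y s) (z s))
      (det3 x' (y s) (z s) + det3 (x s) y' (z s) + det3 (x s) (y s) z') s := by
  have hx' := hasDerivAt_pi.mp hx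
  have hy' := hasDerivAt_pi.mp hy
  have hz' := hasDerivAt_pi.mp hz
  simp only [det3_eq]
  refine ((((((((hx' 0).mul (hy' 1)).mul (hz' 2)).sub (((hx' 0).mul (hy' 2)).mul (hz' 1))).sub
    (((hx' 1).mul (hy' 0)).mul (hz' 2))).add (((hx' 1).mul (hy' 2)).mul (hz' 0))).add
    (((hx' 2).mul (hy' 0)).mul (hz' 1))).sub (((hx' 2).mul (hy' 1)).mul (hz' 0))).congr_deriv ?_
  simp only [Pi.mul_apply]
  ring

/-- Cramer's rule in a unimodular basis. -/
theorem eq_det3_smul {x y z : V3} (h : det3 x y z = 1) (v : V3) :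
    v = det3 v y z • x + det3 x v z • y + det3 x y v • z := by
  rw [det3_eq] at h
  ext i
  simp only [det3_eq, Pi.add_apply, Pi.smul_apply, smul_eq_mul]
  fin_cases i <;> simp only [Fin.zero_eta, Fin.mk_one, Fin.reduceFinMk]
  · linear_combination (-v 0) * h
  · linear_combination (-v 1) * h
  · linear_combination (-v 2) * h

theorem det3_combination (x y z : V3) (r₀ r₁ r₂ : ℝ) :
    det3 (r₀ • x + r₁ • y + r₂ • z) y z = r₀ * det3 x y z ∧
    det3 x (r₀ • x + r₁ • y + r₂ • z) z = r₁ * det3 x y z ∧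
    det3 x y (r₀ • x + r₁ • y + r₂ • z) = r₂ * det3 x y z := by
  simp only [det3_eq, Pi.add_apply, Pi.smul_apply, smul_eq_mul]
  refine ⟨by ring, by ring, by ring⟩

theorem coeff_eq_of_combination_eq {x y z : V3} (h : det3 x y z = 1) {r₀ r₁ r₂ t₀ t₁ t₂ : ℝ}
    (he : r₀ • x + r₁ • y + r₂ • z = t₀ • x + t₁ • y + t₂ • z) :
    r₀ = t₀ ∧ r₁ = t₁ ∧ r₂ = t₂ := by
  have a := det3_combination x y z r₀ r₁ r₂
  have b := det3_combination x y z t₀ t₁ t₂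
  rw [he, h] at a
  rw [h] at b
  simp only [mul_one] at a b
  exact ⟨a.1.symm.trans b.1, a.2.1.symm.trans b.2.1, a.2.2.symm.trans b.2.2⟩

/-- A rescaling multiplies the determinant of a lift by its cube. Smoothness of `ρ` is automatic, as
`ρ = ⟨Γ, g⟩ / ⟨g, g⟩`. -/
theorem det3_of_smul {g Γ : ℝ → V3} (hg : ContDiff ℝ ∞ g) (hΓ : ContDiff ℝ ∞ Γ)
    (h0 : ∀ s, g s ≠ 0) {ρ : ℝ → ℝ} (hρ : ∀ s, Γ s = ρ s • g s) (s : ℝ) :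
    det3 (Γ s) (deriv Γ s) (iteratedDeriv 2 Γ s)
      = ρ s ^ 3 * det3 (g s) (deriv g s) (iteratedDeriv 2 g s) := by
  have hn : ∀ s, ∑ i, g s i * g s i ≠ 0 := fun s h => by
    refine h0 s (funext fun i => ?_)
    have := (Finset.sum_eq_zero_iff_of_nonneg (fun i _ => mul_self_nonneg (g s i))).mp h i
      (Finset.mem_univ i)
    simpa using this
  have hρ' : ρ = fun s => (∑ i, Γ s i * g s i) / ∑ i, g s i * g s i := by
    ext s
    rw [eq_div_iff (hn s), hρ s, Finset.mul_sum]
    exact Finset.sum_congr rfl fun i _ => by simp [mul_assoc]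
  have hρc : ContDiff ℝ ∞ ρ := by
    rw [hρ']
    have hg' := contDiff_pi.mp hg
    have hΓ' := contDiff_pi.mp hΓ
    exact (ContDiff.sum fun i _ => (hΓ' i).mul (hg' i)).div
      (ContDiff.sum fun i _ => (hg' i).mul (hg' i)) hn
  have d : ∀ {G : Type} [NormedAddCommGroup G] [NormedSpace ℝ G] {f : ℝ → G},
      ContDiff ℝ ∞ f → ContDiff ℝ ∞ (deriv f) ∧ ∀ s, HasDerivAt f (deriv f s) s :=
    fun hf => ⟨(contDiff_infty_iff_deriv.mp hf).2,
      fun s => ((contDiff_infty_iff_deriv.mp hf).1 s).hasDerivAt⟩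
  obtain ⟨hg1, dg⟩ := d hg
  obtain ⟨-, dg1⟩ := d hg1
  obtain ⟨hρ1, dρ⟩ := d hρc
  obtain ⟨-, dρ1⟩ := d hρ1
  have e1 : deriv Γ = fun s => ρ s • deriv g s + deriv ρ s • g s := by
    ext1 s
    rw [show Γ = fun s => ρ s • g s from funext hρ]
    exact ((dρ s).smul (dg s)).deriv
  have e2 : iteratedDeriv 2 Γ s = (ρ s • deriv (deriv g) s + deriv ρ s • deriv g s)
      + (deriv ρ s • deriv g s + deriv (deriv ρ) s • g s) := by
    rw [iteratedDeriv_succ, iteratedDeriv_one, e1]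
    exact (((dρ s).smul (dg1 s)).add ((dρ1 s).smul (dg s))).deriv
  have e3 : iteratedDeriv 2 g s = deriv (deriv g) s := by
    rw [iteratedDeriv_succ, iteratedDeriv_one]
  rw [e2, e1, e3, hρ s]
  simp only [det3_eq, Pi.add_apply, Pi.smul_apply, smul_eq_mul]
  ring

theorem IsCanonicalLift.exists_smul {γ : ℝ → RP2} {g Γ : ℝ → V3} (h : IsCanonicalLift γ Γ)
    (hg : ∀ s, ∃ hs : g s ≠ 0, γ s = Projectivization.mk ℝ (g s) hs) :
    ∃ ρ : ℝ → ℝ, ∀ s, Γ s = ρ s • g s := by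
  have : ∀ s, ∃ r : ℝ, Γ s = r • g s := fun s => by
    obtain ⟨h1, e1⟩ := h.lift s
    obtain ⟨h2, e2⟩ := hg s
    obtain ⟨r, hr⟩ := (Projectivization.mk_eq_mk_iff' ℝ _ _ h1 h2).mp (e1.symm.trans e2)
    exact ⟨r, hr.symm⟩
  choose ρ hρ using this
  exact ⟨ρ, hρ⟩

/-- Two canonical lifts differ by a factor `ρ` with `ρ³ = 1`. -/
theorem IsCanonicalLift.unique {γ : ℝ → RP2} {Γ Γ' : ℝ → V3} (h : IsCanonicalLift γ Γ)
    (h' : IsCanonicalLift γ Γ') : Γ = Γ' := by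
  obtain ⟨ρ, hρ⟩ := h.exists_smul h'.lift
  ext1 s
  have := det3_of_smul h'.smooth h.smooth (fun s => (h'.lift s).1) hρ s
  rw [h.det_eq_one, h'.det_eq_one, mul_one] at this
  have h1 : ρ s = 1 :=
    ((pow_eq_one_iff_of_ne_zero (n := 3) (by norm_num)).mp this.symm).resolve_right
      fun h => absurd h.2 (by decide)
  rw [hρ, h1, one_smul]

theorem IsCanonicalLift.canonicalLift_eq {γ : ℝ → RP2} {Γ : ℝ → V3} (h : IsCanonicalLift γ Γ) :
    canonicalLift γ = Γ := by
  have hex : ∃ Γ, IsCanonicalLift γ Γ := ⟨Γ, h⟩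
  have : canonicalLift γ = hex.choose := by unfold canonicalLift; rw [dif_pos hex]
  rw [this]
  exact hex.choose_spec.unique h

theorem isCanonicalLift_canonicalLift {γ : ℝ → RP2} (h : ∃ Γ, IsCanonicalLift γ Γ) :
    IsCanonicalLift γ (canonicalLift γ) := by
  obtain ⟨Γ, hΓ⟩ := h
  rwa [hΓ.canonicalLift_eq]

theorem IsCanonicalLift.hasDerivAt_iteratedDeriv {γ : ℝ → RP2} {Γ : ℝ → V3}
    (h : IsCanonicalLift γ Γ) (n : ℕ) (s : ℝ) :
    HasDerivAt (iteratedDeriv n Γ) (iteratedDeriv (n + 1) Γ s) s := by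
  rw [iteratedDeriv_succ]
  exact ((h.smooth.differentiable_iteratedDeriv n (by exact_mod_cast ENat.natCast_lt_top n))
    s).hasDerivAt

/-- Derivative of `det(Γ, Γ', Γ'') = 1`. -/
theorem IsCanonicalLift.det3_third {γ : ℝ → RP2} {Γ : ℝ → V3} (h : IsCanonicalLift γ Γ) (s : ℝ) :
    KK.det3 (Γ s) (deriv Γ s) (iteratedDeriv 3 Γ s) = 0 := by
  have h0 := h.hasDerivAt_iteratedDeriv 0 s
  have h1 := h.hasDerivAt_iteratedDeriv 1 s
  have h2 := h.hasDerivAt_iteratedDeriv 2 s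
  simp only [iteratedDeriv_zero, zero_add, iteratedDeriv_one, Nat.reduceAdd] at h0 h1 h2
  have hd := HasDerivAt.det3 h0 h1 h2
  have hc : (fun s => KK.det3 (Γ s) (deriv Γ s) (iteratedDeriv 2 Γ s)) = fun _ => 1 :=
    funext h.det_eq_one
  rw [hc] at hd
  have := hd.unique (hasDerivAt_const s (1 : ℝ))
  simp only [det3_eq] at this ⊢
  linear_combination this

/-- The structure equation of a unit-speed curve. -/
theorem IsUnitSpeedGeneric.third_derivative {γ : ℝ → RP2} (h : IsUnitSpeedGeneric γ) (s : ℝ) :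
    iteratedDeriv 3 (canonicalLift γ) s = (1 - deriv (curvature γ) s) • canonicalLift γ s
      + (-2 * curvature γ s) • deriv (canonicalLift γ) s
      + (0 : ℝ) • iteratedDeriv 2 (canonicalLift γ) s := by
  have hc := isCanonicalLift_canonicalLift h.1
  have h1 := eq_det3_smul (hc.det_eq_one s) (iteratedDeriv 3 (canonicalLift γ) s)
  rw [hc.det3_third] at h1
  have hk : curvature γ = fun s => - (coeffB γ s / 2) := rfl
  have h2 : 1 - deriv (curvature γ) s = coeffA γ s := by
    rw [hk, deriv.fun_neg, deriv_div_const]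
    linear_combination -h.2 s
  have h3 : -2 * curvature γ s = coeffB γ s := by rw [curvature]; ring
  rw [h2, h3]
  exact h1

/-- A unit-speed curve from a solution of the structure equation. -/
theorem unitSpeed_of_structureEquation {γ : ℝ → RP2} {Γ : ℝ → V3} {k : ℝ → ℝ}
    (h : IsCanonicalLift γ Γ)
    (h3 : ∀ s, iteratedDeriv 3 Γ s = (1 - deriv k s) • Γ s + (-2 * k s) • deriv Γ s
      + (0 : ℝ) • iteratedDeriv 2 Γ s) :
    IsUnitSpeedGeneric γ ∧ curvature γ = k := by
  have hB : coeffB γ = fun s => -2 * k s := by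
    ext1 s
    rw [coeffB, h.canonicalLift_eq, h3, (det3_combination _ _ _ _ _ _).2.1, h.det_eq_one, mul_one]
  have hA : ∀ s, coeffA γ s = 1 - deriv k s := fun s => by
    rw [coeffA, h.canonicalLift_eq, h3, (det3_combination _ _ _ _ _ _).1, h.det_eq_one, mul_one]
  refine ⟨⟨⟨Γ, h⟩, fun s => ?_⟩, ?_⟩
  · rw [hA, hB, deriv_const_mul_field]; ring
  · ext1 s; rw [curvature, hB]; ring

/-! ### Joint smoothness of the canonical lift of a motion -/

/-- A real cube root of `1 / f` is smooth. As `Real.rpow` with a fractional exponent is used on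
positive numbers only, the sign of `f` is treated locally. -/
theorem contDiffOn_of_cube_mul_eq_one {E : Type*} [NormedAddCommGroup E] [NormedSpace ℝ E]
    {U : Set E} (hU : IsOpen U) {f ρ : E → ℝ} (hf : ContDiffOn ℝ ∞ f U)
    (h : ∀ x ∈ U, ρ x ^ 3 * f x = 1) : ContDiffOn ℝ ∞ ρ U := by
  have hpos : ∀ {a b : ℝ}, a ^ 3 * b = 1 → 0 < b → a = (b⁻¹) ^ (1 / 3 : ℝ) := by
    intro a b hab hb
    have h3 : a ^ 3 = b⁻¹ := eq_inv_of_mul_eq_one_left hab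
    have ha : 0 < a := by
      have : 0 < a ^ 3 := by rw [h3]; positivity
      exact (Odd.pow_pos_iff (by decide)).mp this
    rw [← h3, ← Real.rpow_natCast, ← Real.rpow_mul ha.le]
    norm_num
  have hne : ∀ x ∈ U, f x ≠ 0 := fun x hx h0 => by
    have := h x hx
    rw [h0, mul_zero] at this
    exact zero_ne_one this
  intro x hx
  have hxU := hU.mem_nhds hx
  have hfx := hf.contDiffAt hxU
  refine ContDiffAt.contDiffWithinAt ?_
  rcases (hne x hx).lt_or_gt with hneg | hp
  · have e : ρ =ᶠ[nhds x] fun y => -(((-f y)⁻¹) ^ (1 / 3 : ℝ)) := by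
      filter_upwards [hxU, hfx.continuousAt.eventually_lt continuousAt_const hneg] with y hy hy0
      rw [← hpos (a := -ρ y) (by linear_combination h y hy) (by simpa using hy0), neg_neg]
    refine ContDiffAt.congr_of_eventuallyEq ?_ e
    exact ((hfx.neg.inv (by simpa using hneg.ne)).rpow_const_of_ne
      (by simpa using hneg.ne)).neg
  · have e : ρ =ᶠ[nhds x] fun y => ((f y)⁻¹) ^ (1 / 3 : ℝ) := by
      filter_upwards [hxU, continuousAt_const.eventually_lt hfx.continuousAt hp] with y hy hy0
      exact hpos (h y hy) hy0
    refine ContDiffAt.congr_of_eventuallyEq ?_ e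
    exact (hfx.inv hp.ne').rpow_const_of_ne (inv_ne_zero hp.ne')

/-- The canonical lifts of a motion depend smoothly on time: they are obtained from a smooth lift
by division by the cube root of its determinant. -/
theorem IsMotion.contDiffOn_canonicalLift {I : Set ℝ} (hI : IsOpen I) {γ : ℝ → ℝ → RP2}
    (h : IsMotion I γ) :
    ContDiffOn ℝ ∞ (fun x : ℝ × ℝ => canonicalLift (atTime γ x.2) x.1) (Set.univ ×ˢ I) := by
  obtain ⟨⟨g, hg, hgl⟩, hu⟩ := h
  have hgi := contDiffOn_iteratedDeriv_slice hI hg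
  have hdet : ContDiffOn ℝ ∞ (fun x : ℝ × ℝ => KK.det3 (g x.1 x.2) (deriv (fun σ => g σ x.2) x.1)
      (iteratedDeriv 2 (fun σ => g σ x.2) x.1)) (Set.univ ×ˢ I) := by
    have h1 := hgi 1
    simp only [iteratedDeriv_one] at h1
    exact ContDiffOn.det3 hg h1 (hgi 2)
  have hex : ∀ t, ∃ ρ : ℝ → ℝ, t ∈ I → ∀ s, canonicalLift (atTime γ t) s = ρ s • g s t := by
    intro t
    by_cases ht : t ∈ I
    · obtain ⟨ρ, hρ⟩ := (isCanonicalLift_canonicalLift (hu t ht).1).exists_smul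
        (g := fun σ => g σ t) fun s => hgl s t ht
      exact ⟨ρ, fun _ => hρ⟩
    · exact ⟨0, fun h => absurd h ht⟩
  choose ρ hρ using hex
  have hρs : ContDiffOn ℝ ∞ (fun x : ℝ × ℝ => ρ x.2 x.1) (Set.univ ×ˢ I) := by
    refine contDiffOn_of_cube_mul_eq_one (isOpen_strip hI) hdet fun x hx => ?_
    have hc := isCanonicalLift_canonicalLift (hu x.2 hx.2).1
    rw [← det3_of_smul (contDiff_slice hg hx.2) hc.smooth (fun s => (hgl s x.2 hx.2).1)
      (hρ x.2 hx.2) x.1, hc.det_eq_one]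
  exact (hρs.smul hg).congr fun x hx => hρ x.2 hx.2 x.1

/-! ### Evolution of unimodular frames -/

/-- A smooth family of unimodular frames `(Γ, Γ', Γ'')` of unit-speed curves, with curvature `κ`. -/
structure IsFrameFamily (I : Set ℝ) (κ : ℝ → ℝ → ℝ) (Y : ℝ × ℝ → Frame) : Prop where
  curvature_smooth : ContDiffOn ℝ ∞ (fun x : ℝ × ℝ => κ x.1 x.2) (Set.univ ×ˢ I)
  smooth : ContDiffOn ℝ ∞ Y (Set.univ ×ˢ I)
  fderiv_left : ∀ x ∈ (Set.univ : Set ℝ) ×ˢ I,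
    fderiv ℝ Y x (1, 0) = rowOp (fun i j => ev κ (structureMatrix i j) x) (Y x)
  unimodular : ∀ x ∈ (Set.univ : Set ℝ) ×ˢ I, det3 (Y x 0) (Y x 1) (Y x 2) = 1

theorem fderiv_frame_apply {Y : ℝ × ℝ → Frame} {x : ℝ × ℝ} (hY : DifferentiableAt ℝ Y x)
    (v : ℝ × ℝ) (i : Fin 3) : fderiv ℝ Y x v i = fderiv ℝ (fun x => Y x i) x v := by
  rw [(hasFDerivAt_pi'.mp hY.hasFDerivAt i).fderiv]
  rfl

namespace IsFrameFamily

variable {I : Set ℝ} {κ : ℝ → ℝ → ℝ} {Y : ℝ × ℝ → Frame}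

theorem smooth_apply (h : IsFrameFamily I κ Y) (i : Fin 3) :
    ContDiffOn ℝ ∞ (fun x => Y x i) (Set.univ ×ˢ I) := contDiffOn_pi.mp h.smooth i

theorem fderiv_left_apply (h : IsFrameFamily I κ Y) (hI : IsOpen I) {x : ℝ × ℝ}
    (hx : x ∈ (Set.univ : Set ℝ) ×ˢ I) (i : Fin 3) :
    fderiv ℝ (fun x => Y x i) x (1, 0) = ∑ j, ev κ (structureMatrix i j) x • Y x j := by
  rw [← fderiv_frame_apply (differentiableAt_of_strip hI h.smooth hx), h.fderiv_left x hx,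
    rowOp_apply]

theorem fderiv_left_combination (h : IsFrameFamily I κ Y) (hI : IsOpen I)
    {r : Fin 3 → ℝ × ℝ → ℝ} (hr : ∀ j, ContDiffOn ℝ ∞ (r j) (Set.univ ×ˢ I)) {V : ℝ × ℝ → V3}
    (hV : ∀ x ∈ (Set.univ : Set ℝ) ×ˢ I, V x = ∑ j, r j x • Y x j) {x : ℝ × ℝ}
    (hx : x ∈ (Set.univ : Set ℝ) ×ˢ I) :
    fderiv ℝ V x (1, 0) = ∑ j, (fderiv ℝ (r j) x (1, 0)
      + ∑ k, r k x * ev κ (structureMatrix k j) x) • Y x j := by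
  have e : V =ᶠ[nhds x] fun x => ∑ j, r j x • Y x j := by
    filter_upwards [(isOpen_strip hI).mem_nhds hx] with y hy using hV y hy
  have hd : ∀ j, HasFDerivAt (fun x => r j x • Y x j) _ x := fun j =>
    (differentiableAt_of_strip hI (hr j) hx).hasFDerivAt.smul
      (differentiableAt_of_strip hI (h.smooth_apply j) hx).hasFDerivAt
  rw [e.fderiv_eq, (HasFDerivAt.fun_sum fun j (_ : j ∈ Finset.univ) => hd j).fderiv]
  simp only [add_apply, smul_apply,
    ContinuousLinearMap.smulRight_apply, h.fderiv_left_apply hI hx, Fin.sum_univ_three, add_smul,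
    smul_add, mul_smul]
  module

theorem fderiv_left_ev (h : IsFrameFamily I κ Y) (hI : IsOpen I) {R : Fin 3 → DiffPoly}
    {V : ℝ × ℝ → V3} (hV : ∀ x ∈ (Set.univ : Set ℝ) ×ˢ I, V x = ∑ j, ev κ (R j) x • Y x j)
    {x : ℝ × ℝ} (hx : x ∈ (Set.univ : Set ℝ) ×ˢ I) :
    fderiv ℝ V x (1, 0) = ∑ j, ev κ (prolong R j) x • Y x j := by
  rw [h.fderiv_left_combination hI (fun j => contDiffOn_ev hI h.curvature_smooth (R j)) hV hx]
  refine Finset.sum_congr rfl fun j _ => ?_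
  rw [fderiv_ev_left hI h.curvature_smooth _ hx, prolong_eq, ev_add]
  simp only [Fin.sum_univ_three, ev_add, ev_mul]

/-- The time derivative of an `s`-derivative. -/
theorem fderiv_right_of_eq_fderiv_left (hI : IsOpen I) {Z W : ℝ × ℝ → V3}
    (hZ : ContDiffOn ℝ ∞ Z (Set.univ ×ˢ I))
    (hW : ∀ x ∈ (Set.univ : Set ℝ) ×ˢ I, fderiv ℝ Z x (1, 0) = W x) {x : ℝ × ℝ}
    (hx : x ∈ (Set.univ : Set ℝ) ×ˢ I) :
    fderiv ℝ W x (0, 1) = fderiv ℝ (fun x => fderiv ℝ Z x (0, 1)) x (1, 0) := by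
  have e : W =ᶠ[nhds x] fun x => fderiv ℝ Z x (1, 0) := by
    filter_upwards [(isOpen_strip hI).mem_nhds hx] with y hy using (hW y hy).symm
  rw [e.fderiv_eq, fderiv_fderiv_comm hI hZ hx]

theorem fderiv_left_zero (h : IsFrameFamily I κ Y) (hI : IsOpen I) {x : ℝ × ℝ}
    (hx : x ∈ (Set.univ : Set ℝ) ×ˢ I) : fderiv ℝ (fun x => Y x 0) x (1, 0) = Y x 1 := by
  rw [h.fderiv_left_apply hI hx]
  simp [structureMatrix, Fin.sum_univ_three]

theorem fderiv_left_one (h : IsFrameFamily I κ Y) (hI : IsOpen I) {x : ℝ × ℝ}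
    (hx : x ∈ (Set.univ : Set ℝ) ×ˢ I) : fderiv ℝ (fun x => Y x 1) x (1, 0) = Y x 2 := by
  rw [h.fderiv_left_apply hI hx]
  simp [structureMatrix, Fin.sum_univ_three]

theorem fderiv_left_two (h : IsFrameFamily I κ Y) (hI : IsOpen I) {x : ℝ × ℝ}
    (hx : x ∈ (Set.univ : Set ℝ) ×ˢ I) : fderiv ℝ (fun x => Y x 2) x (1, 0)
      = ev κ (1 - u 1) x • Y x 0 + ev κ (-2 * u 0) x • Y x 1 := by
  rw [h.fderiv_left_apply hI hx]
  simp [structureMatrix, Fin.sum_univ_three]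

/-- Preservation of `det(Γ, Γ', Γ'') = 1` fixes the component of the velocity along `Γ`. -/
theorem velocity_zero (h : IsFrameFamily I κ Y) (hI : IsOpen I) {p : DiffPoly} {l : ℝ}
    {ξ : ℝ × ℝ → ℝ} (hξ : ContDiffOn ℝ ∞ ξ (Set.univ ×ˢ I))
    (hT : ∀ x ∈ (Set.univ : Set ℝ) ×ˢ I, fderiv ℝ (fun x => Y x 0) x (0, 1)
      = ξ x • Y x 0 + ev κ (opM p - c l) x • Y x 1 + ev κ p x • Y x 2) :
    ∀ x ∈ (Set.univ : Set ℝ) ×ˢ I, ξ x = ev κ (velocity p l 0) x := by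
  have hκ := h.curvature_smooth
  set X := opM p - c l with hX
  set g : ℝ × ℝ → ℝ := fun x => fderiv ℝ ξ x (1, 0) + ev κ ((1 - u 1) * p) x with hg
  have hT1 : ∀ x ∈ (Set.univ : Set ℝ) ×ˢ I, fderiv ℝ (fun x => Y x 1) x (0, 1)
      = ∑ j, (![g, fun x => ξ x + ev κ (D X - 2 * u 0 * p) x, ev κ (X + D p)] j) x • Y x j := by
    intro x hx
    rw [fderiv_right_of_eq_fderiv_left hI (h.smooth_apply 0) (fun x hx => h.fderiv_left_zero hI hx)
      hx, h.fderiv_left_combination hI (r := ![ξ, ev κ X, ev κ p]) (fun j => by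
        fin_cases j
        · exact hξ
        · exact contDiffOn_ev hI hκ X
        · exact contDiffOn_ev hI hκ p) (fun x hx => by
        rw [hT x hx]; simp [Fin.sum_univ_three]) hx]
    simp only [Fin.sum_univ_three, Matrix.cons_val, fderiv_ev_left hI hκ _ hx, structureMatrix,
      ev_zero, ev_one, ev_sub, ev_mul, ev_add, ev_neg, ev_ofNat, hg]
    module
  have hT2 : ∀ x ∈ (Set.univ : Set ℝ) ×ˢ I, ∃ r₀ r₁ : ℝ, fderiv ℝ (fun x => Y x 2) x (0, 1)
      = r₀ • Y x 0 + r₁ • Y x 1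
        + (ev κ (D (X + D p)) x + (ξ x + ev κ (D X - 2 * u 0 * p) x)) • Y x 2 := by
    intro x hx
    rw [fderiv_right_of_eq_fderiv_left hI (h.smooth_apply 1) (fun x hx => h.fderiv_left_one hI hx)
      hx, h.fderiv_left_combination hI (fun j => by
        fin_cases j
        · exact (contDiffOn_fderiv_apply hI hξ (1, 0)).add (contDiffOn_ev hI hκ _)
        · exact hξ.add (contDiffOn_ev hI hκ _)
        · exact contDiffOn_ev hI hκ _) hT1 hx, Fin.sum_univ_three]
    have e : fderiv ℝ (![g, fun x => ξ x + ev κ (D X - 2 * u 0 * p) x, ev κ (X + D p)] 2) x (1, 0)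
        + ∑ k, (![g, fun x => ξ x + ev κ (D X - 2 * u 0 * p) x, ev κ (X + D p)] k) x
          * ev κ (structureMatrix k 2) x
        = ev κ (D (X + D p)) x + (ξ x + ev κ (D X - 2 * u 0 * p) x) := by
      simp only [Fin.sum_univ_three, Matrix.cons_val, fderiv_ev_left hI hκ _ hx, structureMatrix,
        ev_zero, ev_one]
      ring
    rw [e]
    exact ⟨_, _, rfl⟩
  intro x hx
  obtain ⟨r₀, r₁, e2⟩ := hT2 x hx
  have e0 := hT x hx
  have e1 := hT1 x hx
  simp only [Fin.sum_univ_three, Matrix.cons_val] at e1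
  have hd : ∀ i, HasDerivAt (fun τ => Y (x.1, τ) i) (fderiv ℝ (fun x => Y x i) x (0, 1)) x.2 :=
    fun i => hasDerivAt_right (differentiableAt_of_strip hI (h.smooth_apply i) hx)
  have hdet := HasDerivAt.det3 (hd 0) (hd 1) (hd 2)
  have hone : (fun τ => det3 (Y (x.1, τ) 0) (Y (x.1, τ) 1) (Y (x.1, τ) 2)) =ᶠ[nhds x.2]
      fun _ => 1 := by
    filter_upwards [hI.mem_nhds hx.2] with τ hτ using h.unimodular (x.1, τ) ⟨Set.mem_univ _, hτ⟩
  have hsum := (hdet.congr_of_eventuallyEq hone.symm).unique (hasDerivAt_const x.2 (1 : ℝ))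
  rw [e0, e1, e2] at hsum
  have hu : det3 (Y (x.1, x.2) 0) (Y (x.1, x.2) 1) (Y (x.1, x.2) 2) = 1 := h.unimodular x hx
  rw [(det3_combination _ _ _ _ _ _).1, (det3_combination _ _ _ _ _ _).2.1,
    (det3_combination _ _ _ _ _ _).2.2, hu] at hsum
  -- the logarithmic derivative of the determinant is the trace, in which `ξ` has coefficient `3`
  have htr := congrArg (fun P => ev κ P x) (trace_prolong_velocity p l)
  have v1 : velocity p l 1 = X := rfl
  have v2 : velocity p l 2 = p := rfl
  simp only [prolong, v1, v2, Matrix.cons_val, map_add, ev_add, ev_sub, ev_mul, ev_zero,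
    ev_ofNat] at htr
  simp only [ev_add, ev_sub, ev_mul, map_add, ev_ofNat] at hsum
  linear_combination (hsum - htr) / 3

/-- A velocity field of the form `X_{𝔭,λ}` determines the evolution of the whole frame and of the
curvature. -/
theorem evolution (h : IsFrameFamily I κ Y) (hI : IsOpen I) {p : DiffPoly} {l : ℝ}
    (hp : HasPrimitive p)
    (hT : ∀ x ∈ (Set.univ : Set ℝ) ×ˢ I, ∃ m : ℝ, fderiv ℝ (fun x => Y x 0) x (0, 1)
      = m • Y x 0 + (ev κ (opM p - c l) x • Y x 1 + ev κ p x • (Y x 2 + κ x.1 x.2 • Y x 0))) :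
    (∀ x ∈ (Set.univ : Set ℝ) ×ˢ I, fderiv ℝ Y x (0, 1)
      = rowOp (fun i j => ev κ (evolutionMatrix p l i j) x) (Y x)) ∧
    ∀ x ∈ (Set.univ : Set ℝ) ×ˢ I,
      fderiv ℝ (ev κ (u 0)) x (0, 1) = -ev κ (opS p + c l * u 1) x := by
  have hκ := h.curvature_smooth
  set ξ : ℝ × ℝ → ℝ := fun x => det3 (fderiv ℝ (fun x => Y x 0) x (0, 1)) (Y x 1) (Y x 2) with hξ
  have hξs : ContDiffOn ℝ ∞ ξ (Set.univ ×ˢ I) :=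
    ContDiffOn.det3 (contDiffOn_fderiv_apply hI (h.smooth_apply 0) _) (h.smooth_apply 1)
      (h.smooth_apply 2)
  have hT' : ∀ x ∈ (Set.univ : Set ℝ) ×ˢ I, fderiv ℝ (fun x => Y x 0) x (0, 1)
      = ξ x • Y x 0 + ev κ (opM p - c l) x • Y x 1 + ev κ p x • Y x 2 := by
    intro x hx
    obtain ⟨m, hm⟩ := hT x hx
    have e : fderiv ℝ (fun x => Y x 0) x (0, 1) = (m + ev κ p x * κ x.1 x.2) • Y x 0
        + ev κ (opM p - c l) x • Y x 1 + ev κ p x • Y x 2 := by rw [hm]; module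
    have e2 : ξ x = m + ev κ p x * κ x.1 x.2 := by
      rw [hξ]
      simp only
      rw [e, (det3_combination _ _ _ _ _ _).1, h.unimodular x hx, mul_one]
    rw [e2, e]
  have hv := h.velocity_zero hI hξs hT'
  have t0 : ∀ x ∈ (Set.univ : Set ℝ) ×ˢ I, fderiv ℝ (fun x => Y x 0) x (0, 1)
      = ∑ j, ev κ (velocity p l j) x • Y x j := fun x hx => by
    rw [hT' x hx, hv x hx, Fin.sum_univ_three]; rfl
  have t1 : ∀ x ∈ (Set.univ : Set ℝ) ×ˢ I, fderiv ℝ (fun x => Y x 1) x (0, 1)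
      = ∑ j, ev κ (prolong (velocity p l) j) x • Y x j := fun x hx => by
    rw [fderiv_right_of_eq_fderiv_left hI (h.smooth_apply 0)
      (fun x hx => h.fderiv_left_zero hI hx) hx]
    exact h.fderiv_left_ev hI t0 hx
  have t2 : ∀ x ∈ (Set.univ : Set ℝ) ×ˢ I, fderiv ℝ (fun x => Y x 2) x (0, 1)
      = ∑ j, ev κ (prolong (prolong (velocity p l)) j) x • Y x j := fun x hx => by
    rw [fderiv_right_of_eq_fderiv_left hI (h.smooth_apply 1)
      (fun x hx => h.fderiv_left_one hI hx) hx]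
    exact h.fderiv_left_ev hI t1 hx
  refine ⟨fun x hx => ?_, fun x hx => ?_⟩
  · ext1 i
    rw [fderiv_frame_apply (differentiableAt_of_strip hI h.smooth hx), rowOp_apply]
    fin_cases i
    · exact t0 x hx
    · exact t1 x hx
    · exact t2 x hx
  -- compare the components along `Γ'` of `∂ₜ Γ'''`, computed from the structure equation (`e4`)
  -- and from the prolonged velocity (`e1`)
  · have e1 := fderiv_right_of_eq_fderiv_left hI (h.smooth_apply 2)
      (fun x hx => h.fderiv_left_two hI hx) hx
    rw [h.fderiv_left_ev hI t2 hx] at e1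
    have hd : ∀ P, HasFDerivAt (ev κ P) (fderiv ℝ (ev κ P) x) x := fun P =>
      (differentiableAt_of_strip hI (contDiffOn_ev hI hκ P) hx).hasFDerivAt
    have hdY : ∀ i, HasFDerivAt (fun x => Y x i) (fderiv ℝ (fun x => Y x i) x) x := fun i =>
      (differentiableAt_of_strip hI (h.smooth_apply i) hx).hasFDerivAt
    have e2 := (((hd (1 - u 1)).smul (hdY 0)).add ((hd (-2 * u 0)).smul (hdY 1))).fderiv
    have e3 := congrArg (fun L => L ((0 : ℝ), (1 : ℝ))) e2
    simp only [add_apply, smul_apply, ContinuousLinearMap.smulRight_apply] at e3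
    have e4 := e3.symm.trans e1
    rw [t0 x hx, t1 x hx] at e4
    simp only [Fin.sum_univ_three] at e4
    have e5 := (coeff_eq_of_combination_eq (h.unimodular x hx)
      (r₀ := ev κ (1 - u 1) x * ev κ (velocity p l 0) x + fderiv ℝ (ev κ (1 - u 1)) x (0, 1)
        + ev κ (-2 * u 0) x * ev κ (prolong (velocity p l) 0) x)
      (r₁ := ev κ (1 - u 1) x * ev κ (velocity p l 1) x + fderiv ℝ (ev κ (-2 * u 0)) x (0, 1)
        + ev κ (-2 * u 0) x * ev κ (prolong (velocity p l) 1) x)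
      (r₂ := ev κ (1 - u 1) x * ev κ (velocity p l 2) x
        + ev κ (-2 * u 0) x * ev κ (prolong (velocity p l) 2) x)
      (Eq.trans (by module) e4)).2.1
    have e6 := congrArg (fun P => ev κ P x) (congrFun (prolong_velocity hp l) 1)
    have e7 : prolong^[3] (velocity p l) 1 = prolong (prolong (prolong (velocity p l))) 1 := rfl
    have e8 : fderiv ℝ (ev κ (-2 * u 0)) x (0, 1) = -2 * fderiv ℝ (ev κ (u 0)) x (0, 1) := by
      rw [show ev κ (-2 * u 0) = fun x => -2 * ev κ (u 0) x from funext fun x => by simp,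
        fderiv_const_mul (hd _).differentiableAt, smul_apply, smul_eq_mul]
    rw [e7] at e6
    rw [e8] at e5
    simp only [ev_add, ev_sub, ev_mul, ev_ofNat, ev_one, ev_neg, ev_c, Matrix.cons_val] at e5 e6 ⊢
    linear_combination (-1 / 2) * e5 - (1 / 2) * e6

end IsFrameFamily

/-! ### The frame family of a motion -/

/-- The frame `(Γ, Γ', Γ'')` of a curve with canonical lift `Γ`. -/
def curveFrame (γ : ℝ → RP2) (s : ℝ) : Frame := fun i => iteratedDeriv i (canonicalLift γ) s

/-- The frames of the curves of a family, as a function on the strip. -/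
def motionFrame (γ : ℝ → ℝ → RP2) (x : ℝ × ℝ) : Frame := curveFrame (atTime γ x.2) x.1

theorem ev_u_one {κ : ℝ → ℝ → ℝ} (x : ℝ × ℝ) :
    ev κ (u 1) x = deriv (fun σ => κ σ x.2) x.1 := by simp [ev, onJet]

theorem IsUnitSpeedGeneric.hasDerivAt_curveFrame {γ : ℝ → RP2} (h : IsUnitSpeedGeneric γ) (s : ℝ) :
    HasDerivAt (curveFrame γ)
      (rowOp (fun i j => onJet (structureMatrix i j) (curvature γ) s) (curveFrame γ s)) s := by
  have hc := isCanonicalLift_canonicalLift h.1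
  refine hasDerivAt_pi.mpr fun i => ?_
  refine (hc.hasDerivAt_iteratedDeriv i s).congr_deriv ?_
  rw [rowOp_apply, Fin.sum_univ_three]
  fin_cases i
  · simp [structureMatrix, onJet, curveFrame]
  · simp [structureMatrix, onJet, curveFrame]
  · refine (h.third_derivative s).trans ?_
    simp [structureMatrix, onJet, curveFrame]

section Motion

variable {I : Set ℝ} {γ : ℝ → ℝ → RP2} {κ : ℝ → ℝ → ℝ}

theorem IsMotion.isFrameFamily (hI : IsOpen I) (h : IsMotion I γ)
    (hκ : ∀ t ∈ I, curvature (atTime γ t) = fun s => κ s t) :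
    IsFrameFamily I κ (motionFrame γ) := by
  have hi := contDiffOn_iteratedDeriv_slice hI (h.contDiffOn_canonicalLift hI)
  have hY : ContDiffOn ℝ ∞ (motionFrame γ) (Set.univ ×ˢ I) := contDiffOn_pi.mpr fun i => hi i
  refine ⟨?_, hY, fun x hx => ?_, fun x hx => ?_⟩
  · refine ((ContDiffOn.det3 (hi 0) (hi 3) (hi 2)).div_const 2).neg.congr fun x hx => ?_
    rw [← congrFun (hκ x.2 hx.2) x.1]
    simp [curvature, coeffB]
  · have e := (hasDerivAt_left (differentiableAt_of_strip hI hY hx)).unique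
      ((h.2 x.2 hx.2).hasDerivAt_curveFrame x.1)
    rw [hκ x.2 hx.2] at e
    exact e
  · have := (isCanonicalLift_canonicalLift (h.2 x.2 hx.2).1).det_eq_one x.1
    simpa [motionFrame, curveFrame] using this

/-- The equations satisfied by the frames and by the curvature of an integral curve. -/
theorem IsIntegralCurve.evolution {p : DiffPoly} {l : ℝ} (hI : IsOpen I) (hp : HasPrimitive p)
    (h : IsIntegralCurve p l I γ) (hκ : ∀ t ∈ I, curvature (atTime γ t) = fun s => κ s t) :
    (∀ x ∈ (Set.univ : Set ℝ) ×ˢ I, fderiv ℝ (motionFrame γ) x (0, 1)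
      = rowOp (fun i j => ev κ (evolutionMatrix p l i j) x) (motionFrame γ x)) ∧
    ∀ x ∈ (Set.univ : Set ℝ) ×ˢ I,
      fderiv ℝ (ev κ (u 0)) x (0, 1) = -ev κ (opS p + c l * u 1) x := by
  have hF := h.1.isFrameFamily hI hκ
  refine hF.evolution hI hp fun x hx => ?_
  obtain ⟨m, hm⟩ := h.2 x.1 x.2 hx.2
  have hd := hasDerivAt_right (differentiableAt_of_strip hI (hF.smooth_apply 0) hx)
  have e : (fun τ => frame0 (atTime γ τ) x.1) = fun τ => motionFrame γ (x.1, τ) 0 := by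
    ext1 τ; simp [motionFrame, curveFrame, frame0]
  rw [e, hd.deriv] at hm
  refine ⟨m, hm.trans ?_⟩
  have hk := congrFun (hκ x.2 hx.2) x.1
  have hb : coeffB (atTime γ x.2) x.1 / 2 = -κ x.1 x.2 := by rw [← hk, curvature, neg_neg]
  rw [localField, frame1, frame2, frame0, hb, hκ x.2 hx.2, ev_sub, ev_c]
  simp [motionFrame, curveFrame, ev]

end Motion

/-! ### Curves swept out by a frame family -/

/-- A vector of a unimodular basis is nonzero. -/
theorem ne_zero_of_det3_eq_one {x y z : V3} (h : det3 x y z = 1) : x ≠ 0 := by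
  rintro rfl
  simp [det3_eq] at h

theorem fderiv_det3_of_trace_eq_zero {Y : ℝ × ℝ → Frame} {x v : ℝ × ℝ}
    (hY : DifferentiableAt ℝ Y x) (hF : DifferentiableAt ℝ
      (fun x => det3 (Y x 0) (Y x 1) (Y x 2)) x) {M : Fin 3 → Fin 3 → ℝ}
    (h : fderiv ℝ Y x v = rowOp M (Y x)) (htr : M 0 0 + M 1 1 + M 2 2 = 0) :
    fderiv ℝ (fun x => det3 (Y x 0) (Y x 1) (Y x 2)) x v = 0 := by
  have hl := hasDerivAt_pi.mp (hY.hasFDerivAt.hasLineDerivAt v)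
  have hd := HasDerivAt.det3 (hl 0) (hl 1) (hl 2)
  rw [(hF.hasFDerivAt.hasLineDerivAt v).unique hd, h]
  simp only [rowOp_apply, Fin.sum_univ_three, zero_smul, add_zero, det3_combination]
  linear_combination det3 (Y x 0) (Y x 1) (Y x 2) * htr

open Classical in
/-- The curves of `ℝℙ²` with lifts the first vectors of a family of frames; where such a vector
vanishes the value is arbitrary. -/
def sweptCurve (Y : ℝ × ℝ → Frame) (s t : ℝ) : RP2 :=
  if h : Y (s, t) 0 ≠ 0 then Projectivization.mk ℝ (Y (s, t) 0) h
  else Projectivization.mk ℝ 1 one_ne_zero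

namespace IsFrameFamily

variable {I : Set ℝ} {κ : ℝ → ℝ → ℝ} {Y : ℝ × ℝ → Frame}

theorem sweptCurve_eq (h : IsFrameFamily I κ Y) {t : ℝ} (ht : t ∈ I) (s : ℝ) :
    ∃ hs : Y (s, t) 0 ≠ 0, sweptCurve Y s t = Projectivization.mk ℝ (Y (s, t) 0) hs := by
  have hs := ne_zero_of_det3_eq_one (h.unimodular (s, t) ⟨Set.mem_univ _, ht⟩)
  exact ⟨hs, dif_pos hs⟩

theorem iteratedDeriv_slice (h : IsFrameFamily I κ Y) (hI : IsOpen I) {t : ℝ} (ht : t ∈ I) :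
    deriv (fun s => Y (s, t) 0) = (fun s => Y (s, t) 1) ∧
    iteratedDeriv 2 (fun s => Y (s, t) 0) = (fun s => Y (s, t) 2) ∧
    iteratedDeriv 3 (fun s => Y (s, t) 0) = fun s =>
      ev κ (1 - u 1) (s, t) • Y (s, t) 0 + ev κ (-2 * u 0) (s, t) • Y (s, t) 1 := by
  have hx : ∀ s : ℝ, (s, t) ∈ (Set.univ : Set ℝ) ×ˢ I := fun s => ⟨Set.mem_univ _, ht⟩
  have hd : ∀ i, deriv (fun s => Y (s, t) i) = fun s => fderiv ℝ (fun x => Y x i) (s, t) (1, 0) :=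
    fun i => funext fun s =>
      (hasDerivAt_left (differentiableAt_of_strip hI (h.smooth_apply i) (hx s))).deriv
  have h1 : deriv (fun s => Y (s, t) 0) = fun s => Y (s, t) 1 := by
    rw [hd]; exact funext fun s => h.fderiv_left_zero hI (hx s)
  have h2 : iteratedDeriv 2 (fun s => Y (s, t) 0) = fun s => Y (s, t) 2 := by
    rw [iteratedDeriv_succ, iteratedDeriv_one, h1, hd]
    exact funext fun s => h.fderiv_left_one hI (hx s)
  refine ⟨h1, h2, ?_⟩
  rw [iteratedDeriv_succ, h2, hd]
  exact funext fun s => h.fderiv_left_two hI (hx s)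

theorem isCanonicalLift_sweptCurve (h : IsFrameFamily I κ Y) (hI : IsOpen I) {t : ℝ} (ht : t ∈ I) :
    IsCanonicalLift (atTime (sweptCurve Y) t) (fun s => Y (s, t) 0) where
  smooth := contDiff_slice (h.smooth_apply 0) ht
  lift s := h.sweptCurve_eq ht s
  det_eq_one s := by
    rw [(h.iteratedDeriv_slice hI ht).1, (h.iteratedDeriv_slice hI ht).2.1]
    exact h.unimodular (s, t) ⟨Set.mem_univ _, ht⟩

theorem curvature_sweptCurve (h : IsFrameFamily I κ Y) (hI : IsOpen I) {t : ℝ} (ht : t ∈ I) :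
    IsUnitSpeedGeneric (atTime (sweptCurve Y) t) ∧
      curvature (atTime (sweptCurve Y) t) = fun s => κ s t := by
  refine unitSpeed_of_structureEquation (h.isCanonicalLift_sweptCurve hI ht) fun s => ?_
  obtain ⟨h1, h2, h3⟩ := h.iteratedDeriv_slice hI ht
  rw [h1, h2, h3]
  simp [ev_u_zero, ev_u_one]

theorem isMotion_sweptCurve (h : IsFrameFamily I κ Y) (hI : IsOpen I) :
    IsMotion I (sweptCurve Y) :=
  ⟨⟨fun s t => Y (s, t) 0, h.smooth_apply 0, fun s _ ht => h.sweptCurve_eq ht s⟩,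
    fun _ ht => (h.curvature_sweptCurve hI ht).1⟩

/-- The velocity of the swept curves is `X_{𝔭,λ}` modulo `F₀`; passing from `Γ''` to
`F₂ = Γ'' + κ Γ` changes it by a multiple of `F₀`. -/
theorem isIntegralCurve_sweptCurve (h : IsFrameFamily I κ Y) (hI : IsOpen I) {p : DiffPoly} {l : ℝ}
    (hT : ∀ x ∈ (Set.univ : Set ℝ) ×ˢ I, fderiv ℝ Y x (0, 1)
      = rowOp (fun i j => ev κ (evolutionMatrix p l i j) x) (Y x)) :
    IsIntegralCurve p l I (sweptCurve Y) := by
  refine ⟨h.isMotion_sweptCurve hI, fun s t ht => ?_⟩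
  have hx : (s, t) ∈ (Set.univ : Set ℝ) ×ˢ I := ⟨Set.mem_univ _, ht⟩
  obtain ⟨h1, h2, -⟩ := h.iteratedDeriv_slice hI ht
  have hd := hasDerivAt_right (differentiableAt_of_strip hI (h.smooth_apply 0) hx)
  have e : (fun τ => frame0 (atTime (sweptCurve Y) τ) s) =ᶠ[nhds t] fun τ => Y (s, τ) 0 := by
    filter_upwards [hI.mem_nhds ht] with τ hτ
    rw [frame0, (h.isCanonicalLift_sweptCurve hI hτ).canonicalLift_eq]
  have hk := (h.curvature_sweptCurve hI ht).2
  have hb : coeffB (atTime (sweptCurve Y) t) s / 2 = -κ s t := by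
    rw [← congrFun hk s, curvature, neg_neg]
  refine ⟨ev κ (velocity p l 0) (s, t) - ev κ p (s, t) * κ s t, ?_⟩
  rw [e.deriv_eq, hd.deriv, ← fderiv_frame_apply (differentiableAt_of_strip hI h.smooth hx),
    hT _ hx, rowOp_apply, Fin.sum_univ_three, localField, frame0, frame1, frame2, hb, hk,
    (h.isCanonicalLift_sweptCurve hI ht).canonicalLift_eq, h1, h2]
  have v1 : evolutionMatrix p l 0 1 = opM p - c l := rfl
  have v2 : evolutionMatrix p l 0 2 = p := rfl
  have v0 : evolutionMatrix p l 0 0 = velocity p l 0 := rfl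
  have e1 : onJet (opM p) (fun σ => κ σ t) s = ev κ (opM p) (s, t) := rfl
  have e2 : onJet p (fun σ => κ σ t) s = ev κ p (s, t) := rfl
  rw [v0, v1, v2, ev_sub, ev_c, e1, e2]
  module

end IsFrameFamily

/-! ### Motions and solutions of the evolution equation -/

section Solutions

variable {I : Set ℝ} {p : DiffPoly} {l : ℝ}

/-- The evolution equation in terms of the partial derivative `κ_t` of the smooth function `κ`. -/
theorem isSolution_iff (hI : IsOpen I) {f : DiffPoly} {κ : ℝ → ℝ → ℝ} :
    IsSolution f I κ ↔ ContDiffOn ℝ ∞ (fun x : ℝ × ℝ => κ x.1 x.2) (Set.univ ×ˢ I) ∧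
      ∀ x ∈ (Set.univ : Set ℝ) ×ˢ I, fderiv ℝ (ev κ (u 0)) x (0, 1) = -ev κ f x := by
  refine and_congr_right fun hκ => ?_
  have hd : ∀ x ∈ (Set.univ : Set ℝ) ×ˢ I,
      deriv (fun τ => κ x.1 τ) x.2 = fderiv ℝ (ev κ (u 0)) x (0, 1) := fun x hx => by
    rw [fderiv_ev_right_u_zero]
    exact (hasDerivAt_right (differentiableAt_of_strip hI hκ hx)).deriv
  constructor
  · intro h x hx
    rw [← hd x hx, eq_neg_iff_add_eq_zero]
    exact h x.1 x.2 hx.2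
  · intro h s t ht
    have hx : (s, t) ∈ (Set.univ : Set ℝ) ×ˢ I := ⟨Set.mem_univ _, ht⟩
    rw [hd (s, t) hx, h (s, t) hx]
    exact neg_add_cancel _

theorem IsIntegralCurve.isSolution (hI : IsOpen I) (hp : HasPrimitive p) {γ : ℝ → ℝ → RP2}
    (h : IsIntegralCurve p l I γ) : IsSolution (opS p + c l * u 1) I (motionCurvature γ) :=
  (isSolution_iff hI).mpr ⟨(h.1.isFrameFamily hI fun _ _ => rfl).curvature_smooth,
    (h.evolution hI hp fun _ _ => rfl).2⟩

theorem contDiffOn_ev_matrix (hI : IsOpen I) {κ : ℝ → ℝ → ℝ}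
    (hκ : ContDiffOn ℝ ∞ (fun x : ℝ × ℝ => κ x.1 x.2) (Set.univ ×ˢ I))
    (M : Fin 3 → Fin 3 → DiffPoly) :
    ContDiffOn ℝ ∞ (fun x i j => ev κ (M i j) x) (Set.univ ×ˢ I) :=
  contDiffOn_pi.mpr fun i => contDiffOn_pi.mpr fun j => contDiffOn_ev hI hκ (M i j)

/-- Two integral curves with the same curvature and the same initial curve have frames which solve
the same linear system with the same initial value. -/
theorem IsIntegralCurve.eq_of_curvature_eq (hI : IsOpen I) (hIc : I.OrdConnected)
    (hp : HasPrimitive p) {κ : ℝ → ℝ → ℝ} {γ γ' : ℝ → ℝ → RP2} (h : IsIntegralCurve p l I γ)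
    (h' : IsIntegralCurve p l I γ') {t₀ : ℝ} (ht₀ : t₀ ∈ I) (h0 : ∀ s, γ s t₀ = γ' s t₀)
    (hκ : ∀ t ∈ I, curvature (atTime γ t) = fun s => κ s t)
    (hκ' : ∀ t ∈ I, curvature (atTime γ' t) = fun s => κ s t) (s : ℝ) {t : ℝ} (ht : t ∈ I) :
    γ s t = γ' s t := by
  have hF := h.1.isFrameFamily hI hκ
  have hF' := h'.1.isFrameFamily hI hκ'
  have hx : (s, t) ∈ (Set.univ : Set ℝ) ×ˢ I := ⟨Set.mem_univ _, ht⟩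
  have e0 : atTime γ t₀ = atTime γ' t₀ := funext h0
  have e := frame_unique (isOpen_strip hI) (convex_univ.prod hIc.convex)
    (contDiffOn_ev_matrix hI hF.curvature_smooth structureMatrix)
    (contDiffOn_ev_matrix hI hF.curvature_smooth (evolutionMatrix p l))
    (p₀ := (0, t₀)) ⟨Set.mem_univ _, ht₀⟩ (hF.smooth.differentiableOn (by simp))
    (hF'.smooth.differentiableOn (by simp)) hF.fderiv_left (h.evolution hI hp hκ).1
    hF'.fderiv_left (h'.evolution hI hp hκ').1 (by simp only [motionFrame, e0]) (s, t) hx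
  obtain ⟨h1, e1⟩ := (isCanonicalLift_canonicalLift (h.1.2 t ht).1).lift s
  obtain ⟨h2, e2⟩ := (isCanonicalLift_canonicalLift (h'.1.2 t ht).1).lift s
  have e3 : canonicalLift (atTime γ t) s = canonicalLift (atTime γ' t) s := by
    simpa [motionFrame, curveFrame] using congrFun e 0
  change atTime γ t s = atTime γ' t s
  rw [e1, e2]
  congr 1

/-- Integration of the frame equations along a solution; both coefficient matrices are traceless, so
the frame stays unimodular. -/
theorem IsSolution.exists_isFrameFamily (hI : IsOpen I) (hIc : I.OrdConnected) (hp : HasPrimitive p)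
    {κ : ℝ → ℝ → ℝ} (hκ : IsSolution (opS p + c l * u 1) I κ) {t₀ : ℝ} (ht₀ : t₀ ∈ I) {Y₀ : Frame}
    (hY₀ : det3 (Y₀ 0) (Y₀ 1) (Y₀ 2) = 1) :
    ∃ Y, IsFrameFamily I κ Y ∧ Y (0, t₀) = Y₀ ∧ ∀ x ∈ (Set.univ : Set ℝ) ×ˢ I,
      fderiv ℝ Y x (0, 1) = rowOp (fun i j => ev κ (evolutionMatrix p l i j) x) (Y x) := by
  obtain ⟨hκs, hE⟩ := (isSolution_iff hI).mp hκ
  have hU := isOpen_strip hI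
  have hUc : Convex ℝ ((Set.univ : Set ℝ) ×ˢ I) := convex_univ.prod hIc.convex
  have hp₀ : ((0 : ℝ), t₀) ∈ (Set.univ : Set ℝ) ×ˢ I := ⟨Set.mem_univ _, ht₀⟩
  obtain ⟨Y, h0, hY, hYd⟩ := exists_frame hU hUc (contDiffOn_ev_matrix hI hκs structureMatrix)
    (contDiffOn_ev_matrix hI hκs (evolutionMatrix p l))
    (fun x hx => isFlat_of_solution hI hκs hp hE hx) hp₀ Y₀
  refine ⟨Y, ⟨hκs, hY, fun x hx => (hYd x hx).1, fun x hx => ?_⟩, h0, fun x hx => (hYd x hx).2⟩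
  have hY' := contDiffOn_pi.mp hY
  have hF := (ContDiffOn.det3 (hY' 0) (hY' 1) (hY' 2)).differentiableOn (by simp)
  have hzero : Set.EqOn (fderiv ℝ fun x => det3 (Y x 0) (Y x 1) (Y x 2)) 0
      ((Set.univ : Set ℝ) ×ˢ I) := by
    intro x hx
    have hdY := differentiableAt_of_strip hI hY hx
    have hdF := hF.differentiableAt (hU.mem_nhds hx)
    have htr := congrArg (fun P => ev κ P x) (trace_prolong_velocity p l)
    simp only [ev_add, ev_zero] at htr
    have hs := fderiv_det3_of_trace_eq_zero hdY hdF (hYd x hx).1 (by simp [structureMatrix])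
    have ht := fderiv_det3_of_trace_eq_zero hdY hdF (hYd x hx).2 htr
    ext
    · simpa using hs
    · simpa using ht
  rw [hU.is_const_of_fderiv_eq_zero hUc.isPreconnected hF hzero hx hp₀, h0, hY₀]

/-- The motion swept out by the frames which solve the linear systems along the given solution. At
time `t₀` the frame of `γ₀` solves the same equation in `s`, whence the initial condition. -/
theorem IsSolution.exists_isIntegralCurve (hI : IsOpen I) (hIc : I.OrdConnected)
    (hp : HasPrimitive p) {κ : ℝ → ℝ → ℝ} (hκ : IsSolution (opS p + c l * u 1) I κ) {t₀ : ℝ}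
    (ht₀ : t₀ ∈ I) {γ₀ : ℝ → RP2} (hγ₀ : IsUnitSpeedGeneric γ₀)
    (hκ₀ : ∀ s, curvature γ₀ s = κ s t₀) :
    ∃ γ : ℝ → ℝ → RP2, IsIntegralCurve p l I γ ∧ (∀ s, γ s t₀ = γ₀ s) ∧
      ∀ s, ∀ t ∈ I, motionCurvature γ s t = κ s t := by
  have hc := isCanonicalLift_canonicalLift hγ₀.1
  obtain ⟨Y, hF, h0, hT⟩ := hκ.exists_isFrameFamily hI hIc hp ht₀ (Y₀ := curveFrame γ₀ 0)
    (by simpa [curveFrame] using hc.det_eq_one 0)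
  refine ⟨sweptCurve Y, hF.isIntegralCurve_sweptCurve hI hT, fun s => ?_, fun s t ht =>
    congrFun (hF.curvature_sweptCurve hI ht).2 s⟩
  have hx : ∀ s : ℝ, (s, t₀) ∈ (Set.univ : Set ℝ) ×ˢ I := fun s => ⟨Set.mem_univ _, ht₀⟩
  have ek : curvature γ₀ = fun s => κ s t₀ := funext hκ₀
  have ha : Continuous fun s i j => ev κ (structureMatrix i j) (s, t₀) :=
    (contDiff_slice (contDiffOn_ev_matrix hI hF.curvature_smooth structureMatrix) ht₀).continuous
  have e := frame_unique_line ha (Y := fun s => Y (s, t₀)) (Y' := curveFrame γ₀)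
    (fun s => by
      rw [← hF.fderiv_left _ (hx s)]
      exact hasDerivAt_left (differentiableAt_of_strip hI hF.smooth (hx s)))
    (fun s => by
      have := hγ₀.hasDerivAt_curveFrame s
      rwa [ek] at this)
    h0 s
  have e0 : Y (s, t₀) 0 = canonicalLift γ₀ s := by simpa [curveFrame] using congrFun e 0
  obtain ⟨h1, e1⟩ := hF.sweptCurve_eq ht₀ s
  obtain ⟨h2, e2⟩ := hc.lift s
  rw [e1, e2]
  congr 1

end Solutions

end KK

end

theorem mainTheorem1 (n : ℕ) :
    -- the recursion which defines the hierarchy makes sense at every stage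
    (KK.D (KK.q n) = KK.opD (KK.h n) ∧ KK.q n ∈ KK.potentials) ∧
    KK.v n ∈ KK.potentials ∧
    -- the evolution equation induced by the vector field is the `n`-th equation of the hierarchy
    KK.opS (KK.v n) + KK.c (KK.lam n) * KK.u 1 = KK.opD (KK.h n) ∧
    -- along every integral curve the curvature solves the `n`-th equation
    (∀ (I : Set ℝ) (γ : ℝ → ℝ → KK.RP2), IsOpen I → I.OrdConnected →
      KK.IsIntegralCurve (KK.v n) (KK.lam n) I γ →
      KK.IsSolution (KK.opD (KK.h n)) I (KK.motionCurvature γ)) ∧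
    -- every solution is the curvature of exactly one integral curve with given initial curve
    (∀ (I : Set ℝ) (t₀ : ℝ) (κ : ℝ → ℝ → ℝ) (γ₀ : ℝ → KK.RP2),
      IsOpen I → I.OrdConnected → t₀ ∈ I →
      KK.IsSolution (KK.opD (KK.h n)) I κ →
      KK.IsUnitSpeedGeneric γ₀ → (∀ s, KK.curvature γ₀ s = κ s t₀) →
      (∃ γ : ℝ → ℝ → KK.RP2, KK.IsIntegralCurve (KK.v n) (KK.lam n) I γ ∧
        (∀ s, γ s t₀ = γ₀ s) ∧ ∀ s, ∀ t ∈ I, KK.motionCurvature γ s t = κ s t) ∧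
      (∀ γ γ' : ℝ → ℝ → KK.RP2,
        KK.IsIntegralCurve (KK.v n) (KK.lam n) I γ →
        KK.IsIntegralCurve (KK.v n) (KK.lam n) I γ' →
        (∀ s, γ s t₀ = γ₀ s) → (∀ s, γ' s t₀ = γ₀ s) →
        (∀ s, ∀ t ∈ I, KK.motionCurvature γ s t = κ s t) →
        (∀ s, ∀ t ∈ I, KK.motionCurvature γ' s t = κ s t) →
        ∀ s, ∀ t ∈ I, γ s t = γ' s t)) := by
  obtain ⟨hq, -, r, hr, -⟩ := KK.exists_primitives_hierarchy n
  obtain ⟨hv, hS⟩ := KK.v_spec n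
  refine ⟨⟨hq, KK.mem_potentials_of_D_eq hr⟩, hv.mem_potentials, hS, ?_, ?_⟩
  · intro I γ hI _ hγ
    rw [← hS]
    exact hγ.isSolution hI hv
  · intro I t₀ κ γ₀ hI hIc ht₀ hκ hγ₀ hκ₀
    rw [← hS] at hκ
    refine ⟨hκ.exists_isIntegralCurve hI hIc hv ht₀ hγ₀ hκ₀, ?_⟩
    intro γ γ' hγ hγ' h0 h0' hk hk' s t ht
    exact hγ.eq_of_curvature_eq hI hIc hv hγ' ht₀ (fun s => (h0 s).trans (h0' s).symm)
      (fun t ht => funext fun s => hk s t ht) (fun t ht => funext fun s => hk' s t ht) s ht
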